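/- **Theorem 6.1 (Profile decomposition).** *Notation.* Work on $\mathbb{R}^4$ with complex-valued functions, and set $\|f\|_{H^1}^2=\|f\|_{L^2}^2+\|\nabla f\|_{L^2}^2$. For $s\in\mathbb{R}$, $y\in\mathbb{R}^4$ and $(f,g)\in H^1\times L^2$ let $$\mathfrak{g}[s,y](f,g)=\big(e^{-is\Delta}\tau_yf,\;e^{-is|\nabla|}\tau_yg\big),\qquad (\tau_y\phi)(x)=\phi(x-y),$$ and let the Zakharov energy be $$\mathcal{E}_Z(f,g)=\int_{\mathbb{R}^4}\tfrac12|\nabla f|^2+\tfrac14|g|^2+\tfrac12\,\mathrm{Re}(g)\,|f|^2\,dx .$$ Fix $\chi\in C_0^\infty(\mathbb{R})$ with $\operatorname{supp}\chi\subset[\frac12,2]$, $0\le\chi\le1$ and $\sum_{\lambda\in2^{\mathbb{Z}}}\chi(\lambda^{-1}r)=1$ for all $r>0$. For $\lambda\in2^{\mathbb{N}}=\{1,2,4,\dots\}$ let $P_\lambda=\chi(\lambda^{-1}|\nabla|)$ if $\lambda>1$ and $P_1=\sum_{\mu\in2^{\mathbb{Z}},\,\mu\le1}\chi(\mu^{-1}|\nabla|)$,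 and put $$\|u\|_Y=\sup_{\lambda\in2^{\mathbb{N}}}\lambda^{-4}\|P_\lambda u\|_{L^\infty_{t,x}(\mathbb{R}\times\mathbb{R}^4)} .$$ *Statement.* Let $(f_n,g_n)_{n\in\mathbb{N}}$ be a bounded sequence in $H^1\times L^2$. Then, after passing to a subsequence, there exist $J^*\in\{0,1,2,\dots\}\cup\{\infty\}$ and, for every integer $j$ with $1\le j\le J^*$, a profile $(f^{(j)},g^{(j)})\in H^1\times L^2$, $(f^{(j)},g^{(j)})\neq(0,0)$, and a sequence $(t_n^{(j)},x_n^{(j)})_{n}$ in $\mathbb{R}\times\mathbb{R}^4$, such that, with $\mathfrak{g}_n^{(j)}=\mathfrak{g}[t_n^{(j)},x_n^{(j)}]$ and with $(w_n^{(J)},e_n^{(J)})\in H^1\times L^2$ defined for every integer $0\le J\le J^*$ by $$(f_n,g_n)=\sum_{j=1}^{J}\mathfrak{g}_n^{(j)}(f^{(j)},g^{(j)})+(w_n^{(J)},e_n^{(J)}),$$ the following hold. 1. For every integer $0\le J\le J^*$, $$\lim_{n\to\infty}\Big(\|f_n\|_{H^1}^2-\sum_{j=1}^J\|f^{(j)}\|_{H^1}^2-\|w_n^{(J)}\|_{H^1}^2\Big)=0,\qquad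 \lim_{n\to\infty}\Big(\|g_n\|_{L^2}^2-\sum_{j=1}^J\|g^{(j)}\|_{L^2}^2-\|e_n^{(J)}\|_{L^2}^2\Big)=0,$$ $$\lim_{n\to\infty}\Big(\mathcal{E}_Z(f_n,g_n)-\sum_{j=1}^J\mathcal{E}_Z\big(\mathfrak{g}_n^{(j)}(f^{(j)},g^{(j)})\big)-\mathcal{E}_Z(w_n^{(J)},e_n^{(J)})\Big)=0.$$ 2. The free evolution of the error tends to zero in $Y\times Y$: $$\lim_{J\to J^*}\limsup_{n\to\infty}\Big(\|e^{it\Delta}w_n^{(J)}\|_Y+\|e^{it|\nabla|}e_n^{(J)}\|_Y\Big)=0,$$ where for finite $J^*$ the limit $J\to J^*$ means the value at $J=J^*$. 3. For all $j\neq k$ with $1\le j,k\le J^*$, $$\lim_{n\to\infty}\big(|t_n^{(j)}-t_n^{(k)}|+|x_n^{(j)}-x_n^{(k)}|\big)=\infty,$$ and for each $1\le j\le J^*$ either $t_n^{(j)}=0$ for all $n$, or $|t_n^{(j)}|\to\infty$ as $n\to\infty$. -/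

import Mathlib

open MeasureTheory Filter Topology FourierTransform
open scoped ENNReal SchwartzMap LineDeriv ContDiff

noncomputable section

namespace Zakharov

/-- The spatial domain `ℝ⁴` with its Euclidean norm. -/
abbrev R4 : Type := EuclideanSpace ℝ (Fin 4)

/-- The complex Hilbert space `L²(ℝ⁴)`. -/
abbrev L2 : Type := Lp ℂ 2 (volume : Measure R4)

/-! ### The Sobolev space `H¹` -/

/-- The Sobolev space `H¹(ℝ⁴)`, as a subspace of `L²(ℝ⁴)`. (The norm that this subspace inherits
from `L²` is never used; the `H¹` norm is `h1NormSq` below.) -/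
def H1 : Submodule ℂ L2 where
  carrier := {f | TemperedDistribution.MemSobolev 1 2 (f : 𝓢'(R4, ℂ))}
  zero_mem' := by
    change TemperedDistribution.MemSobolev 1 2 (((0 : L2)) : 𝓢'(R4, ℂ))
    rw [← Lp.toTemperedDistributionCLM_apply, map_zero]
    exact TemperedDistribution.memSobolev_fun_zero R4 ℂ 1 2
  add_mem' := by
    intro f g hf hg
    change TemperedDistribution.MemSobolev 1 2 ((f + g : L2) : 𝓢'(R4, ℂ))
    rw [← Lp.toTemperedDistributionCLM_apply, map_add]
    exact TemperedDistribution.MemSobolev.add hf hg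
  smul_mem' := by
    intro c f hf
    change TemperedDistribution.MemSobolev 1 2 ((c • f : L2) : 𝓢'(R4, ℂ))
    rw [← Lp.toTemperedDistributionCLM_apply, map_smul]
    exact TemperedDistribution.MemSobolev.smul c hf

theorem exists_weakPartial (f : H1) (j : Fin 4) :
    ∃ h : L2, (h : 𝓢'(R4, ℂ)) =
      ∂_{(EuclideanSpace.single j (1 : ℝ) : R4)} ((f : L2) : 𝓢'(R4, ℂ)) := by
  have hf : TemperedDistribution.MemSobolev 1 2 ((f : L2) : 𝓢'(R4, ℂ)) := f.2
  have h := hf.lineDerivOp (m := (EuclideanSpace.single j (1 : ℝ) : R4))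
  rw [sub_self, TemperedDistribution.memSobolev_zero_iff] at h
  obtain ⟨h', e⟩ := h
  exact ⟨h', e.symm⟩

/-- The weak partial derivative `∂ⱼ f ∈ L²` of `f ∈ H¹`: the unique element of `L²` that represents
the distributional derivative of `f` in the `j`-th coordinate direction. -/
def weakPartial (f : H1) (j : Fin 4) : L2 := (exists_weakPartial f j).choose

theorem weakPartial_spec (f : H1) (j : Fin 4) :
    (weakPartial f j : 𝓢'(R4, ℂ)) =
      ∂_{(EuclideanSpace.single j (1 : ℝ) : R4)} ((f : L2) : 𝓢'(R4, ℂ)) :=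
  (exists_weakPartial f j).choose_spec

/-- `‖f‖²_{H¹} = ‖f‖²_{L²} + ‖∇f‖²_{L²}`. -/
def h1NormSq (f : H1) : ℝ := ‖(f : L2)‖ ^ 2 + ∑ j : Fin 4, ‖weakPartial f j‖ ^ 2

/-- The energy `∫ ½|∇f|² + ¼|g|² + ½ Re(g)|f|² dx` of the Zakharov system. -/
def energy (f : H1) (g : L2) : ℝ :=
  ∫ x : R4, ((1 / 2) * ∑ j : Fin 4, ‖(weakPartial f j) x‖ ^ 2 + (1 / 4) * ‖g x‖ ^ 2
    + (1 / 2) * (g x).re * ‖(f : L2) x‖ ^ 2)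

/-! ### Fourier multipliers on `L²` -/

/-- The Fourier multiplier `f ↦ 𝓕⁻¹ (m 𝓕 f)` on `L²` with bounded symbol `m`. The Fourier transform
is normalised as `𝓕 f ξ = ∫ exp (-2πi x·ξ) f x dx`, so that `|∇|` has the symbol `2π|ξ|`
and `Δ` has the symbol `-(2π|ξ|)²`. -/
def multiplier (m : R4 → ℂ) (hm : MemLp m ∞ volume) (f : L2) : L2 :=
  𝓕⁻ ((hm.toLp m) • (𝓕 f) : L2)

/-- A continuous phase `exp (i θ)` is a bounded symbol. -/
theorem memLp_phase {θ : R4 → ℝ} (hθ : Continuous θ) :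
    MemLp (fun ξ => Complex.exp (θ ξ * Complex.I)) ∞ volume := by
  refine memLp_top_of_bound (C := 1) ?_ ?_
  · exact (by fun_prop : Continuous fun ξ => Complex.exp (θ ξ * Complex.I)).aestronglyMeasurable
  · filter_upwards with ξ
    rw [Complex.norm_exp_ofReal_mul_I]

/-- The Schrödinger propagator `exp (i t Δ)`. -/
def schrodinger (t : ℝ) (f : L2) : L2 :=
  multiplier (fun ξ => Complex.exp ((-(t * (2 * Real.pi * ‖ξ‖) ^ 2) : ℝ) * Complex.I))
    (memLp_phase (by fun_prop)) f

/-- The half-wave propagator `exp (i t |∇|)`. -/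
def halfWave (t : ℝ) (g : L2) : L2 :=
  multiplier (fun ξ => Complex.exp ((t * (2 * Real.pi * ‖ξ‖) : ℝ) * Complex.I))
    (memLp_phase (by fun_prop)) g

/-- The translation `(τ_y f)(x) = f (x - y)`. -/
def translate (y : R4) (f : L2) : L2 :=
  Lp.compMeasurePreserving (fun x : R4 => x - y) (measurePreserving_sub_right volume y) f

/-! ### `H¹` is invariant under multipliers and translations -/

theorem hasTemperateGrowth_weight (s : ℝ) :
    (fun ξ : R4 => (((1 + ‖ξ‖ ^ 2) ^ (s / 2) : ℝ) : ℂ)).HasTemperateGrowth := by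
  fun_prop

theorem memLp_weight_inv :
    MemLp (fun ξ : R4 => (((1 + ‖ξ‖ ^ 2) ^ ((-1 : ℝ) / 2) : ℝ) : ℂ)) ∞ volume := by
  refine memLp_top_of_bound (C := 1) ?_ ?_
  · exact (hasTemperateGrowth_weight (-1)).1.continuous.aestronglyMeasurable
  · filter_upwards with ξ
    rw [Complex.norm_real, Real.norm_eq_abs, abs_of_nonneg (by positivity)]
    exact Real.rpow_le_one_of_one_le_of_nonpos (by simp) (by norm_num)

theorem toTemperedDistribution_injective {f g : L2}
    (h : (f : 𝓢'(R4, ℂ)) = (g : 𝓢'(R4, ℂ))) : f = g := by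
  have := LinearMap.ker_eq_bot.1
    (Lp.ker_toTemperedDistributionCLM_eq_bot (E := R4) (F := ℂ) (μ := volume) (p := 2))
  exact this h

/-- `f ∈ H¹` if and only if `𝓕 f = (1 + |ξ|²)^{-1/2} h` for some `h ∈ L²`. -/
theorem mem_H1_iff (f : L2) :
    f ∈ H1 ↔ ∃ h : L2, 𝓕 f = ((memLp_weight_inv.toLp _) • h : L2) := by
  have key : f ∈ H1 ↔ ∃ h : L2, TemperedDistribution.smulLeftCLM ℂ
      (fun ξ : R4 => (((1 + ‖ξ‖ ^ 2) ^ ((1 : ℝ) / 2) : ℝ) : ℂ)) ((𝓕 f : L2) : 𝓢'(R4, ℂ))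
        = (h : 𝓢'(R4, ℂ)) := by
    rw [← Lp.fourier_toTemperedDistribution_eq]
    exact TemperedDistribution.memSobolev_iff_exists_smulLeftCLM_fourier
  have w1 : ((fun ξ : R4 => (((1 + ‖ξ‖ ^ 2) ^ ((1 : ℝ) / 2) : ℝ) : ℂ)) *
      (fun ξ : R4 => (((1 + ‖ξ‖ ^ 2) ^ ((-1 : ℝ) / 2) : ℝ) : ℂ))) = fun _ => 1 := by
    ext ξ
    rw [Pi.mul_apply]
    rw [← Complex.ofReal_mul, ← Real.rpow_add (by positivity)]
    norm_num
  rw [key]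
  constructor
  · rintro ⟨h, hh⟩
    refine ⟨h, toTemperedDistribution_injective ?_⟩
    rw [Lp.toTemperedDistribution_smul_eq (hasTemperateGrowth_weight (-1)), ← hh,
      TemperedDistribution.smulLeftCLM_smulLeftCLM_apply (hasTemperateGrowth_weight 1)
        (hasTemperateGrowth_weight (-1)), w1, TemperedDistribution.smulLeftCLM_const, one_smul]
  · rintro ⟨h, hh⟩
    refine ⟨h, ?_⟩
    rw [hh, Lp.toTemperedDistribution_smul_eq (hasTemperateGrowth_weight (-1)),
      TemperedDistribution.smulLeftCLM_smulLeftCLM_apply (hasTemperateGrowth_weight (-1))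
        (hasTemperateGrowth_weight 1), mul_comm, w1, TemperedDistribution.smulLeftCLM_const,
      one_smul]

theorem smul_smul_comm' (a b : Lp ℂ ∞ (volume : Measure R4)) (h : L2) :
    (a • (b • h : L2) : L2) = (b • (a • h : L2) : L2) := by
  apply Lp.ext
  filter_upwards [Lp.coeFn_lpSMul (r := 2) a (b • h : L2), Lp.coeFn_lpSMul (r := 2) b h,
    Lp.coeFn_lpSMul (r := 2) b (a • h : L2), Lp.coeFn_lpSMul (r := 2) a h] with x h1 h2 h3 h4
  rw [h1, h3]
  simp only [Pi.smul_apply', h2, h4, smul_eq_mul]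
  ring

theorem mem_H1_of_fourier_eq_smul {f f' : L2} (a : Lp ℂ ∞ (volume : Measure R4))
    (h : 𝓕 f' = (a • 𝓕 f : L2)) (hf : f ∈ H1) : f' ∈ H1 := by
  rw [mem_H1_iff] at hf ⊢
  obtain ⟨u, hu⟩ := hf
  refine ⟨(a • u : L2), ?_⟩
  rw [h, hu, smul_smul_comm']

theorem multiplier_mem_H1 (m : R4 → ℂ) (hm : MemLp m ∞ volume) {f : L2} (hf : f ∈ H1) :
    multiplier m hm f ∈ H1 :=
  mem_H1_of_fourier_eq_smul (hm.toLp m) (FourierTransform.fourier_fourierInv_eq _) hf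

theorem continuous_smul_right' (a : Lp ℂ ∞ (volume : Measure R4)) :
    Continuous fun f : L2 => (a • f : L2) := by
  refine (LipschitzWith.of_dist_le_mul (K := ‖a‖₊) fun f g => ?_).continuous
  rw [dist_eq_norm, dist_eq_norm]
  have h : (a • f : L2) - (a • g : L2) = (a • (f - g) : L2) := by
    rw [sub_eq_add_neg f g, Lp.add_smul, Lp.smul_neg, sub_eq_add_neg]
  rw [h]
  exact Lp.norm_smul_le a (f - g)

theorem fourier_translate (y : R4) (f : L2) :
    𝓕 (translate y f) = (((memLp_phase (θ := fun ξ => -(2 * Real.pi * inner ℝ y ξ))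
      (by fun_prop)).toLp _) • 𝓕 f : L2) := by
  refine DenseRange.induction_on (p := fun f : L2 => 𝓕 (translate y f) =
    (((memLp_phase (θ := fun ξ => -(2 * Real.pi * inner ℝ y ξ))
      (by fun_prop)).toLp _) • 𝓕 f : L2))
    (SchwartzMap.denseRange_toLpCLM (F := ℂ) (E := R4) (μ := volume) (p := 2)
      ENNReal.ofNat_ne_top) f ?_ ?_
  · refine isClosed_eq ?_ ?_
    · exact (continuous_fourier (E := L2)).comp (Lp.isometry_compMeasurePreserving _).continuous
    · exact (continuous_smul_right' _).comp (continuous_fourier (E := L2))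
  · intro u
    have h1 : translate y (u.toLp 2) = (u.compSubConstCLM ℂ y).toLp 2 := by
      apply Lp.ext
      filter_upwards [Lp.coeFn_compMeasurePreserving (u.toLp 2)
          (measurePreserving_sub_right (volume : Measure R4) y),
        (measurePreserving_sub_right (volume : Measure R4) y).quasiMeasurePreserving.ae_eq_comp
          (u.coeFn_toLp 2 (volume : Measure R4)), (u.compSubConstCLM ℂ y).coeFn_toLp 2] with x a b c
      rw [c]
      change (Lp.compMeasurePreserving _ _ _ : L2) x = _
      rw [a]
      exact b
    rw [SchwartzMap.toLpCLM_apply, h1, SchwartzMap.toLp_fourier_eq, SchwartzMap.toLp_fourier_eq]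
    apply Lp.ext
    filter_upwards [(𝓕 (u.compSubConstCLM ℂ y)).coeFn_toLp 2, (𝓕 u).coeFn_toLp 2,
      Lp.coeFn_lpSMul (r := 2) ((memLp_phase (θ := fun ξ => -(2 * Real.pi * inner ℝ y ξ))
        (by fun_prop)).toLp _) ((𝓕 u).toLp 2),
      (memLp_phase (θ := fun ξ : R4 => -(2 * Real.pi * inner ℝ y ξ))
        (by fun_prop)).coeFn_toLp] with ξ a b c d
    rw [a, c, Pi.smul_apply', b, d, SchwartzMap.fourier_coe, SchwartzMap.fourier_coe]
    have e := congrFun (VectorFourier.fourierIntegral_comp_add_right Real.fourierChar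
      (volume : Measure R4) (innerₗ R4) (u : R4 → ℂ) (-y)) ξ
    have e2 : ((u.compSubConstCLM ℂ y : 𝓢(R4, ℂ)) : R4 → ℂ) = (u : R4 → ℂ) ∘ fun v => v + -y := by
      ext v
      simp [sub_eq_add_neg]
    rw [e2]
    refine e.trans ?_
    rw [Circle.smul_def, Real.fourierChar_apply]
    simp only [innerₗ_apply_apply, inner_neg_left]
    congr 2
    push_cast
    ring

theorem translate_mem_H1 (y : R4) {f : L2} (hf : f ∈ H1) : translate y f ∈ H1 :=
  mem_H1_of_fourier_eq_smul _ (fourier_translate y f) hf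

/-- The group element `𝔤[s, y] (f, g) = (exp (-i s Δ) τ_y f, exp (-i s |∇|) τ_y g)`,
acting on `H¹ × L²`. -/
def groupElement (s : ℝ) (y : R4) (p : H1 × L2) : H1 × L2 :=
  (⟨schrodinger (-s) (translate y p.1), multiplier_mem_H1 _ _ (translate_mem_H1 y p.1.2)⟩,
    halfWave (-s) (translate y p.2))

/-! ### Littlewood–Paley projections and the norm `Y` -/

/-- A smooth Littlewood–Paley cutoff on `ℝ`. -/
structure Cutoff where
  /-- The underlying function. -/
  toFun : ℝ → ℝ
  contDiff : ContDiff ℝ ∞ toFun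
  tsupport_subset : tsupport toFun ⊆ Set.Icc (1 / 2) 2
  nonneg : ∀ r, 0 ≤ toFun r
  le_one : ∀ r, toFun r ≤ 1
  hasSum : ∀ r : ℝ, 0 < r → HasSum (fun k : ℤ => toFun (((2 : ℝ) ^ k)⁻¹ * r)) 1

/-- The symbol, as a function of `r = |∇|`, of the inhomogeneous Littlewood–Paley projection `P_λ`
with `λ = 2 ^ k`: it is `∑_{μ ∈ 2^ℤ, μ ≤ 1} χ (r / μ)` for `k = 0` and `χ (r / 2 ^ k)` for `k ≥ 1`. -/
def lpSymbol (χ : Cutoff) (k : ℕ) (r : ℝ) : ℝ :=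
  if k = 0 then ∑' i : ℕ, χ.toFun (((2 : ℝ) ^ (-(i : ℤ)))⁻¹ * r)
  else χ.toFun (((2 : ℝ) ^ k)⁻¹ * r)

theorem Cutoff.apply_zero (χ : Cutoff) : χ.toFun 0 = 0 := by
  by_contra h
  have := χ.tsupport_subset (subset_tsupport _ h)
  norm_num at this

theorem Cutoff.summable (χ : Cutoff) {r : ℝ} (hr : 0 ≤ r) :
    Summable fun i : ℕ => χ.toFun (((2 : ℝ) ^ (-(i : ℤ)))⁻¹ * r) := by
  rcases hr.eq_or_lt with rfl | hr
  · simp [χ.apply_zero, summable_zero]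
  · exact (χ.hasSum r hr).summable.comp_injective (i := fun i : ℕ => -(i : ℤ))
      (fun a b h => by simpa using h)

theorem lpSymbol_nonneg (χ : Cutoff) (k : ℕ) (r : ℝ) : 0 ≤ lpSymbol χ k r := by
  unfold lpSymbol
  split_ifs
  · exact tsum_nonneg fun i => χ.nonneg _
  · exact χ.nonneg _

theorem lpSymbol_le_one (χ : Cutoff) (k : ℕ) {r : ℝ} (hr : 0 ≤ r) : lpSymbol χ k r ≤ 1 := by
  unfold lpSymbol
  split_ifs
  · rcases hr.eq_or_lt with rfl | hr
    · simp [χ.apply_zero]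
    · rw [← (χ.hasSum r hr).tsum_eq]
      exact _root_.tsum_comp_le_tsum_of_inj (χ.hasSum r hr).summable (fun k => χ.nonneg _)
        (i := fun i : ℕ => -(i : ℤ)) (fun a b h => by simpa using h)
  · exact χ.le_one _

theorem memLp_lpSymbol (χ : Cutoff) (k : ℕ) :
    MemLp (fun ξ : R4 => ((lpSymbol χ k (2 * Real.pi * ‖ξ‖) : ℝ) : ℂ)) ∞ volume := by
  have hc := χ.contDiff.continuous
  refine memLp_top_of_bound (C := 1) ?_ ?_
  · refine (Complex.measurable_ofReal.comp ?_).aestronglyMeasurable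
    by_cases hk : k = 0
    · simp only [lpSymbol, hk, if_true]
      refine measurable_of_tendsto_metrizable (f := fun N : ℕ => fun ξ : R4 =>
        ∑ i ∈ Finset.range N, χ.toFun (((2 : ℝ) ^ (-(i : ℤ)))⁻¹ * (2 * Real.pi * ‖ξ‖))) ?_ ?_
      · intro N
        fun_prop
      · rw [tendsto_pi_nhds]
        intro ξ
        exact (χ.summable (by positivity)).hasSum.tendsto_sum_nat
    · simp only [lpSymbol, hk, if_false]
      fun_prop
  · filter_upwards with ξ
    rw [Complex.norm_real, Real.norm_eq_abs, abs_of_nonneg (lpSymbol_nonneg χ k _)]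
    exact lpSymbol_le_one χ k (by positivity)

/-- The inhomogeneous Littlewood–Paley projection `P_λ` with `λ = 2 ^ k`. -/
def lpProj (χ : Cutoff) (k : ℕ) (f : L2) : L2 :=
  multiplier (fun ξ => ((lpSymbol χ k (2 * Real.pi * ‖ξ‖) : ℝ) : ℂ)) (memLp_lpSymbol χ k) f

/-- The norm `‖u‖_Y = sup_{λ ∈ 2^ℕ} λ⁻⁴ ‖P_λ u‖_{L^∞_{t,x}}` of a space-time function `u`, given as
a curve `t ↦ u t` in `L²`. The `L^∞_{t,x}` norm is computed as the essential supremum over `t` of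
the spatial `L^∞` norm. -/
def yNorm (χ : Cutoff) (u : ℝ → L2) : ℝ≥0∞ :=
  ⨆ k : ℕ, ((2 : ℝ≥0∞) ^ k)⁻¹ ^ 4 *
    essSup (fun t => eLpNorm (lpProj χ k (u t)) ∞ volume) volume

/-- `limsup_{n → ∞} (‖e^{itΔ} w n‖_Y + ‖e^{it|∇|} e n‖_Y)` for a sequence `(w n, e n)`. -/
def limsupFreeY (χ : Cutoff) (r : ℕ → H1 × L2) : ℝ≥0∞ :=
  limsup (fun n => yNorm χ (fun t => schrodinger t (r n).1) + yNorm χ (fun t => halfWave t (r n).2))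
    atTop

end Zakharov

end

open MeasureTheory Filter Topology FourierTransform
open scoped ENNReal SchwartzMap LineDeriv ContDiff

noncomputable section

namespace Zakharov

/-! ### Weak convergence in Hilbert spaces -/

section Weak

variable {H : Type*} [NormedAddCommGroup H] [InnerProductSpace ℂ H] {ι : Type*}

/-! The argument is a concentration-compactness extraction, carried out on the Fourier side. Writing
f = (1 + |∇|²)^{-1/2} 𝓕⁻¹ F and g = 𝓕⁻¹ G turns H¹ × L² isometrically into L² × L² (`h1NormSq_toH1`,
`norm_sq_phaseSpace`). The operators 𝔤[s, y] become multiplications by phases, a unitary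
representation of ℝ × ℝ⁴ (`symmetry`). It is mixing: its matrix coefficients are oscillatory
integrals with integrable amplitudes, and they vanish as (s, y) → ∞. For the half-wave phase this is
Riemann–Lebesgue on almost every ray (`tendsto_integral_exp_wave`); for the Schrödinger phase,
squaring the integral (`tendsto_integral_exp_schrodinger`).

The norm Y is visible to this representation. The symbol of P_λ is square integrable, so λ⁻⁴ P_λ of
a free evolution at (t, x) is a matrix coefficient against a fixed kernel (`yNorm_le`), and the
kernels have norm O(λ⁻²) (`norm_kernel_le`). If Y does not tend to zero along a bounded sequence,
then one of finitely many kernels pairs non-trivially with the sequence moved by some (t_n, x_n). A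
weak limit in that moving frame is a profile q with limsup Y ≤ 2C‖q‖ (`exists_profile_step`).

Profiles are subtracted one after the other (`exists_profile_decomposition`). Weak limits split
squared norms, so the squares of the profile norms are summable; hence the profiles, and with them
the Y norms of the remainders, tend to zero. J* is the first stage at which the limsup of Y
vanishes, if there is one. Mixing makes the parameters diverge from each other: if two frames stayed
at bounded distance, a remainder weakly null in one could not have a nonzero limit in the other.
Successive subsequences are encoded as a decreasing sequence of filters.

For the energy, the quadratic part decouples by Pythagoras and the cubic part by showing that the
cross terms vanish (`tendsto_tri_decoupling`). Every profile is normalised so that its times are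
zero or tend to infinity. With zero times, Rellich's theorem makes the product of profile and
remainder small; with infinite times the frequency-truncated profile disperses in L^∞. The
truncation errors are absorbed by the embedding H¹(ℝ⁴) ⊆ L⁴ (`exists_sobolev`), which is critical in
dimension four. -/

/-- Weak convergence in a Hilbert space, along a filter. -/
def TendstoWeakly (l : Filter ι) (u : ι → H) (p : H) : Prop :=
  ∀ h : H, Tendsto (fun n => inner ℂ h (u n)) l (𝓝 (inner ℂ h p))

theorem TendstoWeakly.mono {l l' : Filter ι} {u : ι → H} {p : H} (h : TendstoWeakly l u p)
    (hl : l' ≤ l) : TendstoWeakly l' u p := fun k => (h k).mono_left hl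

theorem TendstoWeakly.comp {κ : Type*} {l : Filter ι} {l' : Filter κ} {u : ι → H} {p : H}
    (h : TendstoWeakly l u p) {φ : κ → ι} (hφ : Tendsto φ l' l) :
    TendstoWeakly l' (fun n => u (φ n)) p := fun k => (h k).comp hφ

theorem TendstoWeakly.sub {l : Filter ι} {u v : ι → H} {p q : H} (hu : TendstoWeakly l u p)
    (hv : TendstoWeakly l v q) : TendstoWeakly l (fun n => u n - v n) (p - q) := fun k => by
  simpa only [inner_sub_right] using (hu k).sub (hv k)

theorem tendstoWeakly_const (l : Filter ι) (p : H) : TendstoWeakly l (fun _ => p) p :=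
  fun _ => tendsto_const_nhds

theorem TendstoWeakly.unique {l : Filter ι} [l.NeBot] {u : ι → H} {p q : H}
    (hp : TendstoWeakly l u p) (hq : TendstoWeakly l u q) : p = q :=
  ext_inner_left ℂ fun h => tendsto_nhds_unique (hp h) (hq h)

/-- The pairing of a weakly convergent bounded sequence with a strongly convergent one. -/
theorem TendstoWeakly.inner_tendsto {l : Filter ι} {u h : ι → H} {p k : H} {M : ℝ}
    (hu : TendstoWeakly l u p) (hM : ∀ n, ‖u n‖ ≤ M) (hk : Tendsto h l (𝓝 k)) :
    Tendsto (fun n => inner ℂ (h n) (u n)) l (𝓝 (inner ℂ k p)) := by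
  have h1 : Tendsto (fun n => inner ℂ (h n - k) (u n)) l (𝓝 0) := by
    refine squeeze_zero_norm (a := fun n => ‖h n - k‖ * M) (fun n => ?_) ?_
    · exact (norm_inner_le_norm _ _).trans (by gcongr; exact hM n)
    · simpa using (tendsto_iff_norm_sub_tendsto_zero.1 hk).mul_const M
  simpa [inner_sub_left] using h1.add (hu k)

/-- Sequential Banach–Alaoglu in the dual, transported by the Riesz isometry. That isometry is
conjugate linear, which explains the conjugations. -/
theorem exists_tendstoWeakly [CompleteSpace H] [TopologicalSpace.SeparableSpace H]
    (u : ℕ → H) (M : ℝ) (hM : ∀ n, ‖u n‖ ≤ M) :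
    ∃ (p : H) (θ : ℕ → ℕ), StrictMono θ ∧ TendstoWeakly atTop (fun n => u (θ n)) p := by
  have hc := WeakDual.isSeqCompact_closedBall (𝕜 := ℂ) (E := H) 0 M
  obtain ⟨q, -, θ, hθ, hq⟩ := hc (x := fun n => StrongDual.toWeakDual
    (InnerProductSpace.toDual ℂ H (u n))) (fun n => by
      simpa using hM n)
  refine ⟨(InnerProductSpace.toDual ℂ H).symm (WeakDual.toStrongDual q), θ, hθ, fun h => ?_⟩
  have h1 := ((WeakDual.eval_continuous (𝕜 := ℂ) h).tendsto q).comp hq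
  have h2 := (Complex.continuous_conj.tendsto _).comp h1
  refine (h2.congr fun n => ?_).trans_eq ?_
  · simp only [Function.comp_apply]
    change (starRingEnd ℂ) (inner ℂ (u (θ n)) h) = _
    exact inner_conj_symm _ _
  · congr 1
    rw [← inner_conj_symm, InnerProductSpace.toDual_symm_apply]
    rfl

end Weak

/-! ### Weakly mixing unitary group actions -/

/-- A strongly continuous unitary representation of an additive topological group whose matrix
coefficients vanish at infinity. -/
structure MixingRep (G H : Type*) [AddCommGroup G] [TopologicalSpace G]
    [NormedAddCommGroup H] [InnerProductSpace ℂ H] where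
  /-- The underlying family of isometries. -/
  toFun : G → H →ₗᵢ[ℂ] H
  map_add : ∀ a b h, toFun (a + b) h = toFun a (toFun b h)
  map_zero : ∀ h, toFun 0 h = h
  continuous_apply : ∀ h, Continuous fun a => toFun a h
  mixing : ∀ h k, Tendsto (fun a => inner ℂ h (toFun a k)) (cocompact G) (𝓝 0)

namespace MixingRep

variable {G H : Type*} [AddCommGroup G] [TopologicalSpace G]
    [NormedAddCommGroup H] [InnerProductSpace ℂ H] {ι : Type*}

instance : CoeFun (MixingRep G H) fun _ => G → H →ₗᵢ[ℂ] H := ⟨MixingRep.toFun⟩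

variable (U : MixingRep G H)

theorem neg_apply_self (a : G) (h : H) : U (-a) (U a h) = h := by
  rw [← U.map_add, neg_add_cancel, U.map_zero]

theorem self_apply_neg (a : G) (h : H) : U a (U (-a) h) = h := by
  rw [← U.map_add, add_neg_cancel, U.map_zero]

theorem inner_apply_right (a : G) (h k : H) : inner ℂ h (U a k) = inner ℂ (U (-a) h) k := by
  rw [← (U (-a)).inner_map_map h, U.neg_apply_self]

/-- The group element moves to the test vector, where strong continuity yields norm convergence;
boundedness then permits pairing with a weakly convergent sequence. -/
theorem tendstoWeakly_apply [IsTopologicalAddGroup G] {l : Filter ι} {a : ι → G} {b : G} {u : ι → H}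
    {p : H} {M : ℝ} (hM : ∀ n, ‖u n‖ ≤ M) (ha : Tendsto a l (𝓝 b)) (hu : TendstoWeakly l u p) :
    TendstoWeakly l (fun n => U (a n) (u n)) (U b p) := fun h => by
  simp only [U.inner_apply_right]
  exact hu.inner_tendsto hM (((U.continuous_apply h).tendsto _).comp ha.neg)

theorem tendstoWeakly_zero {l : Filter ι} {a : ι → G} (ha : Tendsto a l (cocompact G)) (p : H) :
    TendstoWeakly l (fun n => U (a n) p) 0 := fun h => by
  simpa [Function.comp_def] using (U.mixing h p).comp ha

/-- Pythagorean expansion for a sequence from which a weak limit has been split off. -/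
theorem norm_sq_decoupling {l : Filter ι} {a : ι → G} {r : ι → H} {p : H}
    (hr : TendstoWeakly l (fun n => U (-(a n)) (r n)) 0) :
    Tendsto (fun n => ‖U (a n) p + r n‖ ^ 2 - ‖p‖ ^ 2 - ‖r n‖ ^ 2) l (𝓝 0) := by
  have h1 : Tendsto (fun n => 2 * (inner ℂ p (U (-(a n)) (r n))).re) l (𝓝 0) := by
    simpa using (((Complex.continuous_re.tendsto _).comp (hr p)).const_mul 2)
  refine h1.congr fun n => ?_
  rw [@norm_add_sq ℂ, (U (a n)).norm_map, U.inner_apply_right, neg_neg]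
  simp
  ring

end MixingRep

/-- Failure means that some compact set is visited frequently, and compactness supplies the cluster
point. -/
theorem exists_clusterPt_of_not_tendsto_cocompact {G ι : Type*} [TopologicalSpace G]
    {l : Filter ι} {d : ι → G}
    (h : ¬ Tendsto d l (cocompact G)) : ∃ b, MapClusterPt b l d := by
  rw [tendsto_def] at h
  push Not at h
  obtain ⟨s, hs, h⟩ := h
  obtain ⟨t, ht, hts⟩ := mem_cocompact.1 hs
  have hf : ∃ᶠ n in l, d n ∈ t := by
    rw [Filter.Frequently]
    intro hn
    exact h (mem_of_superset hn fun n hn => hts hn)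
  obtain ⟨b, -, hb⟩ := ht.exists_mapClusterPt_of_frequently hf
  exact ⟨b, hb⟩

/-! ### Extraction of profiles in an abstract Hilbert space -/

section Extraction

variable {V H : Type*} [NormedAddCommGroup V]
  [NormedAddCommGroup H] [InnerProductSpace ℂ H]

/-- A bounded sequence seen along a countably generated filter that refines `atTop`. Refining the
filter plays the role of passing to a subsequence. -/
structure Stage (H : Type*) [NormedAddCommGroup H] where
  /-- The filter. -/
  F : Filter ℕ
  /-- The sequence. -/
  r : ℕ → H
  neBot : F.NeBot
  cg : F.IsCountablyGenerated
  bdd : ∃ M : ℝ, ∀ n, ‖r n‖ ≤ M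

/-- After a refinement of the filter, the time parameter either tends to infinity or can be taken
to vanish, at the cost of changing the weak limit by a unitary operator. -/
theorem exists_normalized (U : MixingRep (ℝ × V) H) (F : Filter ℕ) [F.NeBot]
    [F.IsCountablyGenerated] (r : ℕ → H) (M : ℝ) (hM : ∀ n, ‖r n‖ ≤ M) (a : ℕ → ℝ × V) (p : H)
    (hp : TendstoWeakly F (fun n => U (-(a n)) (r n)) p) :
    ∃ F' ≤ F, F'.NeBot ∧ F'.IsCountablyGenerated ∧ ∃ (b : ℕ → ℝ × V) (q : H), ‖q‖ = ‖p‖ ∧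
      TendstoWeakly F' (fun n => U (-(b n)) (r n)) q ∧
      ((∀ n, (b n).1 = 0) ∨ Tendsto (fun n => |(b n).1|) F' atTop) := by
  by_cases h : Tendsto (fun n => (a n).1) F (cocompact ℝ)
  · exact ⟨F, le_rfl, ‹_›, ‹_›, a, p, rfl, hp, Or.inr ((tendsto_norm_cocompact_atTop).comp h)⟩
  -- Refining the filter makes the times converge to s. Replacing them by zero costs a factor U
  -- (s_n, 0), whose limit U (s, 0) is absorbed into the profile.
  · obtain ⟨s, hs⟩ := exists_clusterPt_of_not_tendsto_cocompact h
    have hne : (F ⊓ comap (fun n => (a n).1) (𝓝 s)).NeBot := by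
      rw [neBot_inf_comap_iff_map, inf_comm]
      exact hs
    refine ⟨F ⊓ comap (fun n => (a n).1) (𝓝 s), inf_le_left, hne, inferInstance,
      fun n => (0, (a n).2), U (s, 0) p, (U _).norm_map _, ?_, Or.inl fun n => rfl⟩
    have h1 : Tendsto (fun n => ((a n).1, (0 : V))) (F ⊓ comap (fun n => (a n).1) (𝓝 s))
        (𝓝 (s, 0)) := by
      refine Tendsto.prodMk_nhds ?_ tendsto_const_nhds
      exact (tendsto_comap (f := fun n => (a n).1)).mono_left inf_le_right
    have h2 := U.tendstoWeakly_apply (M := M) (fun n => by rw [(U _).norm_map]; exact hM n) h1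
      (hp.mono inf_le_left)
    refine fun k => (h2 k).congr fun n => ?_
    dsimp only
    rw [← U.map_add]
    congr 3
    ext <;> simp

/-- Countable generation gives a sequence along which weak compactness applies. The lower bound is
recorded through ‖q‖ and not through a pairing, because normalising the times preserves only the
norm of the weak limit. -/
theorem exists_weak_profile [CompleteSpace H] [TopologicalSpace.SeparableSpace H]
    (U : MixingRep (ℝ × V) H) (F : Filter ℕ) [F.NeBot]
    [F.IsCountablyGenerated] (r : ℕ → H) (M : ℝ) (hM : ∀ n, ‖r n‖ ≤ M) (a : ℕ → ℝ × V) :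
    ∃ F' ≤ F, F'.NeBot ∧ F'.IsCountablyGenerated ∧ ∃ (b : ℕ → ℝ × V) (q : H),
      TendstoWeakly F' (fun n => U (-(b n)) (r n)) q ∧
      ((∀ n, (b n).1 = 0) ∨ Tendsto (fun n => |(b n).1|) F' atTop) ∧
      ∀ (h : H) (c : ℝ), (∀ᶠ n in F, c ≤ ‖inner ℂ h (U (-(a n)) (r n))‖) → c ≤ ‖h‖ * ‖q‖ := by
  obtain ⟨ψ, hψ⟩ := exists_seq_tendsto F
  obtain ⟨p, θ, hθ, hp⟩ := exists_tendstoWeakly (fun n => U (-(a (ψ n))) (r (ψ n))) M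
    (fun n => by rw [(U _).norm_map]; exact hM _)
  have hle : map (ψ ∘ θ) atTop ≤ F := hψ.comp hθ.tendsto_atTop
  have hp' : TendstoWeakly (map (ψ ∘ θ) atTop) (fun n => U (-(a n)) (r n)) p :=
    fun h => tendsto_map'_iff.2 (hp h)
  obtain ⟨F', hF', h1, h2, b, q, hq, h3, h4⟩ := exists_normalized U _ r M hM a p hp'
  refine ⟨F', hF'.trans hle, h1, h2, b, q, h3, h4, fun h c hc => ?_⟩
  rw [hq]
  refine le_trans ?_ (norm_inner_le_norm (𝕜 := ℂ) h p)
  exact ge_of_tendsto (hp' h).norm (hle hc)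

variable {ι : Type*}

/-- Extraction of one profile, whose size controls the `limsup` of the seminorm `Y`. -/
theorem exists_profile_step [CompleteSpace H] [TopologicalSpace.SeparableSpace H]
    (U : MixingRep (ℝ × V) H) (K : ι → H) (hK : Tendsto (fun i => ‖K i‖) cofinite (𝓝 0))
    (C : ℝ) (hC : ∀ i, ‖K i‖ ≤ C) (Y : H → ℝ≥0∞)
    (hY : ∀ (u : H) (c : ℝ), (∀ i a, ‖inner ℂ (K i) (U (-a) u)‖ ≤ c) → Y u ≤ ENNReal.ofReal c)
    (s : Stage H) :
    ∃ F' ≤ s.F, F'.NeBot ∧ F'.IsCountablyGenerated ∧ ∃ (b : ℕ → ℝ × V) (q : H),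
      TendstoWeakly F' (fun n => U (-(b n)) (s.r n)) q ∧
      ((∀ n, (b n).1 = 0) ∨ Tendsto (fun n => |(b n).1|) F' atTop) ∧
      limsup (fun n => Y (s.r n)) s.F ≤ ENNReal.ofReal (2 * (C * ‖q‖)) := by
  obtain ⟨F, r, _, _, M, hM⟩ := s
  simp only
  set L := limsup (fun n => Y (r n)) F with hL
  by_cases hL0 : L = 0
  · obtain ⟨F', hF', h1, h2, b, q, h3, h4, -⟩ := exists_weak_profile U F r M hM 0
    exact ⟨F', hF', h1, h2, b, q, h3, h4, by rw [hL0]; exact zero_le⟩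
  have hLtop : L ≠ ⊤ := by
    refine ne_top_of_le_ne_top (b := ENNReal.ofReal (C * M)) ENNReal.ofReal_ne_top ?_
    refine limsup_le_of_le (by isBoundedDefault) (Eventually.of_forall fun n => hY _ _ fun i a => ?_)
    refine (norm_inner_le_norm _ _).trans ?_
    rw [(U _).norm_map]
    exact mul_le_mul (hC i) (hM n) (norm_nonneg _) ((norm_nonneg _).trans (hC i))
  -- Any level strictly below the limsup would do; one half produces the factor 2 in the conclusion.
  set ε : ℝ := L.toReal / 2 with hε
  have hLpos : 0 < L.toReal := ENNReal.toReal_pos hL0 hLtop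
  have hεpos : 0 < ε := by positivity
  have hlt : ENNReal.ofReal ε < L := by
    rw [← ENNReal.ofReal_toReal hLtop]
    exact (ENNReal.ofReal_lt_ofReal_iff hLpos).2 (by linarith)
  have hfreq : ∃ᶠ n in F, ENNReal.ofReal ε < Y (r n) :=
    frequently_lt_of_lt_limsup (by isBoundedDefault) hlt
  have hM0 : 0 ≤ M := (norm_nonneg _).trans (hM 0)
  -- Kernels of norm below ε / (M + 1) cannot pair to more than ε, so only finitely many matter. The
  -- summand 1 keeps the denominator positive when M = 0.
  have hfin : {i | ε / (M + 1) ≤ ‖K i‖}.Finite := by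
    have := hK.eventually (gt_mem_nhds (show (0 : ℝ) < ε / (M + 1) by positivity))
    rw [eventually_cofinite] at this
    simpa using this
  -- Pigeonhole over the finite set: a single kernel detects the sequence frequently. Otherwise `hY`
  -- would bound Y by ε at an index where it exceeds ε.
  have hex : ∃ i, ∃ᶠ n in F, ∃ a, ε < ‖inner ℂ (K i) (U (-a) (r n))‖ := by
    by_contra hno
    push Not at hno
    have hall : ∀ᶠ n in F, ∀ i ∈ {i | ε / (M + 1) ≤ ‖K i‖},
        ¬ ∃ a, ε < ‖inner ℂ (K i) (U (-a) (r n))‖ :=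
      (eventually_all_finite hfin).2 fun i _ => not_frequently.1 (by simpa using hno i)
    obtain ⟨n, hn, hn'⟩ := (hfreq.and_eventually hall).exists
    refine absurd (hY (r n) ε fun i a => ?_) (not_le.2 hn)
    by_cases hi : ε / (M + 1) ≤ ‖K i‖
    · by_contra hcon
      exact hn' i hi ⟨a, not_le.1 hcon⟩
    · refine (norm_inner_le_norm _ _).trans ?_
      rw [(U _).norm_map]
      calc ‖K i‖ * ‖r n‖ ≤ ε / (M + 1) * (M + 1) := by
            gcongr
            · exact (not_le.1 hi).le
            · linarith [hM n]
        _ = ε := by field_simp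
  obtain ⟨i, hi⟩ := hex
  classical
  let a : ℕ → ℝ × V := fun n =>
    if h : ∃ a, ε < ‖inner ℂ (K i) (U (-a) (r n))‖ then h.choose else 0
  have ha : ∃ᶠ n in F, n ∈ {n | ε < ‖inner ℂ (K i) (U (-(a n)) (r n))‖} := by
    refine hi.mono fun n hn => ?_
    simp only [a, Set.mem_ofPred_eq]
    rw [dif_pos hn]
    exact hn.choose_spec
  have : (F ⊓ 𝓟 {n | ε < ‖inner ℂ (K i) (U (-(a n)) (r n))‖}).NeBot :=
    frequently_mem_iff_neBot.1 ha
  obtain ⟨F', hF', h1, h2, b, q, h3, h4, h5⟩ :=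
    exists_weak_profile U (F ⊓ 𝓟 {n | ε < ‖inner ℂ (K i) (U (-(a n)) (r n))‖}) r M hM a
  refine ⟨F', hF'.trans inf_le_left, h1, h2, b, q, h3, h4, ?_⟩
  have h6 : ε ≤ ‖K i‖ * ‖q‖ := h5 (K i) ε (eventually_inf_principal.2
    (Eventually.of_forall fun n hn => le_of_lt hn))
  rw [← ENNReal.ofReal_toReal hLtop]
  refine ENNReal.ofReal_le_ofReal ?_
  have h7 : ‖K i‖ * ‖q‖ ≤ C * ‖q‖ := by gcongr; exact hC i
  linarith

/-- Weakly null remainders are asymptotically orthogonal to later profiles. -/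
theorem tendsto_cocompact_of_weak (U : MixingRep (ℝ × V) H) {l : Filter ℕ} {r : ℕ → H} {M : ℝ}
    (hM : ∀ n, ‖r n‖ ≤ M) {a b : ℕ → ℝ × V} {p : H} (hp : p ≠ 0)
    (ha : TendstoWeakly l (fun n => U (-(a n)) (r n)) 0)
    (hb : TendstoWeakly l (fun n => U (-(b n)) (r n)) p) :
    Tendsto (fun n => b n - a n) l (cocompact (ℝ × V)) := by
  -- Along an ultrafilter the differences of the parameters converge, so the two frames differ by a
  -- convergent group element and the weak limit zero passes from one frame to the other.
  by_contra hno
  obtain ⟨c, hc⟩ := exists_clusterPt_of_not_tendsto_cocompact hno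
  obtain ⟨W, hW, hWc⟩ := mapClusterPt_iff_ultrafilter.1 hc
  refine hp ((hb.mono hW).unique ?_)
  have h1 := U.tendstoWeakly_apply (M := M) (fun n => by rw [(U _).norm_map]; exact hM n) hWc.neg
    (ha.mono hW)
  rw [map_zero] at h1
  refine fun k => (h1 k).congr fun n => ?_
  dsimp only
  rw [← U.map_add]
  congr 3
  abel

variable [CompleteSpace H] [TopologicalSpace.SeparableSpace H]

/-- The profile decomposition of a bounded sequence in a Hilbert space with respect to a mixing
group action. -/
theorem exists_profile_decomposition
    (U : MixingRep (ℝ × V) H) (K : ι → H) (hK : Tendsto (fun i => ‖K i‖) cofinite (𝓝 0))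
    (C : ℝ) (hC : ∀ i, ‖K i‖ ≤ C) (Y : H → ℝ≥0∞)
    (hY : ∀ (u : H) (c : ℝ), (∀ i a, ‖inner ℂ (K i) (U (-a) u)‖ ≤ c) → Y u ≤ ENNReal.ofReal c)
    (u : ℕ → H) (M : ℝ) (hM : ∀ n, ‖u n‖ ≤ M) :
    ∃ (φ : ℕ → ℕ) (Jstar : ℕ∞) (P : ℕ → H) (a : ℕ → ℕ → ℝ × V) (r : ℕ → ℕ → H),
      StrictMono φ ∧ (∀ n, r 0 n = u (φ n)) ∧
      (∀ J n, r J n = U (a J n) (P J) + r (J + 1) n) ∧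
      (∀ J, ∃ M : ℝ, ∀ n, ‖r J n‖ ≤ M) ∧
      (∀ J, TendstoWeakly atTop (fun n => U (-(a J n)) (r (J + 1) n)) 0) ∧
      (∀ j : ℕ, (j : ℕ∞) < Jstar → P j ≠ 0) ∧
      (∀ J : ℕ, Jstar = J → limsup (fun n => Y (r J n)) atTop = 0) ∧
      (Jstar = ⊤ → Tendsto (fun J : ℕ => limsup (fun n => Y (r J n)) atTop) atTop (𝓝 0)) ∧
      (∀ j k : ℕ, (j : ℕ∞) < Jstar → (k : ℕ∞) < Jstar → j ≠ k →
        Tendsto (fun n => a j n - a k n) atTop (cocompact (ℝ × V))) ∧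
      (∀ j, (∀ n, (a j n).1 = 0) ∨ Tendsto (fun n => |(a j n).1|) atTop atTop) := by
  choose F' hF' hne hcg b q hweak htime hlim using
    fun s => exists_profile_step U K hK C hC Y hY s
  have hbdd : ∀ s : Stage H, ∃ M : ℝ, ∀ n, ‖s.r n - U (b s n) (q s)‖ ≤ M := by
    intro s
    obtain ⟨M, hM⟩ := s.bdd
    refine ⟨M + ‖q s‖, fun n => (norm_sub_le _ _).trans ?_⟩
    rw [(U _).norm_map]
    gcongr
    exact hM n
  -- Extraction continues for ever, even if the limsup of Y has already vanished; the stopping index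
  -- is chosen afterwards.
  let S : ℕ → Stage H := fun J => Nat.rec (⟨atTop, u, inferInstance, inferInstance, M, hM⟩ : Stage H)
    (fun _ s => ⟨F' s, fun n => s.r n - U (b s n) (q s), hne s, hcg s, hbdd s⟩) J
  have hSF : ∀ J, (S (J + 1)).F = F' (S J) := fun J => rfl
  have hSr : ∀ J n, (S (J + 1)).r n = (S J).r n - U (b (S J) n) (q (S J)) := fun J n => rfl
  have hanti : Antitone fun J => (S J).F := antitone_nat_of_succ_le fun J => hF' (S J)
  have hcgi : ∀ J, (S J).F.IsCountablyGenerated := fun J => (S J).cg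
  -- This replaces the diagonal argument: a decreasing sequence of proper, countably generated
  -- filters has a proper, countably generated infimum, and a sequence tending to it serves all
  -- stages at once.
  have hnei : (⨅ J, (S J).F).NeBot :=
    iInf_neBot_of_directed' hanti.directed_ge fun J => (S J).neBot
  obtain ⟨ψ, hψ⟩ := exists_seq_tendsto (⨅ J, (S J).F)
  have hψJ : ∀ J, Tendsto ψ atTop (S J).F := fun J => hψ.mono_right (iInf_le _ J)
  -- The filter of stage zero is `atTop`, so ψ tends to infinity and can be thinned out to a
  -- strictly increasing sequence.
  obtain ⟨θ, hθ, hψθ⟩ := strictMono_subseq_of_tendsto_atTop (hψJ 0)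
  set φ := ψ ∘ θ with hφ
  have hφJ : ∀ J, Tendsto φ atTop (S J).F := fun J => (hψJ J).comp hθ.tendsto_atTop
  set a : ℕ → ℕ → ℝ × V := fun J n => b (S J) (φ n)
  set P : ℕ → H := fun J => q (S J)
  set r : ℕ → ℕ → H := fun J n => (S J).r (φ n)
  set L : ℕ → ℝ≥0∞ := fun J => limsup (fun n => Y ((S J).r n)) (S J).F
  have hrec : ∀ J n, r J n = U (a J n) (P J) + r (J + 1) n := fun J n => by
    simp only [r, hSr, a, P]; abel
  have hrbdd : ∀ J, ∃ M : ℝ, ∀ n, ‖r J n‖ ≤ M := fun J => by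
    obtain ⟨M, hM⟩ := (S J).bdd
    exact ⟨M, fun n => hM _⟩
  have hw : ∀ J, TendstoWeakly atTop (fun n => U (-(a J n)) (r J n)) (P J) := fun J =>
    (hweak (S J)).comp (hφJ (J + 1))
  have hw0 : ∀ J, TendstoWeakly atTop (fun n => U (-(a J n)) (r (J + 1) n)) 0 := fun J => by
    have h1 := (hw J).sub (tendstoWeakly_const _ (P J))
    rw [sub_self] at h1
    refine fun k => (h1 k).congr fun n => ?_
    dsimp only
    rw [hrec J n, _root_.map_add, U.neg_apply_self]
    simp
  have hLr : ∀ J, limsup (fun n => Y (r J n)) atTop ≤ L J := fun J => by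
    change limsup ((fun n => Y ((S J).r n)) ∘ φ) atTop ≤ _
    rw [limsup_comp]
    exact limsup_le_limsup_of_le (hφJ J)
  -- Induction on the gap d. Removing profile j + 1 + d keeps the remainder weakly null in frame j,
  -- since that profile recedes to infinity relative to frame j and mixing applies. The new
  -- remainder has a nonzero limit in its own frame, because its L does not vanish, so the two
  -- frames diverge.
  have horth : ∀ j d, (∀ l ≤ j + 1 + d, L l ≠ 0) →
      TendstoWeakly atTop (fun n => U (-(a j n)) (r (j + 1 + d) n)) 0 ∧
      Tendsto (fun n => a (j + 1 + d) n - a j n) atTop (cocompact (ℝ × V)) := by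
    intro j d
    induction d with
    | zero =>
      intro hl
      obtain ⟨M, hM⟩ := hrbdd (j + 1)
      refine ⟨hw0 j, tendsto_cocompact_of_weak U hM ?_ (hw0 j) (hw (j + 1))⟩
      intro hP
      have h1 := hlim (S (j + 1))
      rw [show q (S (j + 1)) = 0 from hP] at h1
      exact hl (j + 1) (by omega) (by simpa using h1)
    | succ d ih =>
      intro hl
      obtain ⟨h1, h2⟩ := ih fun l hl' => hl l (by omega)
      have h3 : TendstoWeakly atTop (fun n => U (-(a j n)) (r (j + 1 + (d + 1)) n)) 0 := by
        have h4 := h1.sub (U.tendstoWeakly_zero h2 (P (j + 1 + d)))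
        rw [sub_zero] at h4
        refine fun k => (h4 k).congr fun n => ?_
        dsimp only
        rw [hrec (j + 1 + d) n, _root_.map_add, ← U.map_add]
        congr 1
        rw [show -(a j n) + a (j + 1 + d) n = a (j + 1 + d) n - a j n by abel]
        simp [add_assoc]
      obtain ⟨M, hM⟩ := hrbdd (j + 1 + (d + 1))
      refine ⟨h3, tendsto_cocompact_of_weak U hM ?_ h3 (hw (j + 1 + (d + 1)))⟩
      intro hP
      have h1 := hlim (S (j + 1 + (d + 1)))
      rw [show q (S (j + 1 + (d + 1))) = 0 from hP] at h1
      exact hl (j + 1 + (d + 1)) le_rfl (by simpa using h1)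
  -- A Bessel inequality, from iterating the Pythagorean expansion and dropping ‖r J n‖².
  have hsum : ∀ J, ∑ j ∈ Finset.range J, ‖P j‖ ^ 2 ≤ M ^ 2 := by
    intro J
    have h1 : Tendsto (fun n => ‖r 0 n‖ ^ 2 - ∑ j ∈ Finset.range J, ‖P j‖ ^ 2 - ‖r J n‖ ^ 2)
        atTop (𝓝 0) := by
      induction J with
      | zero => simp
      | succ J ih =>
        refine (add_zero (0 : ℝ) ▸ ih.add (U.norm_sq_decoupling (hw0 J) (p := P J))).congr
          fun n => ?_
        rw [← hrec J n, Finset.sum_range_succ]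
        ring
    have h2 : ∀ n, ‖r 0 n‖ ^ 2 - ∑ j ∈ Finset.range J, ‖P j‖ ^ 2 - ‖r J n‖ ^ 2 ≤
        M ^ 2 - ∑ j ∈ Finset.range J, ‖P j‖ ^ 2 := fun n => by
      have : ‖r 0 n‖ ^ 2 ≤ M ^ 2 := by gcongr; exact hM _
      nlinarith [sq_nonneg ‖r J n‖]
    linarith [le_of_tendsto h1 (Eventually.of_forall h2)]
  have hPto : Tendsto (fun J => ‖P J‖) atTop (𝓝 0) := by
    have h1 : Summable fun J => ‖P J‖ ^ 2 :=
      summable_of_sum_range_le (fun _ => by positivity) hsum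
    have h2 := h1.tendsto_atTop_zero.sqrt
    simpa using h2
  have hLto : Tendsto L atTop (𝓝 0) := by
    have h1 : Tendsto (fun J => ENNReal.ofReal (2 * (C * ‖P J‖))) atTop (𝓝 0) := by
      have := ENNReal.tendsto_ofReal ((hPto.const_mul C).const_mul 2)
      simpa using this
    exact tendsto_of_tendsto_of_tendsto_of_le_of_le tendsto_const_nhds h1 (fun _ => zero_le)
      fun J => hlim (S J)
  classical
  -- The limsup is tested along the filter of the stage, which dominates the one along φ. Before the
  -- first zero, `hlim` forces the profiles to be nonzero.
  set Jstar : ℕ∞ := if h : ∃ J, L J = 0 then (Nat.find h : ℕ∞) else ⊤ with hJ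
  have hLne : ∀ j : ℕ, (j : ℕ∞) < Jstar → ∀ l ≤ j, L l ≠ 0 := by
    intro j hj l hl
    by_cases h : ∃ J, L J = 0
    · rw [hJ, dif_pos h, Nat.cast_lt] at hj
      exact Nat.find_min h (by omega)
    · push Not at h
      exact h l
  have hdiff : ∀ j k : ℕ, (k : ℕ∞) < Jstar → j < k →
      Tendsto (fun n => a k n - a j n) atTop (cocompact (ℝ × V)) := by
    intro j k hk hjk
    obtain ⟨d, rfl⟩ := Nat.exists_eq_add_of_lt hjk
    have := (horth j d fun l hl => hLne _ hk l (by omega)).2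
    rwa [show j + 1 + d = j + d + 1 by omega] at this
  refine ⟨φ, Jstar, P, a, r, hψθ, fun n => rfl, hrec, hrbdd, hw0, ?_, ?_, ?_, ?_, ?_⟩
  · intro j hj hP
    have h1 := hlim (S j)
    rw [show q (S j) = 0 from hP] at h1
    exact hLne j hj j le_rfl (by simpa using h1)
  · intro J hJJ
    by_cases h : ∃ J, L J = 0
    · rw [hJ, dif_pos h, Nat.cast_inj] at hJJ
      have := Nat.find_spec h
      rw [hJJ] at this
      exact le_antisymm ((hLr J).trans this.le) zero_le
    · rw [hJ, dif_neg h] at hJJ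
      exact absurd hJJ (by simp)
  · intro _
    exact tendsto_of_tendsto_of_tendsto_of_le_of_le tendsto_const_nhds hLto (fun _ => zero_le) hLr
  · intro j k hj hk hjk
    rcases lt_or_gt_of_ne hjk with h | h
    · have := (Homeomorph.neg (ℝ × V)).isClosedEmbedding.tendsto_cocompact.comp (hdiff j k hk h)
      simpa [Function.comp_def] using this
    · exact hdiff k j hj h
  · intro j
    exact (htime (S j)).imp (fun h n => h _) fun h => h.comp (hφJ (j + 1))

end Extraction

/-! ### Oscillatory integrals with integrable amplitudes -/

section Mixing

variable {V : Type*} [NormedAddCommGroup V] [InnerProductSpace ℝ V] [FiniteDimensional ℝ V]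
  [MeasurableSpace V] [BorelSpace V]

theorem norm_exp_phase_mul (θ : ℝ) (z : ℂ) : ‖Complex.exp (θ * Complex.I) * z‖ = ‖z‖ := by
  rw [norm_mul, Complex.norm_exp_ofReal_mul_I, one_mul]

theorem integrable_phase_mul {α : Type*} [MeasurableSpace α] {μ : Measure α} {θ : α → ℝ}
    (hθ : Measurable θ) {F : α → ℂ} (hF : Integrable F μ) :
    Integrable (fun x => Complex.exp (θ x * Complex.I) * F x) μ := by
  refine hF.bdd_mul (c := 1) (Measurable.aestronglyMeasurable (by fun_prop)) ?_
  exact Eventually.of_forall fun x => by rw [Complex.norm_exp_ofReal_mul_I]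

/-- The Riemann–Lebesgue lemma in angular normalisation. -/
theorem tendsto_integral_exp_inner (F : V → ℂ) :
    Tendsto (fun y : V => ∫ ξ, Complex.exp ((inner ℝ y ξ : ℝ) * Complex.I) * F ξ)
      (cocompact V) (𝓝 0) := by
  have hc : (-(2 * Real.pi))⁻¹ ≠ 0 := by simp [Real.pi_ne_zero]
  have h := (tendsto_integral_exp_inner_smul_cocompact F).comp
    (Homeomorph.smulOfNeZero (α := V) _ hc).isClosedEmbedding.tendsto_cocompact
  refine h.congr fun y => integral_congr_ae (Eventually.of_forall fun ξ => ?_)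
  simp only [Homeomorph.smulOfNeZero_apply, Circle.smul_def, Real.fourierChar_apply, smul_eq_mul]
  rw [inner_smul_right, real_inner_comm]
  congr 3
  norm_cast
  field_simp

theorem tendsto_integral_exp_mul_real (F : ℝ → ℂ) :
    Tendsto (fun c : ℝ => ∫ r, Complex.exp ((c * r : ℝ) * Complex.I) * F r)
      (cocompact ℝ) (𝓝 0) := by
  simpa [mul_comm] using tendsto_integral_exp_inner F

/-- The density r ^ n goes into the amplitude, extended by zero to the line. Integrability is not
needed: without it the integral is zero for every c. -/
theorem tendsto_integral_exp_mul_volumeIoiPow (n : ℕ) (F : Set.Ioi (0 : ℝ) → ℂ) :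
    Tendsto (fun c : ℝ => ∫ r, Complex.exp ((c * r : ℝ) * Complex.I) * F r
      ∂(Measure.volumeIoiPow n)) (cocompact ℝ) (𝓝 0) := by
  classical
  set G : ℝ → ℂ := fun r => if h : r ∈ Set.Ioi (0 : ℝ) then F ⟨r, h⟩ else 0 with hG
  refine (tendsto_integral_exp_mul_real
    ((Set.Ioi 0).indicator fun r => (Real.toNNReal (r ^ n)) • G r)).congr fun c => ?_
  symm
  simp only [Measure.volumeIoiPow, ENNReal.ofReal]
  rw [integral_withDensity_eq_integral_smul (by fun_prop)]
  have h1 := integral_subtype_comap (μ := volume) (measurableSet_Ioi (a := (0 : ℝ)))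
    fun r => Real.toNNReal (r ^ n) • (Complex.exp ((c * r : ℝ) * Complex.I) * G r)
  have h2 : ∀ a : Set.Ioi (0 : ℝ), F a = G a := fun a => by
    rw [hG]; simp only; rw [dif_pos a.2]
  simp only [h2]
  rw [h1, ← integral_indicator measurableSet_Ioi]
  refine integral_congr_ae (Eventually.of_forall fun r => ?_)
  by_cases hr : r ∈ Set.Ioi (0 : ℝ)
  · simp only [Set.indicator_of_mem hr, mul_smul_comm]
  · simp only [Set.indicator_of_notMem hr, mul_zero]

/-- A quadratic cone has measure zero in dimension at least two. -/
theorem volume_cone_eq_zero (hd : 2 ≤ Module.finrank ℝ V) (σ : ℝ) (w : V)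
    (h : σ ≠ 0 ∨ w ≠ 0) : volume {x : V | σ * ‖x‖ + inner ℝ w x = 0} = 0 := by
  by_cases hσ : σ = 0
  · subst hσ
    have hv' : w ≠ 0 := by simpa using h
    have h1 := Measure.addHaar_submodule (volume : Measure V) (ℝ ∙ w)ᗮ (by
      rw [Ne, Submodule.orthogonal_eq_top_iff]
      simpa using hv')
    convert h1 using 2
    ext x
    simp [Submodule.mem_orthogonal_singleton_iff_inner_right]
  -- For ‖x‖ = ⟨v, x⟩ there are three cases: the origin if v = 0; part of a line if ‖v‖ = 1, by
  -- equality in Cauchy–Schwarz; otherwise the translates along small multiples of v are disjoint,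
  -- and infinitely many disjoint bounded translates force measure zero.
  set v : V := (-σ⁻¹) • w with hv
  have hset : {x : V | σ * ‖x‖ + inner ℝ w x = 0} = {x : V | ‖x‖ = inner ℝ v x} := by
    ext x
    simp only [Set.mem_ofPred_eq, hv, inner_smul_left]
    simp only [conj_trivial]
    field_simp
    constructor <;> intro h <;> linarith
  rw [hset]
  have hline : ∀ x : V, volume ((ℝ ∙ x : Submodule ℝ V) : Set V) = 0 := fun x => by
    refine Measure.addHaar_submodule _ _ fun htop => ?_
    have := finrank_span_le_card (R := ℝ) ({x} : Set V)
    rw [htop, finrank_top] at this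
    simp at this
    omega
  by_cases hv0 : v = 0
  · refine measure_mono_null (fun x hx => ?_) (hline 0)
    simpa [hv0] using hx
  by_cases hv1 : ‖v‖ = 1
  · refine measure_mono_null (fun x hx => ?_) (hline v)
    have hx' : inner ℝ v x = ‖v‖ * ‖x‖ := by rw [hv1, one_mul]; exact hx.symm
    rw [inner_eq_norm_mul_iff_real, hv1, one_smul] at hx'
    exact Submodule.mem_span_singleton.2 ⟨_, hx'⟩
  have hmeas : MeasurableSet {x : V | ‖x‖ = inner ℝ v x} :=
    (isClosed_eq (by fun_prop) (by fun_prop)).measurableSet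
  refine Measure.addHaar_eq_zero_of_disjoint_translates volume
    (fun n : ℕ => (1 / ((n : ℝ) + 1)) • v) ?_ ?_ hmeas
  · refine isBounded_iff_forall_norm_le.2 ⟨‖v‖, ?_⟩
    rintro _ ⟨n, rfl⟩
    dsimp only
    rw [norm_smul, Real.norm_eq_abs, abs_of_nonneg (by positivity)]
    refine mul_le_of_le_one_left (norm_nonneg _) ?_
    rw [div_le_one (by positivity)]
    simp
  · intro n m hnm
    rw [Function.onFun, Set.disjoint_left]
    intro x hx1 hx2
    simp only [Set.singleton_add, Set.image_add_left, Set.mem_preimage, Set.mem_ofPred_eq]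
      at hx1 hx2
    set z := -((1 / ((n : ℝ) + 1)) • v) + x with hz
    set c : ℝ := 1 / ((n : ℝ) + 1) - 1 / ((m : ℝ) + 1) with hc
    have hz' : -((1 / ((m : ℝ) + 1)) • v) + x = z + c • v := by
      rw [hz, hc, sub_smul]; abel
    have hc0 : c ≠ 0 := by
      rw [hc, sub_ne_zero]
      simpa using hnm
    rw [hz'] at hx2
    have h2 : ‖z + c • v‖ = ‖z‖ + c * ‖v‖ ^ 2 := by
      rw [hx2, inner_add_right, inner_smul_right, real_inner_self_eq_norm_sq, hx1]
    have h3 : ‖z + c • v‖ ^ 2 = ‖z‖ ^ 2 + 2 * (c * ‖z‖) + c ^ 2 * ‖v‖ ^ 2 := by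
      rw [norm_add_sq_real, inner_smul_right, real_inner_comm, ← hx1, norm_smul, mul_pow,
        Real.norm_eq_abs, sq_abs]
    -- The square of `h2` compared with `h3`. As ‖v‖ ≠ 1, both norms vanish, contradicting c • v ≠
    -- 0.
    have h4 : c * ((1 - ‖v‖ ^ 2) * (‖z‖ + ‖z + c • v‖)) = 0 := by
      rw [h2]; rw [h2] at h3; nlinarith
    have h5 : 1 - ‖v‖ ^ 2 ≠ 0 := by
      intro h6
      apply hv1
      nlinarith [norm_nonneg v]
    have h6 : ‖z‖ + ‖z + c • v‖ = 0 := by simpa [hc0, h5] using h4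
    have h7 : z = 0 := norm_eq_zero.1 (by linarith [norm_nonneg z, norm_nonneg (z + c • v)])
    have h8 : z + c • v = 0 :=
      norm_eq_zero.1 (by linarith [norm_nonneg z, norm_nonneg (z + c • v)])
    rw [h7, zero_add, smul_eq_zero] at h8
    exact h8.elim hc0 hv0

/-- The surface measure of a set is a multiple of the volume of the truncated cone over it, and here
that cone is null. -/
theorem toSphere_cone_eq_zero (hd : 2 ≤ Module.finrank ℝ V) (σ : ℝ) (w : V)
    (h : σ ≠ 0 ∨ w ≠ 0) :
    ∀ᵐ θ : Metric.sphere (0 : V) 1 ∂(volume : Measure V).toSphere, σ + inner ℝ w (θ : V) ≠ 0 := by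
  have hm : MeasurableSet {θ : Metric.sphere (0 : V) 1 | σ + inner ℝ w (θ : V) = 0} :=
    (isClosed_eq (by fun_prop) (by fun_prop)).measurableSet
  have : {θ : Metric.sphere (0 : V) 1 | ¬ (σ + inner ℝ w (θ : V) ≠ 0)} =
      {θ : Metric.sphere (0 : V) 1 | σ + inner ℝ w (θ : V) = 0} := by ext; simp
  rw [ae_iff, this, Measure.toSphere_apply' _ hm]
  rw [measure_mono_null (t := {x : V | σ * ‖x‖ + inner ℝ w x = 0}) ?_
    (volume_cone_eq_zero hd σ w h), mul_zero]
  rintro _ ⟨r, hr, _, ⟨θ, hθ, rfl⟩, rfl⟩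
  have h1 : ‖(θ : V)‖ = 1 := by simp
  simp only [Set.mem_ofPred_eq] at hθ ⊢
  rw [inner_smul_right, norm_smul, h1, Real.norm_eq_abs, abs_of_pos hr.1]
  linear_combination r * hθ

/-- Integrability on the product is included because it supplies the dominating function for limits
under the angular integral. -/
theorem integral_polar [Nontrivial V] (f : V → ℂ) (hf : Integrable f) :
    Integrable (fun z : Metric.sphere (0 : V) 1 × Set.Ioi (0 : ℝ) => f ((z.2 : ℝ) • (z.1 : V)))
      ((volume : Measure V).toSphere.prod (Measure.volumeIoiPow (Module.finrank ℝ V - 1))) ∧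
    ∫ x, f x = ∫ θ, ∫ r, f ((r : ℝ) • (θ : V))
      ∂(Measure.volumeIoiPow (Module.finrank ℝ V - 1)) ∂(volume : Measure V).toSphere := by
  have hmp := (volume : Measure V).measurePreserving_homeomorphUnitSphereProd
  have hemb := (homeomorphUnitSphereProd V).measurableEmbedding
  have hcomp : (fun z : Metric.sphere (0 : V) 1 × Set.Ioi (0 : ℝ) =>
      f ((z.2 : ℝ) • (z.1 : V))) ∘ homeomorphUnitSphereProd V = f ∘ Subtype.val := by
    ext x
    have hx : ‖(x : V)‖ ≠ 0 := norm_ne_zero_iff.2 x.2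
    simp [smul_smul, hx]
  have h1 : Integrable (fun z : Metric.sphere (0 : V) 1 × Set.Ioi (0 : ℝ) =>
      f ((z.2 : ℝ) • (z.1 : V)))
      ((volume : Measure V).toSphere.prod (Measure.volumeIoiPow (Module.finrank ℝ V - 1))) := by
    rw [← hmp.integrable_comp_emb hemb, hcomp]
    exact (integrableOn_iff_comap_subtypeVal (measurableSet_singleton _).compl).1 hf.integrableOn
  refine ⟨h1, ?_⟩
  rw [← integral_prod _ h1, ← hmp.integral_comp hemb]
  have h2 := integral_subtype_comap (μ := (volume : Measure V))
    (measurableSet_singleton (0 : V)).compl f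
  rw [restrict_compl_singleton] at h2
  rw [← h2]
  exact integral_congr_ae (Eventually.of_forall fun x => (congrFun hcomp x).symm)

instance : (cocompact (ℝ × V)).IsCountablyGenerated := by
  rw [← Metric.cobounded_eq_cocompact, ← comap_norm_atTop]
  infer_instance

/-- Non-stationary phase for `s|ξ| + y·ξ`, for merely integrable amplitudes. -/
theorem tendsto_integral_exp_wave (hd : 2 ≤ Module.finrank ℝ V) {F : V → ℂ} (hF : Integrable F) :
    Tendsto (fun a : ℝ × V => ∫ ξ, Complex.exp ((a.1 * ‖ξ‖ + inner ℝ a.2 ξ : ℝ) * Complex.I) * F ξ)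
      (cocompact (ℝ × V)) (𝓝 0) := by
  have : Nontrivial V := Module.nontrivial_of_finrank_pos (R := ℝ) (by omega)
  refine tendsto_of_subseq_tendsto fun a ha => ?_
  have hnorm : Tendsto (fun n => ‖a n‖) atTop atTop := (tendsto_norm_cocompact_atTop).comp ha
  -- Let e be a limiting direction of a n. On the ray through θ the phase is r (s + y·θ), whose
  -- coefficient grows like ‖a n‖ |e.1 + e.2·θ| for θ off a null set. One-dimensional
  -- Riemann–Lebesgue then applies ray by ray.
  obtain ⟨e, -, ψ, hψ, he⟩ := tendsto_subseq_of_bounded (Metric.isBounded_closedBall (x := 0) (r := 1))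
    (x := fun n => ‖a n‖⁻¹ • a n) (fun n => by
      rw [mem_closedBall_zero_iff, norm_smul, norm_inv, norm_norm]
      exact inv_mul_le_one)
  refine ⟨ψ, ?_⟩
  have hnψ := hnorm.comp hψ.tendsto_atTop
  have he1 : ‖e‖ = 1 := by
    refine tendsto_nhds_unique he.norm (tendsto_const_nhds.congr' ?_)
    filter_upwards [hnψ.eventually_gt_atTop 0] with n hn
    have hn' : 0 < ‖a (ψ n)‖ := hn
    simp only [Function.comp_apply, norm_smul, norm_inv, norm_norm]
    field_simp
  have he0 : e.1 ≠ 0 ∨ e.2 ≠ 0 := by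
    by_contra hcon
    push Not at hcon
    rw [show e = 0 from Prod.ext hcon.1 hcon.2, norm_zero] at he1
    exact zero_ne_one he1
  have hint : ∀ n, Integrable fun ξ : V => Complex.exp (((a (ψ n)).1 * ‖ξ‖ +
      inner ℝ (a (ψ n)).2 ξ : ℝ) * Complex.I) * F ξ := fun n =>
    integrable_phase_mul (by fun_prop) hF
  obtain ⟨hFp, -⟩ := integral_polar F hF
  have hlim : Tendsto (fun n => ∫ θ, ∫ r : Set.Ioi (0 : ℝ),
      Complex.exp (((a (ψ n)).1 * ‖(r : ℝ) • (θ : V)‖ +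
      inner ℝ (a (ψ n)).2 ((r : ℝ) • (θ : V)) : ℝ) * Complex.I) * F ((r : ℝ) • (θ : V))
      ∂(Measure.volumeIoiPow (Module.finrank ℝ V - 1)) ∂(volume : Measure V).toSphere) atTop
      (𝓝 (∫ _, (0 : ℂ) ∂(volume : Measure V).toSphere)) := by
    refine tendsto_integral_of_dominated_convergence
      (fun θ => ∫ r : Set.Ioi (0 : ℝ), ‖F ((r : ℝ) • (θ : V))‖
        ∂(Measure.volumeIoiPow (Module.finrank ℝ V - 1)))
      (fun n => (integral_polar _ (hint n)).1.integral_prod_left.aestronglyMeasurable)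
      hFp.norm.integral_prod_left ?_ ?_
    · refine fun n => Eventually.of_forall fun θ => (norm_integral_le_integral_norm _).trans_eq ?_
      simp only [norm_exp_phase_mul]
    · filter_upwards [toSphere_cone_eq_zero hd e.1 e.2 he0] with θ hθ
      have h1 : Tendsto (fun n => ‖a (ψ n)‖⁻¹ * ((a (ψ n)).1 + inner ℝ (a (ψ n)).2 (θ : V))) atTop
          (𝓝 (e.1 + inner ℝ e.2 (θ : V))) := by
        have h2 := ((continuous_fst.tendsto e).comp he).add
          (((continuous_snd.tendsto e).comp he).inner (tendsto_const_nhds (x := (θ : V))))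
        refine h2.congr fun n => ?_
        simp only [Function.comp_apply, Prod.smul_fst, Prod.smul_snd, inner_smul_left,
          smul_eq_mul, conj_trivial]
        ring
      have h2 : Tendsto (fun n => ‖(a (ψ n)).1 + inner ℝ (a (ψ n)).2 (θ : V)‖) atTop atTop := by
        refine (hnψ.atTop_mul_pos (norm_pos_iff.2 hθ) h1.norm).congr' ?_
        filter_upwards [hnψ.eventually_gt_atTop 0] with n hn
        have hn' : 0 < ‖a (ψ n)‖ := hn
        rw [norm_mul, norm_inv, norm_norm]
        simp only [Function.comp_apply]
        field_simp
      have h3 : Tendsto (fun n => (a (ψ n)).1 + inner ℝ (a (ψ n)).2 (θ : V)) atTop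
          (cocompact ℝ) := by
        rwa [← Metric.cobounded_eq_cocompact, ← tendsto_norm_atTop_iff_cobounded]
      refine ((tendsto_integral_exp_mul_volumeIoiPow (Module.finrank ℝ V - 1)
        fun r => F ((r : ℝ) • (θ : V))).comp h3).congr fun n => ?_
      refine integral_congr_ae (Eventually.of_forall fun r => ?_)
      have hr : (0 : ℝ) < r := r.2
      have hθ1 : ‖(θ : V)‖ = 1 := by simp
      simp only [norm_smul, hθ1, Real.norm_eq_abs, abs_of_pos hr, inner_smul_right]
      congr 4
      ring
  rw [integral_zero] at hlim
  exact hlim.congr fun n => ((integral_polar _ (hint n)).2).symm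

/-- Decay in time of `∫ exp (i (s|ξ|² + y·ξ)) F`, uniformly in `y`. -/
theorem tendsto_integral_exp_schrodinger_of_time [Nontrivial V] {F : V → ℂ} (hF : Integrable F)
    {s : ℕ → ℝ} (hs : Tendsto s atTop (cocompact ℝ)) (y : ℕ → V) :
    Tendsto (fun n => ∫ ξ, Complex.exp ((s n * ‖ξ‖ ^ 2 + inner ℝ (y n) ξ : ℝ) * Complex.I) * F ξ)
      atTop (𝓝 0) := by
  set Φ : ℕ → V → ℝ := fun n ξ => s n * ‖ξ‖ ^ 2 + inner ℝ (y n) ξ with hΦ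
  set A : ℕ → V → ℂ := fun n ξ => Complex.exp (Φ n ξ * Complex.I) * F ξ with hA
  have hAint : ∀ n, Integrable (A n) := fun n => integrable_phase_mul (by fun_prop) hF
  set K : V → V → ℂ := fun h η => starRingEnd ℂ (F η) * F (η + h) with hK
  have hmp := measurePreserving_prod_add (volume : Measure V) (volume : Measure V)
  have hconj : ∀ {G : V → ℂ}, Integrable G → Integrable fun η => starRingEnd ℂ (G η) := fun hG =>
    (Complex.conjCLE : ℂ →L[ℝ] ℂ).integrable_comp hG
  have hprod : ∀ {G : V → ℂ}, Integrable G →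
      Integrable (fun z : V × V => starRingEnd ℂ (G z.1) * G (z.1 + z.2)) (volume.prod volume) :=
    fun hG => hmp.integrable_comp_of_integrable ((hconj hG).mul_prod hG)
  -- Squaring with ξ = η + h: the difference of the phases is affine in η with slope 2 s h, and y
  -- enters only through a factor of modulus one. For h ≠ 0 what remains is a Fourier integral whose
  -- frequency tends to infinity.
  have hsq : ∀ n, ‖∫ ξ, A n ξ‖ ^ 2 ≤
      ∫ h, ‖∫ η, Complex.exp ((inner ℝ ((2 * s n) • h) η : ℝ) * Complex.I) * K h η‖ := by
    intro n
    have h1 : ∫ h, ∫ η, starRingEnd ℂ (A n η) * A n (η + h) =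
        starRingEnd ℂ (∫ ξ, A n ξ) * ∫ ξ, A n ξ := by
      rw [integral_integral_swap (f := fun h η => starRingEnd ℂ (A n η) * A n (η + h))
        (hprod (hAint n)).swap, ← integral_conj, ← integral_mul_const]
      refine integral_congr_ae (Eventually.of_forall fun η => ?_)
      simp only
      rw [integral_const_mul, integral_add_left_eq_self (A n) η]
    have h2 : ‖∫ ξ, A n ξ‖ ^ 2 = ‖∫ h, ∫ η, starRingEnd ℂ (A n η) * A n (η + h)‖ := by
      rw [h1, norm_mul, RCLike.norm_conj, sq]
    rw [h2]
    refine (norm_integral_le_integral_norm _).trans_eq (integral_congr_ae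
      (Eventually.of_forall fun h => ?_))
    have h3 : ∀ η, starRingEnd ℂ (A n η) * A n (η + h) =
        Complex.exp ((s n * ‖h‖ ^ 2 + inner ℝ (y n) h : ℝ) * Complex.I) *
        (Complex.exp ((inner ℝ ((2 * s n) • h) η : ℝ) * Complex.I) * K h η) := by
      intro η
      simp only [hA, hK, map_mul, ← Complex.exp_conj, Complex.conj_ofReal, Complex.conj_I]
      rw [show Complex.exp ((s n * ‖h‖ ^ 2 + inner ℝ (y n) h : ℝ) * Complex.I) *
        (Complex.exp ((inner ℝ ((2 * s n) • h) η : ℝ) * Complex.I) *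
          (starRingEnd ℂ (F η) * F (η + h))) =
        (Complex.exp ((s n * ‖h‖ ^ 2 + inner ℝ (y n) h : ℝ) * Complex.I) *
        Complex.exp ((inner ℝ ((2 * s n) • h) η : ℝ) * Complex.I)) *
          (starRingEnd ℂ (F η) * F (η + h)) by ring]
      rw [show ∀ a b c d : ℂ, a * b * (c * d) = (a * c) * (b * d) by intros; ring,
        ← Complex.exp_add, ← Complex.exp_add]
      congr 2
      simp only [hΦ, norm_add_sq_real, inner_add_right, inner_smul_left, conj_trivial]
      rw [real_inner_comm h η]
      push_cast
      ring
    simp only [h3]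
    rw [integral_const_mul, norm_mul, Complex.norm_exp_ofReal_mul_I, one_mul]
  have hlim : Tendsto (fun n => ∫ h, ‖∫ η, Complex.exp ((inner ℝ ((2 * s n) • h) η : ℝ) *
      Complex.I) * K h η‖) atTop (𝓝 (∫ _ : V, (0 : ℝ))) := by
    have hKint : Integrable (fun z : V × V => K z.1 z.2) (volume.prod volume) := (hprod hF).swap
    refine tendsto_integral_of_dominated_convergence (fun h => ∫ η, ‖K h η‖) (fun n => ?_)
      hKint.norm.integral_prod_left ?_ ?_
    · refine (Integrable.integral_prod_left (f := fun z : V × V =>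
        Complex.exp ((inner ℝ ((2 * s n) • z.1) z.2 : ℝ) * Complex.I) * K z.1 z.2) (ν := volume)
        ?_).norm.aestronglyMeasurable
      exact integrable_phase_mul (by fun_prop) hKint
    · refine fun n => Eventually.of_forall fun h => ?_
      rw [norm_norm]
      refine (norm_integral_le_integral_norm _).trans_eq ?_
      simp only [norm_exp_phase_mul]
    · have h0 : ∀ᵐ h : V, h ≠ 0 := by
        simp [ae_iff]
      filter_upwards [h0] with h hh
      rw [← norm_zero (E := ℂ)]
      refine Tendsto.norm ?_
      suffices h9 : Tendsto (fun n => (2 * s n) • h) atTop (cocompact V) from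
        (tendsto_integral_exp_inner (K h)).comp h9
      rw [← Metric.cobounded_eq_cocompact, ← tendsto_norm_atTop_iff_cobounded]
      simp only [norm_smul, norm_mul]
      refine Tendsto.atTop_mul_const (norm_pos_iff.2 hh) (Tendsto.const_mul_atTop (by simp) ?_)
      exact tendsto_norm_cocompact_atTop.comp hs
  rw [integral_zero] at hlim
  have h2 := (squeeze_zero (fun n => by positivity) hsq hlim).sqrt
  simp only [Real.sqrt_sq (norm_nonneg _), Real.sqrt_zero] at h2
  exact tendsto_zero_iff_norm_tendsto_zero.2 h2

/-- Oscillation of `exp (i (s|ξ|² + y·ξ))` against integrable amplitudes. -/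
theorem tendsto_integral_exp_schrodinger [Nontrivial V] {F : V → ℂ} (hF : Integrable F) :
    Tendsto (fun a : ℝ × V =>
      ∫ ξ, Complex.exp ((a.1 * ‖ξ‖ ^ 2 + inner ℝ a.2 ξ : ℝ) * Complex.I) * F ξ)
      (cocompact (ℝ × V)) (𝓝 0) := by
  refine tendsto_of_subseq_tendsto fun a ha => ?_
  by_cases hs : Tendsto (fun n => (a n).1) atTop (cocompact ℝ)
  · exact ⟨id, tendsto_integral_exp_schrodinger_of_time hF hs fun n => (a n).2⟩
  -- Along a subsequence the times converge to σ, so the space parameters tend to infinity. Freezing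
  -- exp (iσ|ξ|²) into the amplitude leaves a Fourier integral and an error that vanishes by
  -- dominated convergence.
  obtain ⟨σ, hσ⟩ := exists_clusterPt_of_not_tendsto_cocompact hs
  obtain ⟨ψ, hψ, hlim⟩ := hσ.tendsto_subseq
  refine ⟨ψ, ?_⟩
  have hnorm : Tendsto (fun n => ‖a (ψ n)‖) atTop atTop :=
    (tendsto_norm_cocompact_atTop).comp (ha.comp hψ.tendsto_atTop)
  have hy : Tendsto (fun n => (a (ψ n)).2) atTop (cocompact V) := by
    rw [← Metric.cobounded_eq_cocompact, ← tendsto_norm_atTop_iff_cobounded]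
    have h1 : Tendsto (fun n => ‖(a (ψ n)).1‖) atTop (𝓝 ‖σ‖) := hlim.norm
    have h2 : Tendsto (fun n => -‖(a (ψ n)).1‖ + ‖a (ψ n)‖) atTop atTop :=
      tendsto_atTop_add_left_of_le' _ (-‖σ‖ - 1)
        ((h1.eventually (gt_mem_nhds (lt_add_one _))).mono fun n hn => by linarith) hnorm
    refine tendsto_atTop_mono (fun n => ?_) h2
    have : ‖a (ψ n)‖ ≤ ‖(a (ψ n)).1‖ + ‖(a (ψ n)).2‖ :=
      max_le (by simp) (by simp)
    linarith
  have hG : Integrable fun ξ : V => Complex.exp ((σ * ‖ξ‖ ^ 2 : ℝ) * Complex.I) * F ξ :=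
    integrable_phase_mul (by fun_prop) hF
  have h1 := (tendsto_integral_exp_inner fun ξ : V =>
    Complex.exp ((σ * ‖ξ‖ ^ 2 : ℝ) * Complex.I) * F ξ).comp hy
  have h2 : Tendsto (fun n => ∫ ξ : V, ‖Complex.exp (((a (ψ n)).1 * ‖ξ‖ ^ 2 : ℝ) * Complex.I) * F ξ -
      Complex.exp ((σ * ‖ξ‖ ^ 2 : ℝ) * Complex.I) * F ξ‖) atTop (𝓝 (∫ _ : V, (0 : ℝ))) := by
    refine tendsto_integral_of_dominated_convergence (fun ξ => 2 * ‖F ξ‖) (fun n =>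
      ((integrable_phase_mul (by fun_prop) hF).sub hG).norm.aestronglyMeasurable)
      (hF.norm.const_mul 2) ?_ ?_
    · refine fun n => Eventually.of_forall fun ξ => ?_
      rw [norm_norm]
      refine (norm_sub_le _ _).trans_eq ?_
      rw [norm_exp_phase_mul, norm_exp_phase_mul, two_mul]
    · refine Eventually.of_forall fun ξ => ?_
      have h3 : Continuous fun t : ℝ => ‖Complex.exp ((t * ‖ξ‖ ^ 2 : ℝ) * Complex.I) * F ξ -
        Complex.exp ((σ * ‖ξ‖ ^ 2 : ℝ) * Complex.I) * F ξ‖ := by fun_prop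
      simpa [Function.comp_def] using (h3.tendsto σ).comp hlim
  rw [integral_zero] at h2
  have h4 := h1.norm.add h2
  rw [norm_zero, add_zero] at h4
  refine squeeze_zero_norm (fun n => ?_) h4
  have h5 : ∀ ξ, Complex.exp (((a (ψ n)).1 * ‖ξ‖ ^ 2 + inner ℝ (a (ψ n)).2 ξ : ℝ) * Complex.I) *
      F ξ = Complex.exp ((inner ℝ (a (ψ n)).2 ξ : ℝ) * Complex.I) *
        (Complex.exp ((σ * ‖ξ‖ ^ 2 : ℝ) * Complex.I) * F ξ) +
        Complex.exp ((inner ℝ (a (ψ n)).2 ξ : ℝ) * Complex.I) *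
        (Complex.exp (((a (ψ n)).1 * ‖ξ‖ ^ 2 : ℝ) * Complex.I) * F ξ -
      Complex.exp ((σ * ‖ξ‖ ^ 2 : ℝ) * Complex.I) * F ξ) := fun ξ => by
    rw [mul_sub, add_sub_cancel, ← mul_assoc, ← Complex.exp_add]
    congr 2
    push_cast
    ring
  simp only [h5]
  have h6 : Integrable fun ξ : V => Complex.exp (((a (ψ n)).1 * ‖ξ‖ ^ 2 : ℝ) * Complex.I) * F ξ -
      Complex.exp ((σ * ‖ξ‖ ^ 2 : ℝ) * Complex.I) * F ξ :=
    (integrable_phase_mul (by fun_prop) hF).sub hG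
  rw [integral_add (integrable_phase_mul (by fun_prop) hG) (integrable_phase_mul (by fun_prop) h6)]
  refine (norm_add_le _ _).trans (add_le_add le_rfl ?_)
  refine (norm_integral_le_integral_norm _).trans_eq ?_
  simp only [norm_exp_phase_mul]

end Mixing

/-! ### Multiplication operators and the inverse Fourier transform on `L²` -/

/-- Multiplication by an essentially bounded function, as an operator on `L²`. -/
def mulOp (m : R4 → ℂ) (hm : MemLp m ∞ volume) : L2 →ₗ[ℂ] L2 where
  toFun F := (hm.toLp m • F : L2)
  map_add' F G := Lp.add_smul _ _ _
  map_smul' c F := by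
    apply Lp.ext
    filter_upwards [Lp.coeFn_lpSMul (r := 2) (hm.toLp m) (c • F), Lp.coeFn_smul c F,
      Lp.coeFn_smul c (hm.toLp m • F : L2), Lp.coeFn_lpSMul (r := 2) (hm.toLp m) F] with x a b d e
    simp only [a, Pi.smul_apply', b, Pi.smul_apply, d, e, smul_eq_mul, RingHom.id_apply]
    ring

theorem coeFn_mulOp (m : R4 → ℂ) (hm : MemLp m ∞ volume) (F : L2) :
    mulOp m hm F =ᵐ[volume] fun ξ => m ξ * F ξ := by
  filter_upwards [Lp.coeFn_lpSMul (r := 2) (hm.toLp m) F, hm.coeFn_toLp] with x a b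
  change (hm.toLp m • F : L2) x = _
  rw [a, Pi.smul_apply', b, smul_eq_mul]

theorem multiplier_eq (m : R4 → ℂ) (hm : MemLp m ∞ volume) (f : L2) :
    multiplier m hm f = 𝓕⁻ (mulOp m hm (𝓕 f)) := rfl

theorem mulOp_ext {m : R4 → ℂ} (hm : MemLp m ∞ volume) (F G : L2)
    (h : G =ᵐ[volume] fun ξ => m ξ * F ξ) : mulOp m hm F = G :=
  Lp.ext ((coeFn_mulOp m hm F).trans h.symm)

theorem norm_sq_eq_integral (F : L2) : ‖F‖ ^ 2 = ∫ ξ, ‖F ξ‖ ^ 2 := by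
  have h := @inner_self_eq_norm_sq_to_K ℂ L2 _ _ _ F
  rw [L2.inner_def] at h
  simp only [inner_self_eq_norm_sq_to_K] at h
  have h2 : ((∫ ξ, ‖F ξ‖ ^ 2 : ℝ) : ℂ) = ((‖F‖ ^ 2 : ℝ) : ℂ) := by
    rw [← integral_complex_ofReal]
    push_cast
    exact h
  exact (Complex.ofReal_injective h2).symm

theorem integrable_norm_sq (F : L2) : Integrable fun ξ => ‖F ξ‖ ^ 2 :=
  (Lp.memLp F).integrable_norm_pow (by norm_num)

theorem inner_eq_integral (F G : L2) :
    inner ℂ F G = ∫ ξ, G ξ * starRingEnd ℂ (F ξ) := by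
  rw [L2.inner_def]
  rfl

theorem integrable_inner (F G : L2) : Integrable fun ξ => G ξ * starRingEnd ℂ (F ξ) :=
  L2.integrable_inner (𝕜 := ℂ) F G

/-- The pointwise inverse Fourier integral. -/
def invF (F : R4 → ℂ) (x : R4) : ℂ :=
  ∫ ξ, Complex.exp ((2 * Real.pi * inner ℝ x ξ : ℝ) * Complex.I) * F ξ

theorem continuous_invF {F : R4 → ℂ} (hF : Integrable F) : Continuous (invF F) := by
  refine continuous_of_dominated (bound := fun ξ => ‖F ξ‖) (fun x => ?_) (fun x => ?_) hF.norm ?_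
  · exact (integrable_phase_mul (by fun_prop) hF).aestronglyMeasurable
  · exact Eventually.of_forall fun ξ => (norm_exp_phase_mul _ _).le
  · exact Eventually.of_forall fun ξ => by fun_prop

/-- The multiplication formula for Fourier integrals, with the bilinear form negated so as to give
the inverse transform. -/
theorem integral_fourierInv_schwartz_mul (g : 𝓢(R4, ℂ)) {F : R4 → ℂ} (hF : Integrable F) :
    ∫ ξ, (𝓕⁻ g) ξ * F ξ = ∫ x, g x * invF F x := by
  have h := VectorFourier.integral_fourierIntegral_smul_eq_flip (μ := (volume : Measure R4))
    (ν := (volume : Measure R4)) (L := -innerₗ R4) (e := Real.fourierChar) (f := g) (g := F)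
    Real.continuous_fourierChar (by simpa using! continuous_inner.neg) g.integrable hF
  simp only [smul_eq_mul] at h
  refine Eq.trans ?_ (h.trans ?_)
  · simp only [SchwartzMap.fourierInv_coe]
    rfl
  refine integral_congr_ae (Eventually.of_forall fun x => ?_)
  simp only [invF, VectorFourier.fourierIntegral]
  congr 1
  refine integral_congr_ae (Eventually.of_forall fun ξ => ?_)
  simp [Circle.smul_def, Real.fourierChar_apply]

/-- On `L¹ ∩ L²` the inverse Fourier transform is given by the inverse Fourier integral. -/
theorem fourierInv_ae_eq (F : L2) (hF : Integrable (F : R4 → ℂ)) :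
    (𝓕⁻ F : L2) =ᵐ[volume] invF F := by
  refine ae_eq_of_integral_contDiff_smul_eq ((Lp.memLp _).locallyIntegrable (by norm_num))
    (continuous_invF hF).locallyIntegrable fun g hg hgc => ?_
  have hg₁ : HasCompactSupport (Complex.ofRealCLM ∘ g) := hgc.comp_left rfl
  have hg₂ : ContDiff ℝ ∞ (Complex.ofRealCLM ∘ g) := by fun_prop
  have h1 := integral_fourierInv_schwartz_mul (hg₁.toSchwartzMap hg₂) hF
  have h2 : ((𝓕⁻ F : L2) : 𝓢'(R4, ℂ)) (hg₁.toSchwartzMap hg₂) =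
      (F : 𝓢'(R4, ℂ)) (𝓕⁻ (hg₁.toSchwartzMap hg₂)) := by
    rw [← Lp.fourierInv_toTemperedDistribution_eq]
    rfl
  rw [Lp.toTemperedDistribution_apply, Lp.toTemperedDistribution_apply] at h2
  simp only [smul_eq_mul] at h2
  rw [h1] at h2
  simpa using h2

/-! ### Unitary phase groups on `L²` -/

/-- A family of phases that depends additively on `ℝ × ℝ⁴` and oscillates at infinity. -/
structure PhaseFamily where
  /-- The phase. -/
  toFun : ℝ × R4 → R4 → ℝ
  continuous_freq : ∀ a, Continuous (toFun a)
  continuous_param : ∀ ξ, Continuous fun a => toFun a ξ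
  add : ∀ a b ξ, toFun (a + b) ξ = toFun a ξ + toFun b ξ
  oscillation : ∀ F : R4 → ℂ, Integrable F → Tendsto
    (fun a => ∫ ξ, Complex.exp (toFun a ξ * Complex.I) * F ξ) (cocompact (ℝ × R4)) (𝓝 0)

namespace PhaseFamily

variable (θ : PhaseFamily)

theorem zero (ξ : R4) : θ.toFun 0 ξ = 0 := by
  have := θ.add 0 0 ξ
  rw [add_zero] at this
  linarith

/-- The multiplication operator by the phase. -/
def mul (a : ℝ × R4) : L2 →ₗᵢ[ℂ] L2 where
  toLinearMap := mulOp _ (memLp_phase (θ.continuous_freq a))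
  norm_map' F := by
    have h : ‖mulOp _ (memLp_phase (θ.continuous_freq a)) F‖ ^ 2 = ‖F‖ ^ 2 := by
      rw [norm_sq_eq_integral, norm_sq_eq_integral]
      refine integral_congr_ae ?_
      filter_upwards [coeFn_mulOp _ (memLp_phase (θ.continuous_freq a)) F] with ξ h
      rw [h, norm_exp_phase_mul]
    exact (sq_eq_sq₀ (norm_nonneg _) (norm_nonneg _)).1 h

theorem coeFn_mul (a : ℝ × R4) (F : L2) :
    θ.mul a F =ᵐ[volume] fun ξ => Complex.exp (θ.toFun a ξ * Complex.I) * F ξ :=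
  coeFn_mulOp _ _ F

theorem mul_add (a b : ℝ × R4) (F : L2) : θ.mul (a + b) F = θ.mul a (θ.mul b F) := by
  apply Lp.ext
  filter_upwards [θ.coeFn_mul (a + b) F, θ.coeFn_mul a (θ.mul b F), θ.coeFn_mul b F] with ξ h1 h2 h3
  rw [h1, h2, h3, θ.add, ← mul_assoc, ← Complex.exp_add]
  push_cast
  ring_nf

theorem mul_zero (F : L2) : θ.mul 0 F = F := by
  apply Lp.ext
  filter_upwards [θ.coeFn_mul 0 F] with ξ h1
  rw [h1, θ.zero]
  simp

theorem inner_mul (a : ℝ × R4) (F G : L2) : inner ℂ F (θ.mul a G) =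
    ∫ ξ, Complex.exp (θ.toFun a ξ * Complex.I) * (G ξ * starRingEnd ℂ (F ξ)) := by
  rw [inner_eq_integral]
  refine integral_congr_ae ?_
  filter_upwards [θ.coeFn_mul a G] with ξ h
  rw [h, mul_assoc]

/-- By unitarity ‖U_a F - U_b F‖² = 2‖F‖² - 2 Re ⟨U_b F, U_a F⟩, so it suffices that matrix
coefficients are continuous, which is dominated convergence. -/
theorem continuous_mul (F : L2) : Continuous fun a => θ.mul a F := by
  have hw : ∀ G, Continuous fun a => inner ℂ G (θ.mul a F) := by
    intro G
    simp only [θ.inner_mul]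
    refine continuous_of_dominated (bound := fun ξ => ‖F ξ * starRingEnd ℂ (G ξ)‖) (fun a => ?_)
      (fun a => ?_) (integrable_inner G F).norm ?_
    · exact (integrable_phase_mul (θ.continuous_freq a).measurable
        (integrable_inner G F)).aestronglyMeasurable
    · exact Eventually.of_forall fun ξ => (norm_exp_phase_mul _ _).le
    · refine Eventually.of_forall fun ξ => ?_
      have := θ.continuous_param ξ
      fun_prop
  rw [continuous_iff_continuousAt]
  intro b
  rw [ContinuousAt, tendsto_iff_norm_sub_tendsto_zero]
  have h1 : Tendsto (fun a => 2 * ‖F‖ ^ 2 - 2 * (inner ℂ (θ.mul b F) (θ.mul a F)).re) (𝓝 b)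
      (𝓝 0) := by
    have h2 := (((Complex.continuous_re.comp (hw (θ.mul b F))).tendsto b).const_mul 2).const_sub
      (2 * ‖F‖ ^ 2)
    refine h2.trans_eq ?_
    simp only [Function.comp_apply]
    rw [inner_self_eq_norm_sq_to_K]
    rw [(θ.mul b).norm_map]
    congr 1
    rw [sub_eq_zero]
    norm_cast
  have h3 := h1.sqrt
  rw [Real.sqrt_zero] at h3
  refine h3.congr fun a => ?_
  have h4 : 2 * ‖F‖ ^ 2 - 2 * (inner ℂ (θ.mul b F) (θ.mul a F)).re =
      ‖θ.mul a F - θ.mul b F‖ ^ 2 := by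
    rw [@norm_sub_sq ℂ, (θ.mul a).norm_map, (θ.mul b).norm_map, inner_re_symm]
    simp only [RCLike.re_to_complex]
    ring
  rw [h4, Real.sqrt_sq (norm_nonneg _)]

/-- The unitary representation attached to a family of phases. -/
def rep : MixingRep (ℝ × R4) L2 where
  toFun := θ.mul
  map_add := θ.mul_add
  map_zero := θ.mul_zero
  continuous_apply := θ.continuous_mul
  mixing F G := by
    simp only [θ.inner_mul]
    exact θ.oscillation _ (integrable_inner F G)

end PhaseFamily

theorem phase_eq_inner (ξ y : R4) : -(2 * Real.pi * inner ℝ y ξ) =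
    inner ℝ ((-(2 * Real.pi)) • y) ξ := by
  rw [inner_smul_left]
  simp

theorem tendsto_rescale_cocompact {c d : ℝ} (hc : c ≠ 0) (hd : d ≠ 0) :
    Tendsto (fun a : ℝ × R4 => (c * a.1, d • a.2)) (cocompact (ℝ × R4)) (cocompact (ℝ × R4)) :=
  ((Homeomorph.mulLeft₀ c hc).prodCongr
    (Homeomorph.smulOfNeZero (α := R4) d hd)).isClosedEmbedding.tendsto_cocompact

theorem finrank_R4 : Module.finrank ℝ R4 = 4 := by simp

/-- The phases of the operators `exp (-i s Δ) τ_y`. -/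
def schrodingerPhase : PhaseFamily where
  toFun a ξ := a.1 * (2 * Real.pi * ‖ξ‖) ^ 2 - 2 * Real.pi * inner ℝ a.2 ξ
  continuous_freq a := by fun_prop
  continuous_param ξ := by fun_prop
  add a b ξ := by simp only [Prod.fst_add, Prod.snd_add, inner_add_left]; ring
  oscillation F hF := by
    refine ((tendsto_integral_exp_schrodinger hF).comp (tendsto_rescale_cocompact
      (c := (2 * Real.pi) ^ 2) (d := -(2 * Real.pi)) (by positivity)
      (by simp [Real.pi_ne_zero]))).congr fun a => ?_
    simp only [Function.comp_apply]
    congr! 5 with ξ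
    rw [← phase_eq_inner]
    push_cast
    ring

/-- The phases of the operators `exp (-i s |∇|) τ_y`. -/
def wavePhase : PhaseFamily where
  toFun a ξ := -(a.1 * (2 * Real.pi * ‖ξ‖)) - 2 * Real.pi * inner ℝ a.2 ξ
  continuous_freq a := by fun_prop
  continuous_param ξ := by fun_prop
  add a b ξ := by simp only [Prod.fst_add, Prod.snd_add, inner_add_left]; ring
  oscillation F hF := by
    refine ((tendsto_integral_exp_wave (by simp) hF).comp (tendsto_rescale_cocompact
      (c := -(2 * Real.pi)) (d := -(2 * Real.pi)) (by simp [Real.pi_ne_zero])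
      (by simp [Real.pi_ne_zero]))).congr fun a => ?_
    simp only [Function.comp_apply]
    congr! 5 with ξ
    rw [← phase_eq_inner]
    push_cast
    ring

theorem schrodinger_translate (s : ℝ) (y : R4) (f : L2) :
    schrodinger (-s) (translate y f) = 𝓕⁻ (schrodingerPhase.mul (s, y) (𝓕 f)) := by
  rw [schrodinger, multiplier_eq, fourier_translate]
  congr 1
  apply Lp.ext
  have h1 := coeFn_mulOp (fun ξ : R4 => Complex.exp ((-(-s * (2 * Real.pi * ‖ξ‖) ^ 2) : ℝ) * Complex.I))
    (memLp_phase (by fun_prop)) (mulOp _ (memLp_phase (θ := fun ξ => -(2 * Real.pi * inner ℝ y ξ))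
      (by fun_prop)) (𝓕 f))
  filter_upwards [h1, schrodingerPhase.coeFn_mul (s, y) (𝓕 f), coeFn_mulOp _ (memLp_phase
    (θ := fun ξ : R4 => -(2 * Real.pi * inner ℝ y ξ)) (by fun_prop)) (𝓕 f)] with ξ h1 h2 h3
  refine h1.trans ?_
  rw [h2, h3, ← mul_assoc, ← Complex.exp_add]
  congr 2
  simp only [schrodingerPhase]
  push_cast
  ring

theorem halfWave_translate (s : ℝ) (y : R4) (f : L2) :
    halfWave (-s) (translate y f) = 𝓕⁻ (wavePhase.mul (s, y) (𝓕 f)) := by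
  rw [halfWave, multiplier_eq, fourier_translate]
  congr 1
  apply Lp.ext
  have h1 := coeFn_mulOp (fun ξ : R4 => Complex.exp ((-s * (2 * Real.pi * ‖ξ‖) : ℝ) * Complex.I))
    (memLp_phase (by fun_prop)) (mulOp _ (memLp_phase (θ := fun ξ => -(2 * Real.pi * inner ℝ y ξ))
      (by fun_prop)) (𝓕 f))
  filter_upwards [h1, wavePhase.coeFn_mul (s, y) (𝓕 f), coeFn_mulOp _ (memLp_phase
    (θ := fun ξ : R4 => -(2 * Real.pi * inner ℝ y ξ)) (by fun_prop)) (𝓕 f)] with ξ h1 h2 h3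
  refine h1.trans ?_
  rw [h2, h3, ← mul_assoc, ← Complex.exp_add]
  congr 2
  simp only [wavePhase]
  push_cast
  ring

/-! ### The isometry between `L²` and `H¹` -/

/-- The weight `(1 + (2π|ξ|)²)^{1/2}`. -/
def japanese (ξ : R4) : ℝ := √(1 + (2 * Real.pi * ‖ξ‖) ^ 2)

theorem one_le_japanese (ξ : R4) : 1 ≤ japanese ξ := by
  rw [japanese, Real.one_le_sqrt]
  nlinarith [sq_nonneg (2 * Real.pi * ‖ξ‖)]

theorem japanese_pos (ξ : R4) : 0 < japanese ξ := zero_lt_one.trans_le (one_le_japanese ξ)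

theorem japanese_sq (ξ : R4) : japanese ξ ^ 2 = 1 + (2 * Real.pi * ‖ξ‖) ^ 2 :=
  Real.sq_sqrt (by positivity)

theorem le_japanese (ξ : R4) : 2 * Real.pi * ‖ξ‖ ≤ japanese ξ :=
  Real.le_sqrt_of_sq_le (by linarith)

theorem continuous_japanese : Continuous japanese := by
  unfold japanese
  fun_prop

theorem continuous_japanese_inv : Continuous fun ξ => (japanese ξ)⁻¹ :=
  continuous_japanese.inv₀ fun ξ => (japanese_pos ξ).ne'

theorem memLp_of_continuous_bound {f : R4 → ℝ} (hf : Continuous f) (C : ℝ) (h : ∀ ξ, |f ξ| ≤ C) :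
    MemLp (fun ξ => (f ξ : ℂ)) ∞ volume := by
  refine memLp_top_of_bound (C := C) (by fun_prop : Continuous fun ξ =>
    (f ξ : ℂ)).aestronglyMeasurable ?_
  exact Eventually.of_forall fun ξ => by rw [Complex.norm_real]; exact h ξ

theorem memLp_japanese_inv : MemLp (fun ξ : R4 => (((japanese ξ)⁻¹ : ℝ) : ℂ)) ∞ volume :=
  memLp_of_continuous_bound continuous_japanese_inv 1 fun ξ => by
    rw [abs_of_pos (inv_pos.2 (japanese_pos ξ))]
    exact inv_le_one_of_one_le₀ (one_le_japanese ξ)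

/-- The Fourier multiplier `(1 + |∇|²)^{-1/2}`, seen on the frequency side. -/
def bessel : L2 →ₗ[ℂ] L2 := mulOp _ memLp_japanese_inv

theorem coeFn_bessel (F : L2) :
    bessel F =ᵐ[volume] fun ξ => (((japanese ξ)⁻¹ : ℝ) : ℂ) * F ξ := coeFn_mulOp _ _ F

/-- Membership in `H1` is tested with this weight, while `japanese`, with its 2π, makes the H¹ norm
exact. With the converse bound, both weights describe the same space. -/
theorem weight_le_japanese (ξ : R4) : (1 + ‖ξ‖ ^ 2) ^ ((1 : ℝ) / 2) ≤ japanese ξ := by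
  rw [japanese, ← Real.sqrt_eq_rpow]
  refine Real.sqrt_le_sqrt ?_
  have : ‖ξ‖ ^ 2 ≤ (2 * Real.pi * ‖ξ‖) ^ 2 := by
    gcongr
    nlinarith [norm_nonneg ξ, Real.pi_gt_three]
  linarith

theorem japanese_le_weight (ξ : R4) :
    japanese ξ ≤ 2 * Real.pi * (1 + ‖ξ‖ ^ 2) ^ ((1 : ℝ) / 2) := by
  rw [japanese, ← Real.sqrt_eq_rpow, ← Real.sqrt_sq (show 0 ≤ 2 * Real.pi by positivity),
    ← Real.sqrt_mul (by positivity)]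
  refine Real.sqrt_le_sqrt ?_
  rw [Real.sqrt_sq (by positivity)]
  nlinarith [Real.pi_gt_three, sq_nonneg ‖ξ‖]

theorem weight_neg (ξ : R4) :
    (1 + ‖ξ‖ ^ 2) ^ ((-1 : ℝ) / 2) = ((1 + ‖ξ‖ ^ 2) ^ ((1 : ℝ) / 2))⁻¹ := by
  rw [← Real.rpow_neg (by positivity)]
  norm_num

theorem continuous_weight : Continuous fun ξ : R4 => (1 + ‖ξ‖ ^ 2) ^ ((1 : ℝ) / 2) := by
  simp only [← Real.sqrt_eq_rpow]
  fun_prop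

theorem weight_pos (ξ : R4) : 0 < (1 + ‖ξ‖ ^ 2) ^ ((1 : ℝ) / 2) := by positivity

theorem fourierInv_bessel_mem (F : L2) : (𝓕⁻ (bessel F) : L2) ∈ H1 := by
  rw [mem_H1_iff]
  have hm : MemLp (fun ξ : R4 => (((1 + ‖ξ‖ ^ 2) ^ ((1 : ℝ) / 2) * (japanese ξ)⁻¹ : ℝ) : ℂ))
      ∞ volume := by
    refine memLp_of_continuous_bound (continuous_weight.mul continuous_japanese_inv) 1 fun ξ => ?_
    rw [abs_of_pos (mul_pos (weight_pos ξ) (inv_pos.2 (japanese_pos ξ))), ← div_eq_mul_inv,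
      div_le_one (japanese_pos ξ)]
    exact weight_le_japanese ξ
  refine ⟨mulOp _ hm F, ?_⟩
  rw [FourierTransform.fourier_fourierInv_eq]
  change _ = mulOp _ memLp_weight_inv _
  symm
  refine mulOp_ext _ _ _ ?_
  filter_upwards [coeFn_mulOp _ hm F, coeFn_bessel F] with ξ h1 h2
  rw [h1, h2, weight_neg, ← mul_assoc, ← Complex.ofReal_mul, inv_mul_cancel_left₀ (weight_pos ξ).ne']

/-- The linear map `F ↦ (1 + |∇|²)^{-1/2} 𝓕⁻¹ F` from `L²` to `H¹`. -/
def toH1 : L2 →ₗ[ℂ] H1 where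
  toFun F := ⟨𝓕⁻ (bessel F), fourierInv_bessel_mem F⟩
  map_add' F G := by
    ext1
    simp only [map_add, FourierTransform.fourierInv_add]
    rfl
  map_smul' c F := by
    ext1
    simp only [map_smul, FourierTransform.fourierInv_smul]
    rfl

theorem coe_toH1 (F : L2) : (toH1 F : L2) = 𝓕⁻ (bessel F) := rfl

theorem fourier_toH1 (F : L2) : 𝓕 (toH1 F : L2) = bessel F :=
  FourierTransform.fourier_fourierInv_eq _

theorem toH1_surjective (f : H1) : ∃ F, toH1 F = f := by
  obtain ⟨h, hh⟩ := (mem_H1_iff _).1 f.2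
  have hm : MemLp (fun ξ : R4 => ((japanese ξ * ((1 + ‖ξ‖ ^ 2) ^ ((1 : ℝ) / 2))⁻¹ : ℝ) : ℂ))
      ∞ volume := by
    refine memLp_of_continuous_bound (continuous_japanese.mul (continuous_weight.inv₀
      fun ξ => (weight_pos ξ).ne')) (2 * Real.pi) fun ξ => ?_
    rw [abs_of_pos (mul_pos (japanese_pos ξ) (inv_pos.2 (weight_pos ξ))), ← div_eq_mul_inv,
      div_le_iff₀ (weight_pos ξ)]
    exact japanese_le_weight ξ
  refine ⟨mulOp _ hm h, Subtype.ext ?_⟩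
  have hf : 𝓕⁻ (𝓕 (f : L2) : L2) = (f : L2) := FourierTransform.fourierInv_fourier_eq _
  rw [coe_toH1, ← hf, hh]
  congr 1
  refine mulOp_ext _ _ _ ?_
  filter_upwards [coeFn_mulOp _ hm h, coeFn_mulOp _ memLp_weight_inv h] with ξ h1 h2
  rw [h1, ← mul_assoc, ← Complex.ofReal_mul, inv_mul_cancel_left₀ (japanese_pos ξ).ne',
    ← weight_neg]
  exact h2

/-- The symbol 2πi ξⱼ of ∂ⱼ becomes bounded after division by `japanese`. Both sides are then in L²
and can be compared as tempered distributions. -/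
theorem fourier_weakPartial (F : L2) (j : Fin 4) :
    (𝓕 (weakPartial (toH1 F) j) : L2) =ᵐ[volume] fun ξ => 2 * Real.pi * Complex.I * (ξ j : ℂ) *
      ((((japanese ξ)⁻¹ : ℝ) : ℂ) * F ξ) := by
  have hm : MemLp (fun ξ : R4 => (((ξ j) * (japanese ξ)⁻¹ : ℝ) : ℂ)) ∞ volume := by
    refine memLp_of_continuous_bound ((by fun_prop : Continuous fun ξ : R4 => ξ j).mul
      continuous_japanese_inv) 1 fun ξ => ?_
    rw [abs_mul, abs_of_pos (inv_pos.2 (japanese_pos ξ)), ← div_eq_mul_inv,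
      div_le_one (japanese_pos ξ)]
    have h1 : |ξ j| ≤ ‖ξ‖ := PiLp.norm_apply_le ξ j
    nlinarith [le_japanese ξ, norm_nonneg ξ, Real.pi_gt_three]
  have hK : (𝓕 (weakPartial (toH1 F) j) : L2) = (2 * Real.pi * Complex.I) • mulOp _ hm F := by
    apply toTemperedDistribution_injective
    rw [← Lp.fourier_toTemperedDistribution_eq, weakPartial_spec,
      TemperedDistribution.fourier_lineDerivOp_eq, Lp.fourier_toTemperedDistribution_eq,
      fourier_toH1]
    have hs : TemperedDistribution.smulLeftCLM ℂ
        (fun ξ : R4 => ((inner ℝ ξ (EuclideanSpace.single j (1 : ℝ)) : ℝ) : ℂ))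
        (bessel F : 𝓢'(R4, ℂ)) = (mulOp _ hm F : 𝓢'(R4, ℂ)) := by
      ext u
      have ht : (fun ξ : R4 =>
        ((inner ℝ ξ (EuclideanSpace.single j (1 : ℝ)) : ℝ) : ℂ)).HasTemperateGrowth := by
        fun_prop
      rw [TemperedDistribution.smulLeftCLM_apply_apply, Lp.toTemperedDistribution_apply,
        Lp.toTemperedDistribution_apply]
      refine integral_congr_ae ?_
      filter_upwards [coeFn_mulOp _ hm F, coeFn_bessel F] with ξ h1 h2
      rw [h1, h2, SchwartzMap.smulLeftCLM_apply_apply ht]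
      simp only [EuclideanSpace.inner_single_right, smul_eq_mul]
      push_cast
      simp
      ring_nf
    rw [hs, ← Lp.toTemperedDistributionCLM_apply, ← Lp.toTemperedDistributionCLM_apply,
      map_smul]
  rw [hK]
  filter_upwards [Lp.coeFn_smul (2 * Real.pi * Complex.I) (mulOp _ hm F), coeFn_mulOp _ hm F]
    with ξ h1 h2
  rw [h1, Pi.smul_apply, h2, smul_eq_mul]
  push_cast
  ring

/-- Plancherel: the function and its partial derivatives together contribute 1 + (2π|ξ|)², which
cancels the squared weight in `bessel`. -/
theorem h1NormSq_toH1 (F : L2) : h1NormSq (toH1 F) = ‖F‖ ^ 2 := by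
  rw [h1NormSq, ← Lp.norm_fourier_eq, fourier_toH1]
  have h0 : ∀ j, ‖weakPartial (toH1 F) j‖ ^ 2 =
      ∫ ξ, ‖𝓕 (weakPartial (toH1 F) j) ξ‖ ^ 2 := fun j => by
    rw [← norm_sq_eq_integral, Lp.norm_fourier_eq]
  simp only [h0]
  rw [norm_sq_eq_integral, norm_sq_eq_integral, ← integral_finsetSum _ fun j _ =>
    integrable_norm_sq _, ← integral_add (integrable_norm_sq _)
    (integrable_finsetSum _ fun j _ => integrable_norm_sq _)]
  refine integral_congr_ae ?_
  filter_upwards [coeFn_bessel F, ae_all_iff.2 fun j => fourier_weakPartial F j] with ξ h1 h2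
  have h3 : ∑ j, ‖𝓕 (weakPartial (toH1 F) j) ξ‖ ^ 2 =
      (2 * Real.pi * ‖ξ‖) ^ 2 * ((japanese ξ)⁻¹ * ‖F ξ‖) ^ 2 := by
    rw [mul_pow, EuclideanSpace.norm_sq_eq, Finset.mul_sum, Finset.sum_mul]
    refine Finset.sum_congr rfl fun j _ => ?_
    rw [h2 j]
    simp only [norm_mul, Complex.norm_real, Complex.norm_I, Complex.norm_ofNat, norm_inv,
      Real.norm_eq_abs, abs_of_pos (japanese_pos ξ), abs_of_pos Real.pi_pos, mul_pow, sq_abs]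
    simp
  rw [h1, h3, norm_mul, Complex.norm_real, Real.norm_eq_abs, abs_of_pos (inv_pos.2 (japanese_pos ξ))]
  have h4 := japanese_sq ξ
  have h5 := (japanese_pos ξ).ne'
  field_simp
  rw [h4]
  ring

theorem norm_sq_coe_toH1 (F : L2) : ‖(toH1 F : L2)‖ ^ 2 = ‖bessel F‖ ^ 2 := by
  rw [← Lp.norm_fourier_eq, fourier_toH1]

theorem norm_bessel_le (F : L2) : ‖bessel F‖ ≤ ‖F‖ := by
  rw [← sq_le_sq₀ (norm_nonneg _) (norm_nonneg _)]
  have h := h1NormSq_toH1 F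
  rw [h1NormSq, norm_sq_coe_toH1] at h
  have : 0 ≤ ∑ j : Fin 4, ‖weakPartial (toH1 F) j‖ ^ 2 := Finset.sum_nonneg fun _ _ => by positivity
  linarith

theorem toH1_injective : Function.Injective toH1 := by
  rw [injective_iff_map_eq_zero]
  intro F hF
  have h1 : h1NormSq (toH1 F) = h1NormSq (toH1 0) := by rw [hF, map_zero]
  rw [h1NormSq_toH1, h1NormSq_toH1] at h1
  simpa using h1

theorem bessel_mul (θ : PhaseFamily) (a : ℝ × R4) (F : L2) :
    bessel (θ.mul a F) = θ.mul a (bessel F) := by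
  apply Lp.ext
  filter_upwards [coeFn_bessel (θ.mul a F), θ.coeFn_mul a (bessel F), θ.coeFn_mul a F,
    coeFn_bessel F] with ξ h1 h2 h3 h4
  rw [h1, h2, h3, h4]
  ring

theorem groupElement_toH1 (s : ℝ) (y : R4) (F G : L2) :
    groupElement s y (toH1 F, 𝓕⁻ G) =
      (toH1 (schrodingerPhase.mul (s, y) F), 𝓕⁻ (wavePhase.mul (s, y) G)) := by
  refine Prod.ext (Subtype.ext ?_) ?_
  · change schrodinger (-s) (translate y (toH1 F : L2)) = _
    rw [schrodinger_translate, fourier_toH1, ← bessel_mul]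
    rfl
  · change halfWave (-s) (translate y (𝓕⁻ G)) = _
    rw [halfWave_translate, FourierTransform.fourier_fourierInv_eq]

/-! ### Square integrable symbols and low-frequency truncation -/

/-- The phases restrict to modulations on the subgroup of translations. -/
def PhaseFamily.IsTranslation (θ : PhaseFamily) : Prop :=
  ∀ y ξ, θ.toFun (0, y) ξ = -(2 * Real.pi * inner ℝ y ξ)

theorem schrodingerPhase_isTranslation : schrodingerPhase.IsTranslation := fun y ξ => by
  simp [schrodingerPhase]

theorem wavePhase_isTranslation : wavePhase.IsTranslation := fun y ξ => by
  simp [wavePhase]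

theorem integrable_mulOp {m : R4 → ℂ} (hm : MemLp m ∞ volume) (hm2 : MemLp m 2 volume) (F : L2) :
    Integrable (mulOp m hm F : R4 → ℂ) :=
  (hm2.integrable_mul (Lp.memLp F)).congr (coeFn_mulOp m hm F).symm

theorem invF_mulOp {m : R4 → ℝ} (hm : MemLp (fun ξ => (m ξ : ℂ)) ∞ volume)
    (hm2 : MemLp (fun ξ => (m ξ : ℂ)) 2 volume) {θ : PhaseFamily} (hθ : θ.IsTranslation)
    (F : L2) (x : R4) :
    invF (mulOp _ hm F) x = inner ℂ (hm2.toLp _) (θ.mul (0, -x) F) := by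
  rw [invF, inner_eq_integral]
  refine integral_congr_ae ?_
  filter_upwards [coeFn_mulOp _ hm F, hm2.coeFn_toLp, θ.coeFn_mul (0, -x) F] with ξ h1 h2 h3
  rw [h1, h2, h3, hθ, Complex.conj_ofReal, inner_neg_left]
  push_cast
  ring_nf

/-- A square integrable symbol makes point evaluation a bounded functional: the value at x is a
matrix coefficient of the group at the translation by -x. The low-frequency bounds, Rellich's
theorem, dispersion and the detection of Y all rest on this. -/
theorem fourierInv_mulOp_ae_eq {m : R4 → ℝ} (hm : MemLp (fun ξ => (m ξ : ℂ)) ∞ volume)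
    (hm2 : MemLp (fun ξ => (m ξ : ℂ)) 2 volume) {θ : PhaseFamily} (hθ : θ.IsTranslation)
    (F : L2) :
    (𝓕⁻ (mulOp _ hm F) : L2) =ᵐ[volume] fun x => inner ℂ (hm2.toLp _) (θ.mul (0, -x) F) := by
  refine (fourierInv_ae_eq _ (integrable_mulOp hm hm2 F)).trans ?_
  exact Eventually.of_forall fun x => invF_mulOp hm hm2 hθ F x

/-- The indicator function of a ball in frequency space. -/
def ballSymbol (R : ℝ) (ξ : R4) : ℝ := (Metric.closedBall (0 : R4) R).indicator (fun _ => 1) ξ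

theorem ballSymbol_of_le {R : ℝ} {ξ : R4} (h : ‖ξ‖ ≤ R) : ballSymbol R ξ = 1 :=
  Set.indicator_of_mem (by simpa using h) _

theorem ballSymbol_of_lt {R : ℝ} {ξ : R4} (h : R < ‖ξ‖) : ballSymbol R ξ = 0 :=
  Set.indicator_of_notMem (by simpa using h) _

theorem abs_ballSymbol_le (R : ℝ) (ξ : R4) : |ballSymbol R ξ| ≤ 1 := by
  rcases le_or_gt ‖ξ‖ R with h | h
  · simp [ballSymbol_of_le h]
  · simp [ballSymbol_of_lt h]

theorem measurable_ballSymbol (R : ℝ) : Measurable (ballSymbol R) :=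
  measurable_const.indicator Metric.isClosed_closedBall.measurableSet

/-- Bounded measurable symbols supported in a ball belong to every `L^p`. -/
theorem memLp_of_ball {m : R4 → ℝ} (hm : Measurable m) {R C : ℝ} (hC : ∀ ξ, |m ξ| ≤ C)
    (hR : ∀ ξ, R < ‖ξ‖ → m ξ = 0) (p : ℝ≥0∞) : MemLp (fun ξ => (m ξ : ℂ)) p volume := by
  have h1 : (fun ξ => (m ξ : ℂ)) = (Metric.closedBall (0 : R4) R).indicator fun ξ => (m ξ : ℂ) := by
    ext ξ
    by_cases h : ξ ∈ Metric.closedBall (0 : R4) R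
    · rw [Set.indicator_of_mem h]
    · rw [Set.indicator_of_notMem h, hR ξ (by simpa using h), Complex.ofReal_zero]
  rw [h1, memLp_indicator_iff_restrict Metric.isClosed_closedBall.measurableSet]
  have : IsFiniteMeasure (volume.restrict (Metric.closedBall (0 : R4) R)) :=
    ⟨by rw [Measure.restrict_apply_univ]; exact measure_closedBall_lt_top⟩
  refine MemLp.of_bound (C := C) ?_ (Eventually.of_forall fun ξ => ?_)
  · exact (Complex.measurable_ofReal.comp hm).aestronglyMeasurable
  · rw [Complex.norm_real]; exact hC ξ

theorem memLp_ballSymbol (R : ℝ) (p : ℝ≥0∞) :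
    MemLp (fun ξ => (ballSymbol R ξ : ℂ)) p volume :=
  memLp_of_ball (measurable_ballSymbol R) (abs_ballSymbol_le R) (fun _ h => ballSymbol_of_lt h) p

/-- Sharp truncation to the frequencies `|ξ| ≤ R`. -/
def lowpass (R : ℝ) : L2 →ₗ[ℂ] L2 := mulOp _ (memLp_ballSymbol R ∞)

theorem coeFn_lowpass (R : ℝ) (F : L2) :
    lowpass R F =ᵐ[volume] fun ξ => (ballSymbol R ξ : ℂ) * F ξ := coeFn_mulOp _ _ F

theorem coeFn_sub_lowpass (R : ℝ) (F : L2) :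
    (F - lowpass R F : L2) =ᵐ[volume] fun ξ => ((1 - ballSymbol R ξ : ℝ) : ℂ) * F ξ := by
  filter_upwards [Lp.coeFn_sub F (lowpass R F), coeFn_lowpass R F] with ξ h1 h2
  rw [h1, Pi.sub_apply, h2]
  push_cast
  ring

theorem lowpass_mul (θ : PhaseFamily) (a : ℝ × R4) (R : ℝ) (F : L2) :
    lowpass R (θ.mul a F) = θ.mul a (lowpass R F) := by
  apply Lp.ext
  filter_upwards [coeFn_lowpass R (θ.mul a F), θ.coeFn_mul a (lowpass R F), θ.coeFn_mul a F,
    coeFn_lowpass R F] with ξ h1 h2 h3 h4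
  rw [h1, h2, h3, h4]
  ring

theorem tendsto_lowpass (F : L2) : Tendsto (fun n : ℕ => lowpass n F) atTop (𝓝 F) := by
  have h1 : Tendsto (fun n : ℕ => ∫ ξ, ‖(F - lowpass n F : L2) ξ‖ ^ 2) atTop
      (𝓝 (∫ _ : R4, (0 : ℝ))) := by
    refine tendsto_integral_of_dominated_convergence (fun ξ => ‖F ξ‖ ^ 2)
      (fun n => (integrable_norm_sq _).aestronglyMeasurable) (integrable_norm_sq F) ?_ ?_
    · intro n
      filter_upwards [coeFn_sub_lowpass n F] with ξ h
      rw [h, norm_mul, Complex.norm_real, Real.norm_eq_abs, abs_of_nonneg (by positivity), mul_pow]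
      refine mul_le_of_le_one_left (by positivity) ?_
      rcases le_or_gt ‖ξ‖ n with h | h
      · simp [ballSymbol_of_le h]
      · simp [ballSymbol_of_lt h]
    · filter_upwards [ae_all_iff.2 fun n : ℕ => coeFn_sub_lowpass n F] with ξ h
      refine tendsto_const_nhds.congr' ?_
      filter_upwards [eventually_ge_atTop ⌈‖ξ‖⌉₊] with n hn
      rw [h, ballSymbol_of_le ((Nat.le_ceil _).trans (by exact_mod_cast hn))]
      simp
  simp only [← norm_sq_eq_integral, integral_zero] at h1
  have h2 := h1.sqrt
  simp only [Real.sqrt_sq (norm_nonneg _), Real.sqrt_zero] at h2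
  rw [tendsto_iff_norm_sub_tendsto_zero]
  exact h2.congr fun n => norm_sub_rev _ _

/-- The symbol `1_{|ξ| ≤ R} (1 + (2π|ξ|)²)^{-1/2}`. -/
def lowSymbol (R : ℝ) (ξ : R4) : ℝ := ballSymbol R ξ * (japanese ξ)⁻¹

theorem memLp_lowSymbol (R : ℝ) (p : ℝ≥0∞) :
    MemLp (fun ξ => (lowSymbol R ξ : ℂ)) p volume := by
  refine memLp_of_ball (m := lowSymbol R) (C := 1) (R := R)
    ((measurable_ballSymbol R).mul continuous_japanese_inv.measurable)
    (fun ξ => ?_) (fun ξ h => by rw [lowSymbol, ballSymbol_of_lt h, zero_mul]) p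
  rw [lowSymbol, abs_mul, abs_of_pos (inv_pos.2 (japanese_pos ξ))]
  exact mul_le_one₀ (abs_ballSymbol_le R ξ) (inv_pos.2 (japanese_pos ξ)).le
    (inv_le_one_of_one_le₀ (one_le_japanese ξ))

theorem bessel_lowpass (R : ℝ) (F : L2) :
    bessel (lowpass R F) = mulOp _ (memLp_lowSymbol R ∞) F := by
  symm
  refine mulOp_ext _ _ _ ?_
  filter_upwards [coeFn_bessel (lowpass R F), coeFn_lowpass R F] with ξ h1 h2
  rw [h1, h2, lowSymbol]
  push_cast
  ring

/-- The convolution kernel of the low-frequency part of `toH1`. -/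
def lowKernel (R : ℝ) : L2 := (memLp_lowSymbol R 2).toLp _

theorem toH1_lowpass_ae_eq (R : ℝ) (F : L2) :
    (toH1 (lowpass R F) : L2) =ᵐ[volume]
      fun x => inner ℂ (lowKernel R) (schrodingerPhase.mul (0, -x) F) := by
  rw [coe_toH1, bessel_lowpass]
  exact fourierInv_mulOp_ae_eq _ _ schrodingerPhase_isTranslation F

/-- In dimension four the radial integrand r³ / (1 + (2πr)²) is at most r, so the squared norm is at
most 4 v R². The summand 1 in the constant only secures positivity. -/
theorem exists_norm_lowKernel_le : ∃ c : ℝ, 0 < c ∧ ∀ R, 0 < R → ‖lowKernel R‖ ≤ c * R := by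
  set v := volume.real (Metric.ball (0 : R4) 1)
  refine ⟨2 * √v + 1, by positivity, fun R hR => ?_⟩
  have h1 : ‖lowKernel R‖ ^ 2 ≤ 4 * v * R ^ 2 := by
    set f : ℝ → ℝ := (Set.Iic R).indicator fun r => (1 + (2 * Real.pi * r) ^ 2)⁻¹
    have h2 : ‖lowKernel R‖ ^ 2 = ∫ ξ : R4, f ‖ξ‖ := by
      rw [norm_sq_eq_integral]
      refine integral_congr_ae ?_
      filter_upwards [(memLp_lowSymbol R 2).coeFn_toLp] with ξ h
      rw [lowKernel, h, Complex.norm_real, Real.norm_eq_abs, sq_abs, lowSymbol]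
      rcases le_or_gt ‖ξ‖ R with h | h
      · rw [ballSymbol_of_le h, one_mul, inv_pow, japanese_sq]
        have h0 : f ‖ξ‖ = (1 + (2 * Real.pi * ‖ξ‖) ^ 2)⁻¹ :=
          Set.indicator_of_mem (s := Set.Iic R) (show ‖ξ‖ ∈ Set.Iic R from h) _
        rw [h0]
      · rw [ballSymbol_of_lt h, zero_mul]
        have h0 : f ‖ξ‖ = 0 := Set.indicator_of_notMem (by simpa using h) _
        rw [h0]
        norm_num
    rw [h2, integral_fun_norm_addHaar volume f, finrank_R4]
    have h3 : ∫ y in Set.Ioi (0 : ℝ), y ^ (4 - 1) • f y =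
        ∫ y in Set.Ioc 0 R, y ^ 3 * (1 + (2 * Real.pi * y) ^ 2)⁻¹ := by
      rw [← Set.Ioi_inter_Iic, ← integral_indicator measurableSet_Ioi, ← integral_indicator
        (measurableSet_Ioi.inter measurableSet_Iic)]
      congr 1
      ext y
      by_cases h0 : y ∈ Set.Ioi (0 : ℝ) <;> by_cases h1 : y ∈ Set.Iic R <;>
        simp_all [f, Set.indicator]
    have h4 : ‖∫ y in Set.Ioc 0 R, y ^ 3 * (1 + (2 * Real.pi * y) ^ 2)⁻¹‖ ≤
        R * volume.real (Set.Ioc 0 R) := by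
      refine norm_setIntegral_le_of_norm_le_const (by simp) fun y hy => ?_
      have hy0 : 0 < y := hy.1
      rw [Real.norm_eq_abs, abs_of_pos (by positivity), ← div_eq_mul_inv, div_le_iff₀ (by positivity)]
      have : y ^ 3 ≤ y * (1 + (2 * Real.pi * y) ^ 2) := by
        have : y ^ 2 ≤ (2 * Real.pi * y) ^ 2 := by
          gcongr
          nlinarith [Real.pi_gt_three]
        nlinarith
      exact this.trans (by gcongr; exact hy.2)
    rw [Real.volume_real_Ioc_of_le hR.le, sub_zero] at h4
    rw [h3]
    have h5 := (le_abs_self _).trans h4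
    simp only [nsmul_eq_mul, smul_eq_mul]
    have hv : 0 ≤ v := measureReal_nonneg
    push_cast
    nlinarith
  have h6 : ‖lowKernel R‖ ≤ √(4 * v * R ^ 2) := Real.le_sqrt_of_sq_le h1
  rw [show 4 * v * R ^ 2 = v * (2 * R) ^ 2 by ring, Real.sqrt_mul measureReal_nonneg,
    Real.sqrt_sq (by positivity)] at h6
  nlinarith

/-! ### The critical Sobolev embedding -/

theorem lintegral_enorm_sq (F : L2) : ∫⁻ ξ, ‖F ξ‖ₑ ^ 2 = ‖F‖ₑ ^ 2 := by
  have h1 : ∫⁻ ξ, ‖F ξ‖ₑ ^ 2 = ENNReal.ofReal (∫ ξ, ‖F ξ‖ ^ 2) := by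
    rw [ofReal_integral_eq_lintegral_ofReal (integrable_norm_sq F)
      (Eventually.of_forall fun _ => by positivity)]
    refine lintegral_congr fun ξ => ?_
    rw [ENNReal.ofReal_pow (norm_nonneg _), ofReal_norm]
  rw [h1, ← norm_sq_eq_integral, ENNReal.ofReal_pow (norm_nonneg _), ofReal_norm]

/-- The cutoff R is tuned to the height t so that low frequencies contribute at most t / 2;
Chebyshev and Plancherel treat the rest. The condition R < ‖ξ‖ is phrased as an upper bound on t,
ready for integration in t first. -/
theorem measure_lt_toH1_le {c : ℝ} (hc : 0 < c) (hcK : ∀ R, 0 < R → ‖lowKernel R‖ ≤ c * R)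
    (F : L2) (hF : 0 < ‖F‖) {t : ℝ} (ht : 0 < t) :
    volume {x | t < ‖(toH1 F : L2) x‖} ≤ (∫⁻ ξ, (Set.Iio (2 * c * ‖F‖ * ‖ξ‖)).indicator
      (fun _ => ‖(japanese ξ)⁻¹ * ‖F ξ‖‖ₑ ^ 2) t) / ENNReal.ofReal (t / 2) ^ 2 := by
  set R := t / (2 * c * ‖F‖) with hR
  have hR0 : 0 < R := by positivity
  set h : L2 := (toH1 (F - lowpass R F) : L2) with hh
  have hsplit : ∀ᵐ x, ‖(toH1 F : L2) x‖ ≤ t / 2 + ‖h x‖ := by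
    have e : (toH1 F : L2) = (toH1 (lowpass R F) : L2) + h := by
      rw [hh, map_sub, AddSubgroupClass.coe_sub, add_sub_cancel]
    rw [e]
    filter_upwards [Lp.coeFn_add (toH1 (lowpass R F) : L2) h, toH1_lowpass_ae_eq R F] with x h1 h2
    rw [h1, Pi.add_apply]
    refine (norm_add_le _ _).trans (add_le_add ?_ le_rfl)
    rw [h2]
    refine (norm_inner_le_norm _ _).trans ?_
    rw [(schrodingerPhase.mul _).norm_map]
    calc ‖lowKernel R‖ * ‖F‖ ≤ c * R * ‖F‖ := by gcongr; exact hcK R hR0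
      _ = t / 2 := by rw [hR]; field_simp
  have h1 : volume {x | t < ‖(toH1 F : L2) x‖} ≤
      volume {x | ENNReal.ofReal (t / 2) ^ 2 ≤ ‖h x‖ₑ ^ 2} := by
    refine measure_mono_ae ?_
    filter_upwards [hsplit] with x hx hxt
    have h3 : t < ‖(toH1 F : L2) x‖ := hxt
    change ENNReal.ofReal (t / 2) ^ 2 ≤ ‖h x‖ₑ ^ 2
    gcongr
    rw [← ofReal_norm]
    exact ENNReal.ofReal_le_ofReal (by linarith)
  refine h1.trans ?_
  have hne : ENNReal.ofReal (t / 2) ^ 2 ≠ 0 := by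
    simpa using ht
  refine (meas_ge_le_lintegral_div ((Lp.stronglyMeasurable h).measurable.enorm.pow_const
    2).aemeasurable hne (by simp)).trans ?_
  refine ENNReal.div_le_div_right ?_ _
  rw [lintegral_enorm_sq]
  have h4 : ‖h‖ₑ = ‖bessel (F - lowpass R F)‖ₑ := by
    rw [← ofReal_norm, ← ofReal_norm, ← Lp.norm_fourier_eq, hh, fourier_toH1]
  rw [h4, ← lintegral_enorm_sq]
  refine lintegral_mono_ae ?_
  filter_upwards [coeFn_bessel (F - lowpass R F), coeFn_sub_lowpass R F] with ξ h5 h6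
  rw [h5, h6]
  rcases le_or_gt ‖ξ‖ R with h | h
  · rw [ballSymbol_of_le h]
    simp
  · rw [ballSymbol_of_lt h, Set.indicator_of_mem]
    · simp [← ofReal_norm]
    · rw [hR, div_lt_iff₀ (by positivity)] at h
      simp only [Set.mem_Iio]
      linarith

/-- The Sobolev embedding `H¹(ℝ⁴) ⊆ L⁴(ℝ⁴)`. -/
theorem exists_sobolev : ∃ C : ℝ, 0 < C ∧ ∀ F : L2,
    eLpNorm (toH1 F : L2) 4 volume ≤ ENNReal.ofReal (C * ‖F‖) := by
  obtain ⟨c, hc, hcK⟩ := exists_norm_lowKernel_le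
  -- The estimate below gives ∫ |u|⁴ ≤ 64 c² ‖F‖⁴, and this constant has fourth power at least 64
  -- c².
  refine ⟨4 * (c + 1), by positivity, fun F => ?_⟩
  rcases (norm_nonneg F).eq_or_lt with hF | hF
  · have : F = 0 := norm_eq_zero.1 hF.symm
    rw [this, map_zero]
    have h0 : eLpNorm ((0 : H1) : L2) 4 volume = 0 := by
      rw [ZeroMemClass.coe_zero, eLpNorm_congr_ae (Lp.coeFn_zero ℂ 2 volume)]
      exact eLpNorm_zero
    rw [h0]
    exact zero_le
  set u : L2 := (toH1 F : L2) with hu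
  set b := 2 * c * ‖F‖ with hb
  have hb0 : 0 < b := by positivity
  have hum := (Lp.stronglyMeasurable u).measurable
  have hFm := (Lp.stronglyMeasurable F).measurable
  have hjm := continuous_japanese_inv.measurable
  set w : R4 → ℝ≥0∞ := fun ξ => ‖(japanese ξ)⁻¹ * ‖F ξ‖‖ₑ ^ 2 with hw
  have hwm : Measurable w := (hjm.mul hFm.norm).enorm.pow_const 2
  -- Layer cake: Chebyshev's (t / 2)⁻² turns t³ into 4 t, the integral over t < b ‖ξ‖ is at most 4
  -- b² ‖ξ‖², and the squared weight in w absorbs ‖ξ‖².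
  have h1 : ∫⁻ x, ‖u x‖ₑ ^ 4 ≤ ENNReal.ofReal (16 * b ^ 2 * ‖F‖ ^ 2) := by
    have e1 : ∫⁻ x, ‖u x‖ₑ ^ 4 = ∫⁻ x, ENNReal.ofReal (‖u x‖ ^ (4 : ℝ)) := by
      refine lintegral_congr fun x => ?_
      rw [← ofReal_norm, ← ENNReal.ofReal_pow (norm_nonneg _)]
      norm_cast
    rw [e1, lintegral_rpow_eq_lintegral_meas_lt_mul volume
      (Eventually.of_forall fun x => norm_nonneg _) hum.norm.aemeasurable (by norm_num)]
    have e2 : ∫⁻ t in Set.Ioi (0 : ℝ), volume {x | t < ‖u x‖} * ENNReal.ofReal (t ^ ((4 : ℝ) - 1)) ≤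
        ∫⁻ t in Set.Ioi (0 : ℝ), ∫⁻ ξ, (Set.Iio (b * ‖ξ‖)).indicator (fun _ => w ξ) t *
          ENNReal.ofReal (4 * t) := by
      refine setLIntegral_mono' measurableSet_Ioi fun t ht => ?_
      have ht0 : 0 < t := ht
      rw [lintegral_mul_const' _ _ ENNReal.ofReal_ne_top]
      refine (mul_le_mul_left (measure_lt_toH1_le hc hcK F hF ht0) _).trans_eq ?_
      rw [div_eq_mul_inv, mul_assoc]
      congr 1
      rw [← ENNReal.ofReal_pow (by positivity), ← ENNReal.ofReal_inv_of_pos (by positivity),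
        ← ENNReal.ofReal_mul (by positivity)]
      congr 1
      rw [show (4 : ℝ) - 1 = (3 : ℕ) by norm_num, Real.rpow_natCast]
      field_simp
      norm_num
    have e3 : ∫⁻ t in Set.Ioi (0 : ℝ), ∫⁻ ξ, (Set.Iio (b * ‖ξ‖)).indicator (fun _ => w ξ) t *
          ENNReal.ofReal (4 * t) ≤ ∫⁻ ξ, ENNReal.ofReal (4 * b ^ 2) * ‖F ξ‖ₑ ^ 2 := by
      rw [lintegral_lintegral_swap]
      · refine lintegral_mono fun ξ => ?_
        have e4 : ∫⁻ t in Set.Ioi (0 : ℝ), (Set.Iio (b * ‖ξ‖)).indicator (fun _ => w ξ) t *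
            ENNReal.ofReal (4 * t) ≤ ∫⁻ t in Set.Ioo 0 (b * ‖ξ‖),
              w ξ * ENNReal.ofReal (4 * (b * ‖ξ‖)) := by
          rw [← lintegral_indicator measurableSet_Ioi, ← lintegral_indicator measurableSet_Ioo]
          refine lintegral_mono fun t => ?_
          by_cases h0 : 0 < t
          · by_cases h1 : t < b * ‖ξ‖
            · rw [Set.indicator_of_mem (show t ∈ Set.Ioi (0 : ℝ) from h0),
                Set.indicator_of_mem (show t ∈ Set.Iio (b * ‖ξ‖) from h1),
                Set.indicator_of_mem (show t ∈ Set.Ioo 0 (b * ‖ξ‖) from ⟨h0, h1⟩)]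
              gcongr
            · rw [Set.indicator_of_mem (show t ∈ Set.Ioi (0 : ℝ) from h0),
                Set.indicator_of_notMem (show t ∉ Set.Iio (b * ‖ξ‖) from h1), zero_mul]
              exact zero_le
          · rw [Set.indicator_of_notMem (show t ∉ Set.Ioi (0 : ℝ) from h0)]
            exact zero_le
        refine e4.trans ?_
        rw [setLIntegral_const, Real.volume_Ioo, sub_zero, mul_assoc,
          ← ENNReal.ofReal_mul (by positivity), hw]
        simp only
        rw [← ofReal_norm, ← ofReal_norm, ← ENNReal.ofReal_pow (norm_nonneg _),
          ← ENNReal.ofReal_pow (norm_nonneg _), ← ENNReal.ofReal_mul (by positivity),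
          ← ENNReal.ofReal_mul (by positivity)]
        refine ENNReal.ofReal_le_ofReal ?_
        rw [norm_mul, norm_norm, norm_inv, Real.norm_eq_abs, abs_of_pos (japanese_pos ξ)]
        have h5 : (japanese ξ)⁻¹ * ‖ξ‖ ≤ 1 := by
          rw [inv_mul_le_iff₀ (japanese_pos ξ), mul_one]
          nlinarith [le_japanese ξ, norm_nonneg ξ, Real.pi_gt_three]
        have h6 : ((japanese ξ)⁻¹ * ‖ξ‖) ^ 2 ≤ 1 :=
          pow_le_one₀ (mul_nonneg (inv_pos.2 (japanese_pos ξ)).le (norm_nonneg _)) h5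
        calc ((japanese ξ)⁻¹ * ‖F ξ‖) ^ 2 * (4 * (b * ‖ξ‖) * (b * ‖ξ‖))
            = 4 * b ^ 2 * ‖F ξ‖ ^ 2 * ((japanese ξ)⁻¹ * ‖ξ‖) ^ 2 := by ring
          _ ≤ 4 * b ^ 2 * ‖F ξ‖ ^ 2 * 1 := by gcongr
          _ = _ := by ring
      · refine Measurable.aemeasurable ?_
        have e5 : (Function.uncurry fun (t : ℝ) (ξ : R4) =>
            (Set.Iio (b * ‖ξ‖)).indicator (fun _ => w ξ) t * ENNReal.ofReal (4 * t)) =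
            fun z : ℝ × R4 => {z : ℝ × R4 | z.1 < b * ‖z.2‖}.indicator (fun z => w z.2) z *
              ENNReal.ofReal (4 * z.1) := by
          ext ⟨t, ξ⟩
          simp only [Function.uncurry, Set.indicator, Set.mem_Iio, Set.mem_ofPred_eq]
        rw [e5]
        refine Measurable.mul ?_ (by fun_prop)
        exact (hwm.comp measurable_snd).indicator
          (measurableSet_lt (by fun_prop) (by fun_prop))
    refine (mul_le_mul_right (e2.trans e3) _).trans_eq ?_
    rw [lintegral_const_mul' _ _ ENNReal.ofReal_ne_top, lintegral_enorm_sq, ← ofReal_norm,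
      ← ENNReal.ofReal_pow (norm_nonneg _), ← ENNReal.ofReal_mul (by positivity),
      ← ENNReal.ofReal_mul (by norm_num)]
    congr 1
    ring
  rw [eLpNorm_eq_lintegral_rpow_enorm_toReal (by norm_num) (by norm_num)]
  have h2 : ENNReal.ofReal (16 * b ^ 2 * ‖F‖ ^ 2) ≤ ENNReal.ofReal (4 * (c + 1) * ‖F‖) ^ (4 : ℝ) := by
    rw [ENNReal.ofReal_rpow_of_nonneg (by positivity) (by norm_num)]
    refine ENNReal.ofReal_le_ofReal ?_
    rw [show (4 : ℝ) = (4 : ℕ) by norm_num, Real.rpow_natCast, hb]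
    push_cast
    have h7 : 64 * c ^ 2 ≤ (4 * (c + 1)) ^ 4 := by
      nlinarith [pow_pos hc 2, pow_pos hc 3, pow_pos hc 4]
    calc 16 * (2 * c * ‖F‖) ^ 2 * ‖F‖ ^ 2 = 64 * c ^ 2 * ‖F‖ ^ 4 := by ring
      _ ≤ (4 * (c + 1)) ^ 4 * ‖F‖ ^ 4 := by gcongr
      _ = (4 * (c + 1) * ‖F‖) ^ 4 := by ring
  rw [ENNReal.toReal_ofNat, one_div, ENNReal.rpow_inv_le_iff (by norm_num)]
  refine le_trans (le_of_eq ?_) (h1.trans h2)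
  norm_cast

/-! ### Trilinear estimates -/

/-- The trilinear integral `∫ |f g h|`. -/
def absTri (f g h : L2) : ℝ≥0∞ := ∫⁻ x, ‖f x‖ₑ * (‖g x‖ₑ * ‖h x‖ₑ)

/-- The `L²` norm of a product. -/
def prodNorm (f g : L2) : ℝ≥0∞ := eLpNorm (fun x => f x * g x) 2 volume

theorem absTri_swap (f g h : L2) : absTri f g h = absTri g f h :=
  lintegral_congr fun x => by ring

theorem prodNorm_comm (f g : L2) : prodNorm f g = prodNorm g f := by
  simp only [prodNorm, mul_comm]

theorem aestronglyMeasurable_coe (f : L2) : AEStronglyMeasurable (f : R4 → ℂ) volume :=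
  Lp.aestronglyMeasurable f

theorem measurable_enorm_coe (f : L2) : Measurable fun x => ‖f x‖ₑ :=
  (Lp.stronglyMeasurable f).measurable.enorm

theorem eLpNorm_two_coe (f : L2) : eLpNorm (f : R4 → ℂ) 2 volume = ‖f‖ₑ := (Lp.enorm_def f).symm

theorem prodNorm_sq (f g : L2) : prodNorm f g ^ 2 = ∫⁻ x, ‖f x * g x‖ₑ ^ 2 := by
  rw [prodNorm, eLpNorm_eq_lintegral_rpow_enorm_toReal (by norm_num) (by norm_num),
    ← ENNReal.rpow_natCast, ← ENNReal.rpow_mul]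
  norm_num

theorem absTri_le (f g h : L2) : absTri f g h ≤ ‖f‖ₑ * prodNorm g h := by
  have h1 := eLpNorm_smul_le_mul_eLpNorm (p := 2) (q := 2) (r := 1) (μ := (volume : Measure R4))
    (f := fun x => g x * h x) (φ := (f : R4 → ℂ))
    ((aestronglyMeasurable_coe g).mul (aestronglyMeasurable_coe h)) (aestronglyMeasurable_coe f)
  rw [eLpNorm_two_coe, eLpNorm_one_eq_lintegral_enorm] at h1
  refine le_trans (le_of_eq (lintegral_congr fun x => ?_)) h1
  simp [enorm_mul]

instance : ENNReal.HolderTriple 4 4 2 where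
  inv_add_inv_eq_inv := by
    rw [← two_mul, show (4 : ℝ≥0∞) = 2 * 2 by norm_num, ENNReal.mul_inv (by simp) (by simp),
      ← mul_assoc, ENNReal.mul_inv_cancel (by simp) (by simp), one_mul]

theorem prodNorm_le_four (f g : L2) :
    prodNorm f g ≤ eLpNorm (f : R4 → ℂ) 4 volume * eLpNorm (g : R4 → ℂ) 4 volume :=
  eLpNorm_smul_le_mul_eLpNorm (p := 4) (q := 4) (r := 2) (μ := (volume : Measure R4))
    (f := (g : R4 → ℂ)) (φ := (f : R4 → ℂ)) (aestronglyMeasurable_coe g)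
    (aestronglyMeasurable_coe f)

theorem prodNorm_le_top (f g : L2) :
    prodNorm f g ≤ eLpNorm (f : R4 → ℂ) ∞ volume * ‖g‖ₑ := by
  rw [← eLpNorm_two_coe]
  exact eLpNorm_smul_le_mul_eLpNorm (p := ∞) (q := 2) (r := 2) (μ := (volume : Measure R4))
    (f := (g : R4 → ℂ)) (φ := (f : R4 → ℂ)) (aestronglyMeasurable_coe g)
    (aestronglyMeasurable_coe f)

theorem prodNorm_add_le (f g h : L2) : prodNorm f (g + h) ≤ prodNorm f g + prodNorm f h := by
  have h1 : prodNorm f (g + h) =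
      eLpNorm ((fun x => f x * g x) + fun x => f x * h x) 2 volume := by
    refine eLpNorm_congr_ae ?_
    filter_upwards [Lp.coeFn_add g h] with x hx
    rw [hx, Pi.add_apply, Pi.add_apply, mul_add]
  rw [h1]
  exact eLpNorm_add_le ((aestronglyMeasurable_coe f).mul (aestronglyMeasurable_coe g))
    ((aestronglyMeasurable_coe f).mul (aestronglyMeasurable_coe h)) (by norm_num)

theorem absTri_add_le (f f' g h : L2) : absTri (f + f') g h ≤ absTri f g h + absTri f' g h := by
  have h1 : Measurable fun x => ‖f x‖ₑ * (‖g x‖ₑ * ‖h x‖ₑ) := (measurable_enorm_coe f).mul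
    ((measurable_enorm_coe g).mul (measurable_enorm_coe h))
  rw [absTri, absTri, absTri, ← lintegral_add_left h1]
  refine lintegral_mono_ae ?_
  filter_upwards [Lp.coeFn_add f f'] with x hx
  rw [hx, Pi.add_apply, ← add_mul]
  gcongr
  exact enorm_add_le _ _

theorem measurePreserving_sub (y : R4) :
    MeasurePreserving (fun x : R4 => x - y) volume volume :=
  measurePreserving_sub_right volume y

theorem coeFn_translate (y : R4) (f : L2) :
    translate y f =ᵐ[volume] fun x => f (x - y) :=
  Lp.coeFn_compMeasurePreserving f (measurePreserving_sub y)

theorem prodNorm_translate (y : R4) (f g : L2) :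
    prodNorm (translate y f) (translate y g) = prodNorm f g := by
  have h := eLpNorm_comp_measurePreserving (p := 2) (g := fun x => f x * g x)
    ((aestronglyMeasurable_coe f).mul (aestronglyMeasurable_coe g)) (measurePreserving_sub y)
  rw [prodNorm, prodNorm, ← h]
  refine eLpNorm_congr_ae ?_
  filter_upwards [coeFn_translate y f, coeFn_translate y g] with x h1 h2
  rw [h1, h2]
  rfl

/-- At time zero both groups act by the same translations, so one change of variables undoes the
motion in both components. -/
theorem fourierInv_translation {θ : PhaseFamily} (hθ : θ.IsTranslation) (y : R4) (F : L2) :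
    (𝓕⁻ (θ.mul (0, y) F) : L2) = translate y (𝓕⁻ F) := by
  have h1 : (𝓕⁻ (𝓕 (translate y (𝓕⁻ F)) : L2) : L2) = translate y (𝓕⁻ F) :=
    FourierTransform.fourierInv_fourier_eq _
  rw [← h1, fourier_translate]
  congr 1
  have h2 : (𝓕 (𝓕⁻ F : L2) : L2) = F := FourierTransform.fourier_fourierInv_eq _
  rw [h2]
  symm
  refine mulOp_ext (memLp_phase (θ := fun ξ => -(2 * Real.pi * inner ℝ y ξ)) (by fun_prop)) F _ ?_
  filter_upwards [θ.coeFn_mul (0, y) F] with ξ h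
  rw [h, hθ]

/-- The trilinear form `∫ Re (g) Re (conj f h)`. -/
def tri (g f h : L2) : ℝ := ∫ x, (g x).re * (starRingEnd ℂ (f x) * h x).re

theorem tri_translate (y : R4) (g f h : L2) :
    tri (translate y g) (translate y f) (translate y h) = tri g f h := by
  have h0 := (measurePreserving_sub y).integral_comp (Homeomorph.subRight y).measurableEmbedding
    fun x => (g x).re * (starRingEnd ℂ (f x) * h x).re
  rw [tri, tri, ← h0]
  refine integral_congr_ae ?_
  filter_upwards [coeFn_translate y f, coeFn_translate y g, coeFn_translate y h] with x h1 h2 h3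
  rw [h1, h2, h3]

theorem enorm_re_mul_re_le (a b c : ℂ) :
    ‖a.re * (starRingEnd ℂ b * c).re‖ₑ ≤ ‖a‖ₑ * (‖b‖ₑ * ‖c‖ₑ) := by
  have h : ‖a.re * (starRingEnd ℂ b * c).re‖ ≤ ‖a * (starRingEnd ℂ b * c)‖ := by
    rw [norm_mul, norm_mul]
    exact mul_le_mul (Complex.abs_re_le_norm _) (Complex.abs_re_le_norm _) (norm_nonneg _)
      (norm_nonneg _)
  rw [← ofReal_norm, ← enorm_mul, ← enorm_mul, ← ofReal_norm]
  refine ENNReal.ofReal_le_ofReal (h.trans_eq ?_)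
  rw [norm_mul, norm_mul, norm_mul, norm_mul, RCLike.norm_conj]

theorem enorm_tri_le (g f h : L2) : ‖tri g f h‖ₑ ≤ absTri g f h :=
  (enorm_integral_le_lintegral_enorm _).trans (lintegral_mono fun _ => enorm_re_mul_re_le _ _ _)

theorem integrable_tri (g : L2) {f h : L2} (hfh : prodNorm f h ≠ ⊤) :
    Integrable fun x => (g x).re * (starRingEnd ℂ (f x) * h x).re := by
  have hm : ∀ f : L2, Measurable (f : R4 → ℂ) := fun f => (Lp.stronglyMeasurable f).measurable
  refine ⟨Measurable.aestronglyMeasurable ?_, ?_⟩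
  · have h1 := hm f
    have h2 := hm g
    have h3 := hm h
    have h4 : Measurable fun x => starRingEnd ℂ (f x) := 
      Complex.continuous_conj.measurable.comp h1
    exact (Complex.measurable_re.comp h2).mul (Complex.measurable_re.comp (h4.mul h3))
  · rw [hasFiniteIntegral_iff_enorm]
    exact lt_of_le_of_lt (b := absTri g f h) (lintegral_mono fun x => enorm_re_mul_re_le _ _ _)
      ((absTri_le g f h).trans_lt (ENNReal.mul_lt_top (by simp) hfh.lt_top))

theorem tri_add_add (g e f w : L2) (hff : prodNorm f f ≠ ⊤) (hfw : prodNorm f w ≠ ⊤)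
    (hww : prodNorm w w ≠ ⊤) :
    tri (g + e) (f + w) (f + w) = tri g f f + 2 * tri g f w + tri g w w +
      (tri e f f + 2 * tri e f w + tri e w w) := by
  have h1 : tri (g + e) (f + w) (f + w) =
      ∫ x, ((g x).re * (starRingEnd ℂ (f x) * f x).re +
        2 * ((g x).re * (starRingEnd ℂ (f x) * w x).re) +
        (g x).re * (starRingEnd ℂ (w x) * w x).re) +
        ((e x).re * (starRingEnd ℂ (f x) * f x).re +
        2 * ((e x).re * (starRingEnd ℂ (f x) * w x).re) +
        (e x).re * (starRingEnd ℂ (w x) * w x).re) := by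
    refine integral_congr_ae ?_
    filter_upwards [Lp.coeFn_add g e, Lp.coeFn_add f w] with x h1 h2
    rw [h1, h2]
    simp only [Pi.add_apply, Complex.add_re, Complex.add_im, Complex.mul_re, Complex.conj_re,
      Complex.conj_im]
    ring
  have i1 : ∀ g : L2, Integrable fun x => (g x).re * (starRingEnd ℂ (f x) * f x).re :=
    fun g => integrable_tri g hff
  have i2 : ∀ g : L2, Integrable fun x => 2 * ((g x).re * (starRingEnd ℂ (f x) * w x).re) :=
    fun g => (integrable_tri g hfw).const_mul 2
  have i3 : ∀ g : L2, Integrable fun x => (g x).re * (starRingEnd ℂ (w x) * w x).re :=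
    fun g => integrable_tri g hww
  have i12 : ∀ g : L2, Integrable fun x => (g x).re * (starRingEnd ℂ (f x) * f x).re +
      2 * ((g x).re * (starRingEnd ℂ (f x) * w x).re) := fun g => (i1 g).add (i2 g)
  have i123 : ∀ g : L2, Integrable fun x => (g x).re * (starRingEnd ℂ (f x) * f x).re +
      2 * ((g x).re * (starRingEnd ℂ (f x) * w x).re) +
      (g x).re * (starRingEnd ℂ (w x) * w x).re := fun g => (i12 g).add (i3 g)
  have h2 : ∀ g : L2, ∫ x, ((g x).re * (starRingEnd ℂ (f x) * f x).re +
        2 * ((g x).re * (starRingEnd ℂ (f x) * w x).re) +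
        (g x).re * (starRingEnd ℂ (w x) * w x).re) = tri g f f + 2 * tri g f w + tri g w w := by
    intro g
    rw [integral_add (i12 g) (i3 g), integral_add (i1 g) (i2 g), integral_const_mul]
    rfl
  rw [h1, integral_add (i123 g) (i123 e), h2, h2]

/-! ### Local compactness and dispersion -/

/-- If `f_n ≤ f'_{k,n} + δ_k` where `f'_{k,n} → 0` for all `k` and `δ_k → 0`, then `f_n → 0`. -/
theorem tendsto_zero_of_approx {x : ℕ → ℝ≥0∞} {x' : ℕ → ℕ → ℝ≥0∞} {δ : ℕ → ℝ≥0∞}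
    (h : ∀ k n, x n ≤ x' k n + δ k) (hx : ∀ k, Tendsto (x' k) atTop (𝓝 0))
    (hδ : Tendsto δ atTop (𝓝 0)) : Tendsto x atTop (𝓝 0) := by
  rw [ENNReal.tendsto_nhds_zero] at hδ ⊢
  intro ε hε
  obtain ⟨k, hk⟩ := (hδ (ε / 2) (ENNReal.half_pos hε.ne')).exists
  filter_upwards [ENNReal.tendsto_nhds_zero.1 (hx k) (ε / 2) (ENNReal.half_pos hε.ne')] with n hn
  calc x n ≤ x' k n + δ k := h k n
    _ ≤ ε / 2 + ε / 2 := add_le_add hn hk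
    _ = ε := ENNReal.add_halves ε

theorem enorm_toH1_le (F : L2) : ‖(toH1 F : L2)‖ₑ ≤ ENNReal.ofReal ‖F‖ := by
  rw [← ofReal_norm, ← Lp.norm_fourier_eq, fourier_toH1]
  exact ENNReal.ofReal_le_ofReal (norm_bessel_le F)

theorem norm_bessel_sub_lowpass_le (F : L2) {R : ℝ} (hR : 0 < R) :
    ‖bessel (F - lowpass R F)‖ ≤ R⁻¹ * ‖F‖ := by
  refine Lp.norm_le_mul_norm_of_ae_le_mul ?_
  filter_upwards [coeFn_bessel (F - lowpass R F), coeFn_sub_lowpass R F] with ξ h1 h2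
  rw [h1, h2, ← mul_assoc, norm_mul, ← Complex.ofReal_mul, Complex.norm_real, Real.norm_eq_abs]
  gcongr
  rcases le_or_gt ‖ξ‖ R with h | h
  · rw [ballSymbol_of_le h]
    simp [hR.le]
  · rw [ballSymbol_of_lt h, sub_zero, mul_one, abs_of_pos (inv_pos.2 (japanese_pos ξ))]
    refine inv_anti₀ hR ?_
    nlinarith [le_japanese ξ, norm_nonneg ξ, Real.pi_gt_three]

/-- Rellich's theorem: multiplication by a bounded square integrable function maps weakly null
sequences in `H¹` to null sequences in `L²`. -/
theorem tendsto_prodNorm_toH1 (f : L2) (hf : eLpNorm (f : R4 → ℂ) ∞ volume ≠ ⊤) {W : ℕ → L2} {M : ℝ}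
    (hM : ∀ n, ‖W n‖ ≤ M) (hW : TendstoWeakly atTop W 0) :
    Tendsto (fun n => prodNorm f (toH1 (W n))) atTop (𝓝 0) := by
  have hM0 : 0 ≤ M := (norm_nonneg _).trans (hM 0)
  -- At a fixed cutoff the values are pairings of W n with translates of one kernel, so weak
  -- convergence gives pointwise convergence, and the squares are dominated by a multiple of |f|².
  have hlow : ∀ R : ℝ, Tendsto (fun n => prodNorm f (toH1 (lowpass R (W n)))) atTop (𝓝 0) := by
    intro R
    have h1 : Tendsto (fun n => ∫⁻ x, ‖f x * (toH1 (lowpass R (W n)) : L2) x‖ₑ ^ 2) atTop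
        (𝓝 (∫⁻ _ : R4, 0)) := by
      refine tendsto_lintegral_of_dominated_convergence'
        (fun x => ‖f x‖ₑ ^ 2 * ENNReal.ofReal (‖lowKernel R‖ * M) ^ 2) (fun n => ?_) (fun n => ?_)
        ?_ ?_
      · exact (((aestronglyMeasurable_coe f).mul (aestronglyMeasurable_coe _)).enorm).pow_const 2
      · filter_upwards [toH1_lowpass_ae_eq R (W n)] with x hx
        rw [enorm_mul, mul_pow, hx]
        gcongr
        rw [← ofReal_norm]
        refine ENNReal.ofReal_le_ofReal ((norm_inner_le_norm _ _).trans ?_)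
        rw [(schrodingerPhase.mul _).norm_map]
        gcongr
        exact hM n
      · have h2 : ENNReal.ofReal (‖lowKernel R‖ * M) ^ 2 ≠ ⊤ :=
          ENNReal.pow_ne_top ENNReal.ofReal_ne_top
        rw [lintegral_mul_const' _ _ h2, lintegral_enorm_sq]
        exact ENNReal.mul_ne_top (by simp) h2
      · filter_upwards [ae_all_iff.2 fun n => toH1_lowpass_ae_eq R (W n)] with x hx
        simp only [hx]
        have h2 : ∀ n, inner ℂ (lowKernel R) (schrodingerPhase.mul (0, -x) (W n)) =
          inner ℂ (schrodingerPhase.mul (-(0, -x)) (lowKernel R)) (W n) := fun n =>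
            schrodingerPhase.rep.inner_apply_right (0, -x) _ _
        simp only [h2]
        have h3 := hW (schrodingerPhase.mul (-(0, -x)) (lowKernel R))
        rw [inner_zero_right] at h3
        have h4 : Tendsto (fun n => f x * inner ℂ (schrodingerPhase.mul (-(0, -x)) (lowKernel R))
            (W n)) atTop (𝓝 0) := by simpa using h3.const_mul (f x)
        have h5 := ENNReal.Tendsto.pow (n := 2) h4.enorm
        simpa using h5
    simp only [← prodNorm_sq, lintegral_zero] at h1
    have h2 := h1.ennrpow_const (1 / 2)
    rw [ENNReal.zero_rpow_of_pos (by norm_num)] at h2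
    refine h2.congr fun n => ?_
    rw [← ENNReal.rpow_natCast, ← ENNReal.rpow_mul]
    norm_num
  -- High frequencies gain a factor R⁻¹ in L², uniformly in n; the cutoff k + 1 is positive also for
  -- k = 0.
  refine tendsto_zero_of_approx (x' := fun k n => prodNorm f (toH1 (lowpass ((k : ℝ) + 1) (W n))))
    (δ := fun k => eLpNorm (f : R4 → ℂ) ∞ volume * ENNReal.ofReal (((k : ℝ) + 1)⁻¹ * M))
    (fun k n => ?_) (fun k => hlow _) ?_
  · have h1 : (toH1 (W n) : L2) = (toH1 (lowpass ((k : ℝ) + 1) (W n)) : L2) +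
        (toH1 (W n - lowpass ((k : ℝ) + 1) (W n)) : L2) := by
      rw [map_sub, AddSubgroupClass.coe_sub, add_sub_cancel]
    rw [h1]
    refine (prodNorm_add_le _ _ _).trans (add_le_add le_rfl ((prodNorm_le_top _ _).trans ?_))
    gcongr
    rw [← ofReal_norm, ← Lp.norm_fourier_eq, fourier_toH1]
    refine ENNReal.ofReal_le_ofReal ((norm_bessel_sub_lowpass_le _ (by positivity)).trans ?_)
    gcongr
    exact hM n
  · have h1 : Tendsto (fun k : ℕ => ((k : ℝ) + 1)⁻¹ * M) atTop (𝓝 0) := by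
      simpa [one_div] using (tendsto_one_div_add_atTop_nhds_zero_nat (𝕜 := ℝ)).mul_const M
    have h2 := ENNReal.Tendsto.const_mul (ENNReal.tendsto_ofReal h1)
      (a := eLpNorm (f : R4 → ℂ) ∞ volume) (Or.inr hf)
    simpa using h2

section Symbol

variable {m : R4 → ℝ} (hm : MemLp (fun ξ => (m ξ : ℂ)) ∞ volume)
  (hm2 : MemLp (fun ξ => (m ξ : ℂ)) 2 volume) {θ : PhaseFamily}

/-- Qualitative dispersive estimate. -/
theorem tendsto_eLpNorm_top (hm2 : MemLp (fun ξ => (m ξ : ℂ)) 2 volume) (hθ : θ.IsTranslation)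
    (P : L2) {a : ℕ → ℝ × R4}
    (ha : Tendsto (fun n => |(a n).1|) atTop atTop) :
    Tendsto (fun n => eLpNorm (𝓕⁻ (mulOp _ hm (θ.mul (a n) P)) : L2) ∞ volume) atTop (𝓝 0) := by
  rw [ENNReal.tendsto_nhds_zero]
  intro ε hε
  wlog hε' : ε ≠ ⊤ generalizing ε
  · refine (this 1 one_pos ENNReal.one_ne_top).mono fun n hn => hn.trans ?_
    rw [not_not.1 hε']
    exact le_top
  have hε0 : 0 < ε.toReal := ENNReal.toReal_pos hε.ne' hε'
  -- The value at x is the matrix coefficient at (0, -x) + a n, and this parameter has norm at least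
  -- |(a n).1| whatever x is. Mixing is therefore uniform in x.
  have h1 := (θ.rep.mixing (hm2.toLp _) P).norm.eventually
    (gt_mem_nhds (show ‖(0 : ℂ)‖ < ε.toReal by rwa [norm_zero]))
  rw [← Metric.cobounded_eq_cocompact, ← comap_norm_atTop] at h1
  obtain ⟨R, hR⟩ := eventually_atTop.1 (eventually_comap.1 h1)
  filter_upwards [ha.eventually_ge_atTop R] with n hn
  refine essSup_le_of_ae_le _ ?_
  filter_upwards [fourierInv_mulOp_ae_eq hm hm2 hθ (θ.mul (a n) P)] with x hx
  rw [hx, ← θ.mul_add, ← ofReal_norm, ← ENNReal.ofReal_toReal hε']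
  refine ENNReal.ofReal_le_ofReal (hR _ ?_ _ rfl).le
  refine hn.trans ?_
  have : ‖((0, -x) + a n : ℝ × R4).1‖ ≤ ‖((0, -x) + a n : ℝ × R4)‖ := norm_fst_le _
  simpa using this

theorem eLpNorm_top_ne_top (hm2 : MemLp (fun ξ => (m ξ : ℂ)) 2 volume) (P : L2) :
    eLpNorm (𝓕⁻ (mulOp _ hm P) : L2) ∞ volume ≠ ⊤ := by
  refine ne_top_of_le_ne_top (b := ENNReal.ofReal (‖hm2.toLp _‖ * ‖P‖)) ENNReal.ofReal_ne_top ?_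
  refine essSup_le_of_ae_le _ ?_
  filter_upwards [fourierInv_mulOp_ae_eq hm hm2 schrodingerPhase_isTranslation P] with x hx
  rw [hx, ← ofReal_norm]
  refine ENNReal.ofReal_le_ofReal ((norm_inner_le_norm _ _).trans ?_)
  rw [(schrodingerPhase.mul _).norm_map]

theorem mulOp_mul_comm (a : ℝ × R4) (P : L2) :
    mulOp _ hm (θ.mul a P) = θ.mul a (mulOp _ hm P) := by
  apply Lp.ext
  filter_upwards [coeFn_mulOp _ hm (θ.mul a P), θ.coeFn_mul a (mulOp _ hm P), θ.coeFn_mul a P,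
    coeFn_mulOp _ hm P] with ξ h1 h2 h3 h4
  rw [h1, h2, h3, h4]
  ring

/-- Products of a moving profile with a remainder from which the profile has been removed. -/
theorem tendsto_prodNorm_profile (hm2 : MemLp (fun ξ => (m ξ : ℂ)) 2 volume)
    (hθ : θ.IsTranslation) (P : L2) {a : ℕ → ℝ × R4}
    (ha : (∀ n, (a n).1 = 0) ∨ Tendsto (fun n => |(a n).1|) atTop atTop) {W : ℕ → L2} {M : ℝ}
    (hM : ∀ n, ‖W n‖ ≤ M)
    (hW : TendstoWeakly atTop (fun n => schrodingerPhase.mul (-(a n)) (W n)) 0) :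
    Tendsto (fun n => prodNorm (𝓕⁻ (mulOp _ hm (θ.mul (a n) P))) (toH1 (W n))) atTop (𝓝 0) := by
  -- Zero times: translating back freezes the profile, and Rellich's theorem applies. Infinite
  -- times: the profile disperses in L^∞ while the remainder stays bounded in L².
  rcases ha with ha | ha
  · have h1 := tendsto_prodNorm_toH1 _ (eLpNorm_top_ne_top hm hm2 P)
      (fun n => ((schrodingerPhase.mul (-(a n))).norm_map (W n)).trans_le (hM n)) hW
    refine h1.congr fun n => ?_
    have h2 : a n = (0, (a n).2) := Prod.ext (ha n) rfl
    rw [mulOp_mul_comm, h2, fourierInv_translation hθ, ← prodNorm_translate (a n).2]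
    congr 1
    rw [coe_toH1, coe_toH1, ← fourierInv_translation schrodingerPhase_isTranslation, bessel_mul,
      ← h2]
    congr 1
    exact schrodingerPhase.rep.self_apply_neg _ _
  · have h1 := ENNReal.Tendsto.mul_const (tendsto_eLpNorm_top hm hm2 hθ P ha)
      (b := ENNReal.ofReal M) (Or.inr ENNReal.ofReal_ne_top)
    rw [zero_mul] at h1
    refine tendsto_of_tendsto_of_tendsto_of_le_of_le tendsto_const_nhds h1 (fun _ => zero_le)
      fun n => (prodNorm_le_top _ _).trans ?_
    gcongr
    exact (enorm_toH1_le _).trans (ENNReal.ofReal_le_ofReal (hM n))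

end Symbol

/-! ### Decoupling of the energy -/

theorem prodNorm_toH1_le {C : ℝ} (hC : ∀ F : L2, eLpNorm (toH1 F : L2) 4 volume ≤
    ENNReal.ofReal (C * ‖F‖)) (F G : L2) :
    prodNorm (toH1 F) (toH1 G) ≤ ENNReal.ofReal (C * ‖F‖) * ENNReal.ofReal (C * ‖G‖) :=
  (prodNorm_le_four _ _).trans (mul_le_mul' (hC F) (hC G))

theorem prodNorm_toH1_ne_top (F G : L2) : prodNorm (toH1 F) (toH1 G) ≠ ⊤ := by
  obtain ⟨C, -, hC⟩ := exists_sobolev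
  exact ne_top_of_le_ne_top (ENNReal.mul_ne_top ENNReal.ofReal_ne_top ENNReal.ofReal_ne_top)
    (prodNorm_toH1_le hC F G)

theorem tendsto_norm_sub_lowpass (F : L2) :
    Tendsto (fun k : ℕ => ‖F - lowpass k F‖) atTop (𝓝 0) := by
  simpa using ((tendsto_lowpass F).const_sub F).norm

theorem norm_fourierInv (F : L2) : ‖(𝓕⁻ F : L2)‖ = ‖F‖ := by
  rw [← Lp.norm_fourier_eq, FourierTransform.fourier_fourierInv_eq]

theorem PhaseFamily.mul_neg_cancel (θ : PhaseFamily) (a : ℝ × R4) (F : L2) :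
    θ.mul a (θ.mul (-a) F) = F := θ.rep.self_apply_neg a F

theorem enorm_fourierInv (F : L2) : ‖(𝓕⁻ F : L2)‖ₑ = ENNReal.ofReal ‖F‖ := by
  rw [← ofReal_norm, norm_fourierInv]

theorem toH1_eq_add_lowpass (R : ℝ) (θ : PhaseFamily) (a : ℝ × R4) (P : L2) :
    (toH1 (θ.mul a P) : L2) = (𝓕⁻ (mulOp _ (memLp_lowSymbol R ∞) (θ.mul a P)) : L2) +
      (toH1 (θ.mul a (P - lowpass R P)) : L2) := by
  rw [← bessel_lowpass, ← coe_toH1, ← Submodule.coe_add, ← map_add, lowpass_mul, ← map_add,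
    add_sub_cancel]

theorem fourierInv_eq_add_lowpass (R : ℝ) (θ : PhaseFamily) (a : ℝ × R4) (Q : L2) :
    (𝓕⁻ (θ.mul a Q) : L2) = (𝓕⁻ (mulOp _ (memLp_ballSymbol R ∞) (θ.mul a Q)) : L2) +
      (𝓕⁻ (θ.mul a (Q - lowpass R Q)) : L2) := by
  rw [← FourierTransform.fourierInv_add]
  congr 1
  change _ = lowpass R (θ.mul a Q) + _
  rw [lowpass_mul, ← map_add, add_sub_cancel]

section Decoupling

variable (P Q : L2) {a : ℕ → ℝ × R4}
  (ha : (∀ n, (a n).1 = 0) ∨ Tendsto (fun n => |(a n).1|) atTop atTop) {W E : ℕ → L2} {M : ℝ}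

-- For the frequency-truncated profile this is `tendsto_prodNorm_profile`; the tail is small in L⁴
-- by the Sobolev embedding, uniformly in n.
include ha in
theorem tendsto_prodNorm_toH1_profile (hM : ∀ n, ‖W n‖ ≤ M)
    (hW : TendstoWeakly atTop (fun n => schrodingerPhase.mul (-(a n)) (W n)) 0) :
    Tendsto (fun n => prodNorm (toH1 (schrodingerPhase.mul (a n) P)) (toH1 (W n))) atTop (𝓝 0) := by
  obtain ⟨C, hC0, hC⟩ := exists_sobolev
  refine tendsto_zero_of_approx
    (x' := fun k n => prodNorm (𝓕⁻ (mulOp _ (memLp_lowSymbol k ∞) (schrodingerPhase.mul (a n) P)))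
      (toH1 (W n)))
    (δ := fun k => ENNReal.ofReal (C * ‖P - lowpass k P‖) * ENNReal.ofReal (C * M))
    (fun k n => ?_) (fun k => tendsto_prodNorm_profile _ (memLp_lowSymbol k 2)
      schrodingerPhase_isTranslation P ha hM hW) ?_
  · rw [toH1_eq_add_lowpass k, prodNorm_comm]
    refine (prodNorm_add_le _ _ _).trans (add_le_add (prodNorm_comm _ _).le ?_)
    rw [prodNorm_comm]
    refine (prodNorm_toH1_le hC _ _).trans ?_
    rw [(schrodingerPhase.mul (a n)).norm_map]
    gcongr
    exact hM n
  · have h := ENNReal.Tendsto.mul_const (ENNReal.tendsto_ofReal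
      ((tendsto_norm_sub_lowpass P).const_mul C)) (b := ENNReal.ofReal (C * M))
      (Or.inr ENNReal.ofReal_ne_top)
    simpa using h

-- One remainder is multiplied with the truncated wave profile, the other is bounded in L². The tail
-- of the wave profile is small in L² and meets two L⁴ factors.
include ha in
theorem tendsto_absTri_wave (hM : ∀ n, ‖W n‖ ≤ M)
    (hW : TendstoWeakly atTop (fun n => schrodingerPhase.mul (-(a n)) (W n)) 0) :
    Tendsto (fun n => absTri (𝓕⁻ (wavePhase.mul (a n) Q)) (toH1 (W n)) (toH1 (W n))) atTop
      (𝓝 0) := by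
  obtain ⟨C, hC0, hC⟩ := exists_sobolev
  refine tendsto_zero_of_approx
    (x' := fun k n => ENNReal.ofReal M *
      prodNorm (𝓕⁻ (mulOp _ (memLp_ballSymbol k ∞) (wavePhase.mul (a n) Q))) (toH1 (W n)))
    (δ := fun k => ENNReal.ofReal ‖Q - lowpass k Q‖ *
      (ENNReal.ofReal (C * M) * ENNReal.ofReal (C * M)))
    (fun k n => ?_) (fun k => ?_) ?_
  · rw [fourierInv_eq_add_lowpass k]
    refine (absTri_add_le _ _ _ _).trans (add_le_add ?_ ?_)
    · rw [absTri_swap]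
      refine (absTri_le _ _ _).trans ?_
      gcongr
      exact (enorm_toH1_le _).trans (ENNReal.ofReal_le_ofReal (hM n))
    · refine (absTri_le _ _ _).trans ?_
      rw [enorm_fourierInv, (wavePhase.mul (a n)).norm_map]
      gcongr
      refine (prodNorm_toH1_le hC _ _).trans ?_
      gcongr <;> exact hM n
  · have h := ENNReal.Tendsto.const_mul (tendsto_prodNorm_profile
      (memLp_ballSymbol k ∞) (memLp_ballSymbol k 2)
      wavePhase_isTranslation Q ha hM hW) (a := ENNReal.ofReal M) (Or.inr ENNReal.ofReal_ne_top)
    simpa using h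
  · have h := ENNReal.Tendsto.mul_const (ENNReal.tendsto_ofReal (tendsto_norm_sub_lowpass Q))
      (b := ENNReal.ofReal (C * M) * ENNReal.ofReal (C * M))
      (Or.inr (ENNReal.mul_ne_top ENNReal.ofReal_ne_top ENNReal.ofReal_ne_top))
    simpa using h

/-- Since |f|² lies in L², the form is the real part of a bounded functional of e, hence weakly
continuous. -/
theorem exists_tri_eq_re_inner (f : L2) (hf : prodNorm f f ≠ ⊤) :
    ∃ ψ : L2, ∀ e : L2, tri e f f = (inner ℂ ψ e).re := by
  have hm : MemLp (fun x => starRingEnd ℂ (f x) * f x) 2 volume := by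
    refine ⟨(Complex.continuous_conj.comp_aestronglyMeasurable (aestronglyMeasurable_coe f)).mul
      (aestronglyMeasurable_coe f), ?_⟩
    refine lt_of_le_of_lt (le_of_eq (eLpNorm_congr_norm_ae ?_)) hf.lt_top
    exact Eventually.of_forall fun x => by simp
  refine ⟨hm.toLp _, fun e => ?_⟩
  rw [inner_eq_integral, tri, ← RCLike.re_to_complex, ← integral_re (integrable_inner _ _)]
  refine integral_congr_ae ?_
  filter_upwards [hm.coeFn_toLp] with x hx
  rw [hx]
  simp
  ring

-- Zero times: translate back and pair the weakly null E with the fixed square of the profile.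
-- Infinite times: the square of the moving profile tends to zero in L².
include ha in
theorem tendsto_tri_profile (hM : ∀ n, ‖E n‖ ≤ M)
    (hE : TendstoWeakly atTop (fun n => wavePhase.mul (-(a n)) (E n)) 0) :
    Tendsto (fun n => tri (𝓕⁻ (E n)) (toH1 (schrodingerPhase.mul (a n) P))
      (toH1 (schrodingerPhase.mul (a n) P))) atTop (𝓝 0) := by
  rcases ha with ha | ha
  · obtain ⟨ψ, hψ⟩ := exists_tri_eq_re_inner (toH1 P) (prodNorm_toH1_ne_top P P)
    have h1 := (Complex.continuous_re.tendsto _).comp (hE (𝓕 ψ))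
    rw [inner_zero_right, Complex.zero_re] at h1
    refine h1.congr fun n => ?_
    have h2 : a n = (0, (a n).2) := Prod.ext (ha n) rfl
    have h3 : (𝓕⁻ (E n) : L2) = translate (a n).2 (𝓕⁻ (wavePhase.mul (-(a n)) (E n))) := by
      rw [← fourierInv_translation wavePhase_isTranslation, ← h2, wavePhase.mul_neg_cancel]
    have h4 : (toH1 (schrodingerPhase.mul (a n) P) : L2) = translate (a n).2 (toH1 P) := by
      rw [coe_toH1, coe_toH1, ← fourierInv_translation schrodingerPhase_isTranslation, bessel_mul,
        ← h2]
    rw [h3, h4, tri_translate, hψ, Function.comp_apply, ← Lp.inner_fourier_eq ψ,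
      FourierTransform.fourier_fourierInv_eq]
  · obtain ⟨C, hC0, hC⟩ := exists_sobolev
    have h0 : Tendsto (fun n => ENNReal.ofReal M * prodNorm (toH1 (schrodingerPhase.mul (a n) P))
        (toH1 (schrodingerPhase.mul (a n) P))) atTop (𝓝 (ENNReal.ofReal M * 0)) := by
      refine ENNReal.Tendsto.const_mul ?_ (Or.inr ENNReal.ofReal_ne_top)
      refine tendsto_zero_of_approx
        (x' := fun k n => eLpNorm (𝓕⁻ (mulOp _ (memLp_lowSymbol k ∞)
          (schrodingerPhase.mul (a n) P)) : L2) ∞ volume * ENNReal.ofReal ‖P‖)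
        (δ := fun k => ENNReal.ofReal (C * ‖P - lowpass k P‖) * ENNReal.ofReal (C * ‖P‖))
        (fun k n => ?_) (fun k => ?_) ?_
      · nth_rw 2 [toH1_eq_add_lowpass k]
        refine (prodNorm_add_le _ _ _).trans (add_le_add ?_ ?_)
        · rw [prodNorm_comm]
          refine (prodNorm_le_top _ _).trans ?_
          gcongr
          exact (enorm_toH1_le _).trans_eq (by rw [(schrodingerPhase.mul (a n)).norm_map])
        · rw [prodNorm_comm]
          refine (prodNorm_toH1_le hC _ _).trans_eq ?_
          rw [(schrodingerPhase.mul (a n)).norm_map, (schrodingerPhase.mul (a n)).norm_map]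
      · have h := ENNReal.Tendsto.mul_const (tendsto_eLpNorm_top
          (memLp_lowSymbol k ∞) (memLp_lowSymbol k 2)
          schrodingerPhase_isTranslation P ha) (b := ENNReal.ofReal ‖P‖)
          (Or.inr ENNReal.ofReal_ne_top)
        simpa using h
      · have h := ENNReal.Tendsto.mul_const (ENNReal.tendsto_ofReal
          ((tendsto_norm_sub_lowpass P).const_mul C)) (b := ENNReal.ofReal (C * ‖P‖))
          (Or.inr ENNReal.ofReal_ne_top)
        simpa using h
    rw [mul_zero] at h0
    rw [tendsto_zero_iff_enorm_tendsto_zero]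
    refine tendsto_of_tendsto_of_tendsto_of_le_of_le tendsto_const_nhds h0 (fun _ => zero_le)
      fun n => (enorm_tri_le _ _ _).trans ((absTri_le _ _ _).trans ?_)
    gcongr
    rw [enorm_fourierInv]
    exact ENNReal.ofReal_le_ofReal (hM n)

/-- A product estimate turned into convergence of the trilinear form. -/
theorem tendsto_tri_of_prodNorm {g f h : ℕ → L2} {M : ℝ} (hg : ∀ n, ‖g n‖ ≤ M)
    (hfh : Tendsto (fun n => prodNorm (f n) (h n)) atTop (𝓝 0)) :
    Tendsto (fun n => tri (g n) (f n) (h n)) atTop (𝓝 0) := by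
  have h0 := ENNReal.Tendsto.const_mul hfh (a := ENNReal.ofReal M) (Or.inr ENNReal.ofReal_ne_top)
  rw [mul_zero] at h0
  rw [tendsto_zero_iff_enorm_tendsto_zero]
  refine tendsto_of_tendsto_of_tendsto_of_le_of_le tendsto_const_nhds h0 (fun _ => zero_le)
    fun n => (enorm_tri_le _ _ _).trans ((absTri_le _ _ _).trans ?_)
  gcongr
  rw [← ofReal_norm]
  exact ENNReal.ofReal_le_ofReal (hg n)

include ha in
/-- Decoupling of the cubic part of the energy. -/
theorem tendsto_tri_decoupling (hM : ∀ n, ‖W n‖ ≤ M) (hM' : ∀ n, ‖E n‖ ≤ M)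
    (hW : TendstoWeakly atTop (fun n => schrodingerPhase.mul (-(a n)) (W n)) 0)
    (hE : TendstoWeakly atTop (fun n => wavePhase.mul (-(a n)) (E n)) 0) :
    Tendsto (fun n => tri (𝓕⁻ (wavePhase.mul (a n) Q + E n))
        (toH1 (schrodingerPhase.mul (a n) P + W n)) (toH1 (schrodingerPhase.mul (a n) P + W n))
      - tri (𝓕⁻ (wavePhase.mul (a n) Q)) (toH1 (schrodingerPhase.mul (a n) P))
        (toH1 (schrodingerPhase.mul (a n) P))
      - tri (𝓕⁻ (E n)) (toH1 (W n)) (toH1 (W n))) atTop (𝓝 0) := by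
  have hp := tendsto_prodNorm_toH1_profile P ha hM hW
  have h1 := tendsto_tri_of_prodNorm (g := fun n => 𝓕⁻ (wavePhase.mul (a n) Q)) (M := ‖Q‖)
    (fun n => by rw [norm_fourierInv, (wavePhase.mul (a n)).norm_map]) hp
  have h2 := tendsto_tri_of_prodNorm (g := fun n => 𝓕⁻ (E n)) (M := M)
    (fun n => by rw [norm_fourierInv]; exact hM' n) hp
  have h3 : Tendsto (fun n => tri (𝓕⁻ (wavePhase.mul (a n) Q)) (toH1 (W n)) (toH1 (W n))) atTop
      (𝓝 0) := by
    rw [tendsto_zero_iff_enorm_tendsto_zero]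
    exact tendsto_of_tendsto_of_tendsto_of_le_of_le tendsto_const_nhds
      (tendsto_absTri_wave Q ha hM hW) (fun _ => zero_le) fun n => enorm_tri_le _ _ _
  have h4 := tendsto_tri_profile P ha hM' hE
  -- The cross terms of the expansion; those with one profile and one remainder in the two
  -- Schrödinger slots occur twice.
  have h5 := (((h1.const_mul 2).add h3).add h4).add (h2.const_mul 2)
  simp only [mul_zero, add_zero] at h5
  refine h5.congr fun n => ?_
  rw [FourierTransform.fourierInv_add, map_add, Submodule.coe_add,
    tri_add_add _ _ _ _ (prodNorm_toH1_ne_top _ _) (prodNorm_toH1_ne_top _ _)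
      (prodNorm_toH1_ne_top _ _)]
  ring

end Decoupling

/-- The squared gradient norm is the H¹ part minus the L² part, ‖F‖² - ‖bessel F‖², so that the
energy involves no derivatives any more. -/
theorem energy_toH1 (F G : L2) : energy (toH1 F) (𝓕⁻ G) =
    (1 / 2) * (‖F‖ ^ 2 - ‖bessel F‖ ^ 2) + (1 / 4) * ‖G‖ ^ 2 +
      (1 / 2) * tri (𝓕⁻ G) (toH1 F) (toH1 F) := by
  have i1 : Integrable fun x => (1 / 2) * ∑ j : Fin 4, ‖(weakPartial (toH1 F) j) x‖ ^ 2 :=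
    (integrable_finsetSum _ fun j _ => integrable_norm_sq _).const_mul _
  have i2 : Integrable fun x => (1 / 4) * ‖(𝓕⁻ G : L2) x‖ ^ 2 :=
    (integrable_norm_sq _).const_mul _
  have e3 : ∀ x, (1 / 2) * ((𝓕⁻ G : L2) x).re * ‖(toH1 F : L2) x‖ ^ 2 = (1 / 2) *
      (((𝓕⁻ G : L2) x).re * (starRingEnd ℂ ((toH1 F : L2) x) * (toH1 F : L2) x).re) := by
    intro x
    rw [mul_assoc, mul_comm (starRingEnd ℂ _), Complex.mul_conj, Complex.ofReal_re,
      Complex.normSq_eq_norm_sq]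
  have i3 : Integrable fun x => (1 / 2) * (((𝓕⁻ G : L2) x).re *
      (starRingEnd ℂ ((toH1 F : L2) x) * (toH1 F : L2) x).re) :=
    (integrable_tri _ (prodNorm_toH1_ne_top _ _)).const_mul _
  have i12 : Integrable fun x => (1 / 2) * ∑ j : Fin 4, ‖(weakPartial (toH1 F) j) x‖ ^ 2 +
      (1 / 4) * ‖(𝓕⁻ G : L2) x‖ ^ 2 := i1.add i2
  have h := h1NormSq_toH1 F
  rw [h1NormSq, norm_sq_coe_toH1] at h
  simp only [energy, e3]
  rw [integral_add i12 i3, integral_add i1 i2, integral_const_mul, integral_const_mul,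
    integral_const_mul, ← norm_sq_eq_integral, norm_fourierInv,
    integral_finsetSum _ fun j _ => integrable_norm_sq _, tri, ← h]
  simp only [← norm_sq_eq_integral]
  ring

theorem inner_bessel_left (F G : L2) : inner ℂ (bessel F) G = inner ℂ F (bessel G) := by
  rw [inner_eq_integral, inner_eq_integral]
  refine integral_congr_ae ?_
  filter_upwards [coeFn_bessel F, coeFn_bessel G] with ξ h1 h2
  rw [h1, h2]
  simp only [map_mul, Complex.conj_ofReal]
  ring

/-- As `bessel` is self-adjoint and commutes with the phases, it preserves weak nullity in the
moving frame. Hence the L² norm decouples along with the H¹ norm, and their difference is the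
gradient term. -/
theorem tendsto_energy_decoupling (P Q : L2) {a : ℕ → ℝ × R4}
    (ha : (∀ n, (a n).1 = 0) ∨ Tendsto (fun n => |(a n).1|) atTop atTop) {W E : ℕ → L2} {M : ℝ}
    (hM : ∀ n, ‖W n‖ ≤ M) (hM' : ∀ n, ‖E n‖ ≤ M)
    (hW : TendstoWeakly atTop (fun n => schrodingerPhase.mul (-(a n)) (W n)) 0)
    (hE : TendstoWeakly atTop (fun n => wavePhase.mul (-(a n)) (E n)) 0) :
    Tendsto (fun n => energy (toH1 (schrodingerPhase.mul (a n) P + W n))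
        (𝓕⁻ (wavePhase.mul (a n) Q + E n))
      - energy (toH1 (schrodingerPhase.mul (a n) P)) (𝓕⁻ (wavePhase.mul (a n) Q))
      - energy (toH1 (W n)) (𝓕⁻ (E n))) atTop (𝓝 0) := by
  have h1 := schrodingerPhase.rep.norm_sq_decoupling (p := P) hW
  have hWb : TendstoWeakly atTop
      (fun n => schrodingerPhase.rep (-(a n)) (bessel (W n))) 0 := fun h => by
    have h0 := hW (bessel h)
    rw [inner_zero_right] at h0 ⊢
    refine h0.congr fun n => ?_
    change _ = inner ℂ h (schrodingerPhase.mul (-(a n)) (bessel (W n)))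
    rw [← bessel_mul, inner_bessel_left]
  have h2 := schrodingerPhase.rep.norm_sq_decoupling (p := bessel P) hWb
  have h3 := wavePhase.rep.norm_sq_decoupling (p := Q) hE
  have h4 := tendsto_tri_decoupling P Q ha hM hM' hW hE
  have h5 := (((h1.sub h2).const_mul (1 / 2)).add (h3.const_mul (1 / 4))).add (h4.const_mul (1 / 2))
  simp only [mul_zero, add_zero, sub_zero] at h5
  refine h5.congr fun n => ?_
  have e1 : ∀ b F, schrodingerPhase.rep b F = schrodingerPhase.mul b F := fun _ _ => rfl
  have e2 : ∀ b F, wavePhase.rep b F = wavePhase.mul b F := fun _ _ => rfl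
  rw [energy_toH1, energy_toH1, energy_toH1]
  simp only [map_add, bessel_mul, (schrodingerPhase.mul _).norm_map,
    (wavePhase.mul _).norm_map, e1, e2]
  ring

/-! ### Direct sums of representations -/

namespace MixingRep

variable {G H H' ι : Type*} [AddCommGroup G] [TopologicalSpace G]
  [NormedAddCommGroup H] [InnerProductSpace ℂ H] [NormedAddCommGroup H'] [InnerProductSpace ℂ H']

/-- The direct sum of two mixing representations. -/
def prod (U : MixingRep G H) (V : MixingRep G H') : MixingRep G (WithLp 2 (H × H')) where
  toFun a :=
    { toFun := fun p => WithLp.toLp 2 (U a p.fst, V a p.snd)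
      map_add' := fun p q => by simp only [WithLp.add_fst, WithLp.add_snd, _root_.map_add]; rfl
      map_smul' := fun c p => by
        simp only [WithLp.smul_fst, WithLp.smul_snd, _root_.map_smul, RingHom.id_apply]; rfl
      norm_map' := fun p => by
        rw [← sq_eq_sq₀ (norm_nonneg _) (norm_nonneg _), WithLp.prod_norm_sq_eq_of_L2,
          WithLp.prod_norm_sq_eq_of_L2]
        exact congrArg₂ (fun x y : ℝ => x ^ 2 + y ^ 2) ((U a).norm_map _) ((V a).norm_map _) }
  map_add a b p := congrArg (WithLp.toLp 2) (Prod.ext (U.map_add a b _) (V.map_add a b _))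
  map_zero p := congrArg (WithLp.toLp 2) (Prod.ext (U.map_zero _) (V.map_zero _))
  continuous_apply p := (WithLp.prod_continuous_toLp 2 H H').comp
    ((U.continuous_apply p.fst).prodMk (V.continuous_apply p.snd))
  mixing h k := by
    simpa using! (U.mixing h.fst k.fst).add (V.mixing h.snd k.snd)

end MixingRep

theorem TendstoWeakly.fst {H H' ι : Type*} [NormedAddCommGroup H] [InnerProductSpace ℂ H]
    [NormedAddCommGroup H'] [InnerProductSpace ℂ H'] {l : Filter ι} {u : ι → WithLp 2 (H × H')}
    {p : WithLp 2 (H × H')} (h : TendstoWeakly l u p) :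
    TendstoWeakly l (fun n => (u n).fst) p.fst := fun k => by
  simpa [WithLp.prod_inner_apply] using h (WithLp.toLp 2 (k, 0))

theorem TendstoWeakly.snd {H H' ι : Type*} [NormedAddCommGroup H] [InnerProductSpace ℂ H]
    [NormedAddCommGroup H'] [InnerProductSpace ℂ H'] {l : Filter ι} {u : ι → WithLp 2 (H × H')}
    {p : WithLp 2 (H × H')} (h : TendstoWeakly l u p) :
    TendstoWeakly l (fun n => (u n).snd) p.snd := fun k => by
  simpa [WithLp.prod_inner_apply] using h (WithLp.toLp 2 (0, k))

/-! ### Detection of the norm `Y` -/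

theorem lpSymbol_eq_zero (χ : Cutoff) (k : ℕ) {r : ℝ} (hr : 2 ^ (k + 1) < r) :
    lpSymbol χ k r = 0 := by
  have h0 : ∀ r, 2 < r → χ.toFun r = 0 := fun r hr => by
    by_contra h
    exact hr.not_ge (χ.tsupport_subset (subset_tsupport _ h)).2
  unfold lpSymbol
  split_ifs with hk
  · subst hk
    refine (tsum_congr fun i => h0 _ ?_).trans tsum_zero
    rw [zpow_neg, inv_inv, zpow_natCast]
    have h1 : (1 : ℝ) ≤ 2 ^ i := one_le_pow₀ one_le_two
    norm_num at hr
    nlinarith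
  · refine h0 _ ?_
    rw [← div_eq_inv_mul, lt_div_iff₀ (by positivity), ← pow_succ']
    exact hr

/-- A generous ball: the symbol already vanishes for 2π‖ξ‖ > 2 ^ (k + 1). -/
theorem abs_lpSymbol_le (χ : Cutoff) (k : ℕ) (ξ : R4) :
    |lpSymbol χ k (2 * Real.pi * ‖ξ‖)| ≤ ballSymbol (2 ^ (k + 1)) ξ := by
  rcases le_or_gt ‖ξ‖ (2 ^ (k + 1)) with h | h
  · rw [ballSymbol_of_le h, abs_of_nonneg (lpSymbol_nonneg χ k _)]
    exact lpSymbol_le_one χ k (by positivity)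
  · rw [ballSymbol_of_lt h, lpSymbol_eq_zero, abs_zero]
    nlinarith [Real.pi_gt_three, norm_nonneg ξ]

/-- A sequence of symbols of size at most one, localised to dyadic balls. -/
structure DyadicSymbol where
  /-- The symbols. -/
  toFun : ℕ → R4 → ℝ
  aestronglyMeasurable : ∀ k, AEStronglyMeasurable (fun ξ => (toFun k ξ : ℂ)) volume
  abs_le : ∀ k ξ, |toFun k ξ| ≤ ballSymbol (2 ^ (k + 1)) ξ

namespace DyadicSymbol

theorem memLp (s : DyadicSymbol) (k : ℕ) (p : ℝ≥0∞) :
    MemLp (fun ξ => (s.toFun k ξ : ℂ)) p volume := by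
  refine (memLp_ballSymbol (2 ^ (k + 1)) p).mono (s.aestronglyMeasurable k)
    (Eventually.of_forall fun ξ => ?_)
  rw [Complex.norm_real, Complex.norm_real]
  exact (s.abs_le k ξ).trans (le_abs_self _)

/-- The symbols of the Littlewood–Paley projections. -/
def littlewoodPaley (χ : Cutoff) : DyadicSymbol where
  toFun k ξ := lpSymbol χ k (2 * Real.pi * ‖ξ‖)
  aestronglyMeasurable k := (memLp_lpSymbol χ k).1
  abs_le := abs_lpSymbol_le χ

/-- The product of a dyadic symbol with the symbol of `(1 + |∇|²)^{-1/2}`. -/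
def smooth (s : DyadicSymbol) : DyadicSymbol where
  toFun k ξ := s.toFun k ξ * (japanese ξ)⁻¹
  aestronglyMeasurable k := by
    simpa using! (s.aestronglyMeasurable k).mul memLp_japanese_inv.1
  abs_le k ξ := by
    rw [abs_mul, abs_of_pos (inv_pos.2 (japanese_pos ξ))]
    exact (mul_le_of_le_one_right (abs_nonneg _)
      (inv_le_one_of_one_le₀ (one_le_japanese ξ))).trans (s.abs_le k ξ)

theorem mulOp_smooth (s : DyadicSymbol) (k : ℕ) (F : L2) :
    mulOp _ (s.smooth.memLp k ∞) F = mulOp _ (s.memLp k ∞) (bessel F) := by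
  refine mulOp_ext _ _ _ ?_
  filter_upwards [coeFn_mulOp _ (s.memLp k ∞) (bessel F), coeFn_bessel F] with ξ h1 h2
  rw [h1, h2, smooth]
  push_cast
  ring

/-- The weighted kernels whose translates compute `2 λ⁻⁴ P_λ`. -/
def kernel (s : DyadicSymbol) (k : ℕ) : L2 :=
  ((2 * ((2 ^ k)⁻¹) ^ 4 : ℝ) : ℂ) • (s.memLp k 2).toLp _

theorem norm_toLp_ballSymbol {R : ℝ} (hR : 0 ≤ R) : ‖(memLp_ballSymbol R 2).toLp _‖ ^ 2 =
    R ^ 4 * volume.real (Metric.ball (0 : R4) 1) := by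
  have h1 : ∫ ξ, ‖((memLp_ballSymbol R 2).toLp _ : L2) ξ‖ ^ 2 =
      ∫ ξ, (Metric.closedBall (0 : R4) R).indicator (1 : R4 → ℝ) ξ := by
    refine integral_congr_ae ?_
    filter_upwards [(memLp_ballSymbol R 2).coeFn_toLp] with ξ h
    rw [h, Complex.norm_real, ballSymbol]
    by_cases hξ : ξ ∈ Metric.closedBall (0 : R4) R
    · simp [Set.indicator_of_mem hξ]
    · simp [Set.indicator_of_notMem hξ]
  rw [norm_sq_eq_integral, h1, integral_indicator_one Metric.isClosed_closedBall.measurableSet,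
    Measure.real, Measure.addHaar_closedBall _ _ hR, finrank_R4, ENNReal.toReal_mul,
    ENNReal.toReal_ofReal (by positivity), Measure.real]

/-- With λ = 2 ^ k, a symbol bounded by one on a ball of radius 2λ has L² norm at most 4 λ² √v; the
weight 2 λ⁻⁴ leaves 8 √v λ⁻². This decay leaves only finitely many relevant frequencies in the
extraction. -/
theorem norm_kernel_le (s : DyadicSymbol) (k : ℕ) :
    ‖s.kernel k‖ ≤ 8 * √(volume.real (Metric.ball (0 : R4) 1)) * ((1 : ℝ) / 4) ^ k := by
  set v := volume.real (Metric.ball (0 : R4) 1)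
  have h1 : ‖((s.memLp k 2).toLp _ : L2)‖ ≤ ‖((memLp_ballSymbol (2 ^ (k + 1)) 2).toLp _ : L2)‖ := by
    refine Lp.norm_le_norm_of_ae_le ?_
    filter_upwards [(s.memLp k 2).coeFn_toLp, (memLp_ballSymbol (2 ^ (k + 1)) 2).coeFn_toLp]
      with ξ h1 h2
    rw [h1, h2, Complex.norm_real, Complex.norm_real]
    exact (s.abs_le k ξ).trans (le_abs_self _)
  have h2 : ‖((memLp_ballSymbol (2 ^ (k + 1)) 2).toLp _ : L2)‖ = (2 ^ (k + 1)) ^ 2 * √v := by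
    rw [← sq_eq_sq₀ (norm_nonneg _) (by positivity), norm_toLp_ballSymbol (by positivity), mul_pow,
      Real.sq_sqrt (by positivity)]
    ring
  rw [kernel, norm_smul, Complex.norm_real, Real.norm_of_nonneg (by positivity)]
  calc _ ≤ 2 * ((2 ^ k)⁻¹) ^ 4 * ((2 ^ (k + 1)) ^ 2 * √v) := by rw [← h2]; gcongr
    _ = _ := by
      have h4 : ((1 : ℝ) / 4) ^ k = ((2 ^ k)⁻¹) ^ 2 := by
        rw [one_div, inv_pow, inv_pow, show (4 : ℝ) = 2 ^ 2 by norm_num, ← pow_mul, ← pow_mul,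
          mul_comm]
      rw [h4, pow_succ (2 : ℝ) k]
      field_simp
      ring

theorem norm_inner_kernel (s : DyadicSymbol) (k : ℕ) (F : L2) :
    ‖inner ℂ (s.kernel k) F‖ = 2 * ((2 ^ k)⁻¹) ^ 4 * ‖inner ℂ ((s.memLp k 2).toLp _) F‖ := by
  rw [kernel, inner_smul_left, norm_mul, Complex.conj_ofReal, Complex.norm_real,
    Real.norm_of_nonneg (by positivity)]

end DyadicSymbol

/-- At (t, x) the function λ⁻⁴ P_λ u is one half of the matrix coefficient of `kernel` at -(t, x).
The factor 2 in the kernel is there so that the two components, each bounded by c / 2, add up to c.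
-/
theorem yNorm_le (χ : Cutoff) {θ : PhaseFamily} (hθ : θ.IsTranslation) (s : DyadicSymbol) (F : L2)
    {u : ℝ → L2} (hu : ∀ k t, lpProj χ k (u t) = 𝓕⁻ (mulOp _ (s.memLp k ∞) (θ.mul (-t, 0) F)))
    {c : ℝ} (hc : ∀ k a, ‖inner ℂ (s.kernel k) (θ.mul (-a) F)‖ ≤ c) :
    yNorm χ u ≤ ENNReal.ofReal (c / 2) := by
  refine iSup_le fun k => ?_
  have h1 : essSup (fun t => eLpNorm (lpProj χ k (u t)) ∞ volume) volume ≤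
      ENNReal.ofReal ((2 ^ k) ^ 4 * (c / 2)) := by
    refine essSup_le_of_ae_le _ (Eventually.of_forall fun t => ?_)
    refine essSup_le_of_ae_le _ ?_
    rw [hu]
    filter_upwards [fourierInv_mulOp_ae_eq (s.memLp k ∞) (s.memLp k 2) hθ (θ.mul (-t, 0) F)]
      with x hx
    rw [hx, ← θ.mul_add, ← ofReal_norm]
    refine ENNReal.ofReal_le_ofReal ?_
    have h2 := hc k (t, x)
    rw [s.norm_inner_kernel, show -((t, x) : ℝ × R4) = (0, -x) + (-t, 0) by simp] at h2
    rw [inv_pow, mul_assoc, ← le_div_iff₀' two_pos, inv_mul_le_iff₀ (by positivity)] at h2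
    linarith
  refine (mul_le_mul_right h1 _).trans (le_of_eq ?_)
  rw [ENNReal.ofReal_mul (by positivity), ← mul_assoc]
  have h3 : ENNReal.ofReal ((2 ^ k) ^ 4) = (2 ^ k) ^ 4 := by
    rw [ENNReal.ofReal_pow (by positivity), ENNReal.ofReal_pow (by positivity)]
    norm_num
  rw [h3, ← mul_pow, ENNReal.inv_mul_cancel (by positivity) (by finiteness), one_pow, one_mul]

theorem translate_zero (f : L2) : translate 0 f = f := by
  apply Lp.ext
  filter_upwards [coeFn_translate 0 f] with x h
  rw [h, sub_zero]

theorem lpProj_fourierInv (χ : Cutoff) (k : ℕ) (F : L2) :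
    lpProj χ k (𝓕⁻ F) = 𝓕⁻ (mulOp _ ((DyadicSymbol.littlewoodPaley χ).memLp k ∞) F) := by
  rw [lpProj, multiplier_eq, FourierTransform.fourier_fourierInv_eq]
  rfl

theorem lpProj_schrodinger (χ : Cutoff) (k : ℕ) (t : ℝ) (F : L2) :
    lpProj χ k (schrodinger t (toH1 F)) =
      𝓕⁻ (mulOp _ ((DyadicSymbol.littlewoodPaley χ).smooth.memLp k ∞)
        (schrodingerPhase.mul (-t, 0) F)) := by
  have h := schrodinger_translate (-t) 0 (toH1 F)
  rw [translate_zero, neg_neg, fourier_toH1, ← bessel_mul] at h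
  rw [h, lpProj_fourierInv, DyadicSymbol.mulOp_smooth]

theorem lpProj_halfWave (χ : Cutoff) (k : ℕ) (t : ℝ) (G : L2) :
    lpProj χ k (halfWave t (𝓕⁻ G)) =
      𝓕⁻ (mulOp _ ((DyadicSymbol.littlewoodPaley χ).memLp k ∞) (wavePhase.mul (-t, 0) G)) := by
  have h := halfWave_translate (-t) 0 (𝓕⁻ G)
  rw [translate_zero, neg_neg, FourierTransform.fourier_fourierInv_eq] at h
  rw [h, lpProj_fourierInv]

/-! ### The phase space -/

/-- The space `H¹ × L²`, seen on the Fourier side. -/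
abbrev PhaseSpace : Type := WithLp 2 (L2 × L2)

instance : TopologicalSpace.SeparableSpace PhaseSpace := by
  have : Fact ((2 : ℝ≥0∞) ≠ ⊤) := ⟨ENNReal.ofNat_ne_top⟩
  have : SecondCountableTopology L2 := Lp.SecondCountableTopology
  have : SecondCountableTopology PhaseSpace := WithLp.secondCountableTopology 2 L2 L2
  infer_instance

/-- The symmetry group acting on the Fourier side. -/
def symmetry : MixingRep (ℝ × R4) PhaseSpace := schrodingerPhase.rep.prod wavePhase.rep

/-- The passage from the Fourier side to `H¹ × L²`. -/
def toPair (p : PhaseSpace) : H1 × L2 := (toH1 p.fst, 𝓕⁻ p.snd)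

theorem toPair_add (p q : PhaseSpace) : toPair (p + q) = toPair p + toPair q :=
  Prod.ext (map_add toH1 p.fst q.fst) (FourierTransform.fourierInv_add p.snd q.snd)

theorem toPair_symmetry (a : ℝ × R4) (p : PhaseSpace) :
    toPair (symmetry a p) = groupElement a.1 a.2 (toPair p) :=
  (groupElement_toH1 a.1 a.2 p.fst p.snd).symm

theorem toPair_ne_zero {p : PhaseSpace} (hp : p ≠ 0) : toPair p ≠ 0 := by
  contrapose! hp
  have h1 : p.fst = 0 := toH1_injective ((congrArg Prod.fst hp).trans (map_zero toH1).symm)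
  have h2 : p.snd = 0 := by
    rw [← norm_eq_zero, ← norm_fourierInv]
    exact norm_eq_zero.2 (congrArg Prod.snd hp)
  have h3 : ‖p‖ ^ 2 = 0 := by simp [WithLp.prod_norm_sq_eq_of_L2, h1, h2]
  simpa using h3

theorem exists_toPair (p : H1 × L2) : ∃ q : PhaseSpace, toPair q = p := by
  obtain ⟨F, hF⟩ := toH1_surjective p.1
  exact ⟨WithLp.toLp 2 (F, 𝓕 p.2), Prod.ext hF (FourierTransform.fourierInv_fourier_eq _)⟩

theorem norm_sq_phaseSpace (p : PhaseSpace) :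
    ‖p‖ ^ 2 = h1NormSq (toPair p).1 + ‖(toPair p).2‖ ^ 2 := by
  rw [WithLp.prod_norm_sq_eq_of_L2, toPair, h1NormSq_toH1, norm_fourierInv]

/-- The kernels that detect concentration in `Y × Y`. -/
def detector (χ : Cutoff) : ℕ ⊕ ℕ → PhaseSpace :=
  Sum.elim (fun k => WithLp.toLp 2 ((DyadicSymbol.littlewoodPaley χ).smooth.kernel k, 0))
    fun k => WithLp.toLp 2 (0, (DyadicSymbol.littlewoodPaley χ).kernel k)

theorem norm_detector_le (χ : Cutoff) (i : ℕ ⊕ ℕ) : ‖detector χ i‖ ≤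
    8 * √(volume.real (Metric.ball (0 : R4) 1)) * ((1 : ℝ) / 4) ^ (Sum.elim id id i) := by
  rcases i with k | k
  · rw [detector, Sum.elim_inl, WithLp.norm_toLp_fst]
    exact DyadicSymbol.norm_kernel_le _ k
  · rw [detector, Sum.elim_inr, WithLp.norm_toLp_snd]
    exact DyadicSymbol.norm_kernel_le _ k

theorem tendsto_norm_detector (χ : Cutoff) :
    Tendsto (fun i => ‖detector χ i‖) cofinite (𝓝 0) := by
  have h1 : Tendsto (Sum.elim id id : ℕ ⊕ ℕ → ℕ) cofinite atTop := by
    rw [← Nat.cofinite_eq_atTop]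
    refine Tendsto.cofinite_of_finite_preimage_singleton fun b => ?_
    refine ((Set.finite_singleton (Sum.inr b)).insert (Sum.inl b)).subset ?_
    rintro (k | k) hk
    · exact Or.inl (congrArg Sum.inl hk)
    · exact Or.inr (congrArg Sum.inr hk)
  have h2 := ((tendsto_pow_atTop_nhds_zero_of_lt_one (r := (1 : ℝ) / 4) (by norm_num)
    (by norm_num)).comp h1).const_mul (8 * √(volume.real (Metric.ball (0 : R4) 1)))
  rw [mul_zero] at h2
  exact squeeze_zero (fun _ => norm_nonneg _) (norm_detector_le χ) h2

/-- The norm of the free evolution in `Y × Y`. -/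
def freeY (χ : Cutoff) (p : H1 × L2) : ℝ≥0∞ :=
  yNorm χ (fun t => schrodinger t p.1) + yNorm χ (fun t => halfWave t p.2)

theorem freeY_le (χ : Cutoff) (p : PhaseSpace) (c : ℝ)
    (hc : ∀ i a, ‖inner ℂ (detector χ i) (symmetry (-a) p)‖ ≤ c) :
    freeY χ (toPair p) ≤ ENNReal.ofReal c := by
  have hc0 : 0 ≤ c := (norm_nonneg _).trans (hc (Sum.inl 0) 0)
  have h1 : yNorm χ (fun t => schrodinger t (toH1 p.fst)) ≤ ENNReal.ofReal (c / 2) := by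
    refine yNorm_le χ schrodingerPhase_isTranslation _ p.fst
      (fun k t => lpProj_schrodinger χ k t p.fst) fun k a => ?_
    simpa [detector, symmetry, WithLp.prod_inner_apply] using! hc (Sum.inl k) a
  have h2 : yNorm χ (fun t => halfWave t (𝓕⁻ p.snd)) ≤ ENNReal.ofReal (c / 2) := by
    refine yNorm_le χ wavePhase_isTranslation _ p.snd
      (fun k t => lpProj_halfWave χ k t p.snd) fun k a => ?_
    simpa [detector, symmetry, WithLp.prod_inner_apply] using! hc (Sum.inr k) a
  refine (add_le_add h1 h2).trans_eq ?_
  rw [← ENNReal.ofReal_add (by positivity) (by positivity), add_halves]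

/-! ### Conclusion -/

/-- Telescoping of the one-profile decouplings. B may depend on n, as the energy of a moving profile
does. -/
theorem tendsto_sub_sum {A B : ℕ → ℕ → ℝ}
    (h : ∀ J, Tendsto (fun n => A J n - B J n - A (J + 1) n) atTop (𝓝 0)) (J : ℕ) :
    Tendsto (fun n => A 0 n - ∑ j ∈ Finset.range J, B j n - A J n) atTop (𝓝 0) := by
  induction J with
  | zero => simp
  | succ J ih =>
    refine (add_zero (0 : ℝ) ▸ ih.add (h J)).congr fun n => ?_
    rw [Finset.sum_range_succ]
    ring

theorem tendsto_add_norm_of_cocompact {a b : ℕ → ℝ × R4}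
    (h : Tendsto (fun n => a n - b n) atTop (cocompact (ℝ × R4))) :
    Tendsto (fun n => |(a n).1 - (b n).1| + ‖(a n).2 - (b n).2‖) atTop atTop := by
  refine tendsto_atTop_mono (fun n => ?_) (tendsto_norm_cocompact_atTop.comp h)
  rw [Function.comp_apply, Prod.norm_def]
  exact max_le (le_add_of_nonneg_right (norm_nonneg _)) (le_add_of_nonneg_left (abs_nonneg _))

section PairDecoupling

variable {P : PhaseSpace} {a : ℕ → ℝ × R4} {u r : ℕ → PhaseSpace}
  (hu : ∀ n, u n = symmetry (a n) P + r n)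

include hu

theorem tendsto_h1NormSq_decoupling
    (hr : TendstoWeakly atTop (fun n => symmetry (-(a n)) (r n)) 0) :
    Tendsto (fun n => h1NormSq (toPair (u n)).1 - h1NormSq (toPair P).1
      - h1NormSq (toPair (r n)).1) atTop (𝓝 0) := by
  refine (schrodingerPhase.rep.norm_sq_decoupling (p := P.fst) hr.fst).congr fun n => ?_
  rw [toPair, toPair, toPair, h1NormSq_toH1, h1NormSq_toH1, h1NormSq_toH1, hu]
  rfl

theorem tendsto_norm_sq_snd_decoupling
    (hr : TendstoWeakly atTop (fun n => symmetry (-(a n)) (r n)) 0) :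
    Tendsto (fun n => ‖(toPair (u n)).2‖ ^ 2 - ‖(toPair P).2‖ ^ 2
      - ‖(toPair (r n)).2‖ ^ 2) atTop (𝓝 0) := by
  refine (wavePhase.rep.norm_sq_decoupling (p := P.snd) hr.snd).congr fun n => ?_
  rw [toPair, toPair, toPair, norm_fourierInv, norm_fourierInv, norm_fourierInv, hu]
  rfl

/-- Unlike the two quadratic quantities, the cubic term needs normalised times and bounded
remainders. -/
theorem tendsto_energy_toPair_decoupling
    (ha : (∀ n, (a n).1 = 0) ∨ Tendsto (fun n => |(a n).1|) atTop atTop) {M : ℝ}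
    (hM : ∀ n, ‖r n‖ ≤ M) (hr : TendstoWeakly atTop (fun n => symmetry (-(a n)) (r n)) 0) :
    Tendsto (fun n => energy (toPair (u n)).1 (toPair (u n)).2
      - energy (groupElement (a n).1 (a n).2 (toPair P)).1
          (groupElement (a n).1 (a n).2 (toPair P)).2
      - energy (toPair (r n)).1 (toPair (r n)).2) atTop (𝓝 0) := by
  refine (tendsto_energy_decoupling P.fst P.snd ha
    (fun n => (WithLp.norm_fst_le _ (r n)).trans (hM n))
    (fun n => (WithLp.norm_snd_le _ (r n)).trans (hM n)) hr.fst hr.snd).congr fun n => ?_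
  rw [← toPair_symmetry, hu]
  rfl

end PairDecoupling

end Zakharov

end

theorem theorem6p1 (χ : Zakharov.Cutoff) (f : ℕ → Zakharov.H1) (g : ℕ → Zakharov.L2)
    (hbdd : ∃ A : ℝ, ∀ n, Zakharov.h1NormSq (f n) + ‖g n‖ ^ 2 ≤ A) :
    ∃ (φ : ℕ → ℕ) (Jstar : ℕ∞) (P : ℕ → Zakharov.H1 × Zakharov.L2)
      (t : ℕ → ℕ → ℝ) (x : ℕ → ℕ → Zakharov.R4)
      (w : ℕ → ℕ → Zakharov.H1) (e : ℕ → ℕ → Zakharov.L2),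
      -- the subsequence, and the profiles `P j`, `0 ≤ j < J*`, all of them non-zero
      StrictMono φ ∧
      (∀ j : ℕ, (j : ℕ∞) < Jstar → P j ≠ 0) ∧
      -- the decomposition, which defines the remainders `(w J n, e J n)`
      (∀ J n : ℕ, (f (φ n), g (φ n)) =
        ∑ j ∈ Finset.range J, Zakharov.groupElement (t j n) (x j n) (P j) + (w J n, e J n)) ∧
      -- decoupling of the `H¹` norm, of the `L²` norm and of the energy
      (∀ J : ℕ, (J : ℕ∞) ≤ Jstar →
        Tendsto (fun n => Zakharov.h1NormSq (f (φ n))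
          - ∑ j ∈ Finset.range J, Zakharov.h1NormSq (P j).1
          - Zakharov.h1NormSq (w J n)) atTop (𝓝 0) ∧
        Tendsto (fun n => ‖g (φ n)‖ ^ 2 - ∑ j ∈ Finset.range J, ‖(P j).2‖ ^ 2
          - ‖e J n‖ ^ 2) atTop (𝓝 0) ∧
        Tendsto (fun n => Zakharov.energy (f (φ n)) (g (φ n))
          - ∑ j ∈ Finset.range J, Zakharov.energy
              (Zakharov.groupElement (t j n) (x j n) (P j)).1
              (Zakharov.groupElement (t j n) (x j n) (P j)).2
          - Zakharov.energy (w J n) (e J n)) atTop (𝓝 0)) ∧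
      -- `lim_{J → J*}`: the value at `J = J*` if `J*` is finite, the limit `J → ∞` otherwise
      (∀ J : ℕ, Jstar = J → Zakharov.limsupFreeY χ (fun n => (w J n, e J n)) = 0) ∧
      (Jstar = ⊤ →
        Tendsto (fun J : ℕ => Zakharov.limsupFreeY χ (fun n => (w J n, e J n))) atTop (𝓝 0)) ∧
      -- asymptotic orthogonality and normalisation of the parameters
      (∀ j k : ℕ, (j : ℕ∞) < Jstar → (k : ℕ∞) < Jstar → j ≠ k →
        Tendsto (fun n => |t j n - t k n| + ‖x j n - x k n‖) atTop atTop) ∧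
      (∀ j : ℕ, (j : ℕ∞) < Jstar →
        (∀ n, t j n = 0) ∨ Tendsto (fun n => |t j n|) atTop atTop) := by
  obtain ⟨A, hA⟩ := hbdd
  choose u hu using fun n => Zakharov.exists_toPair (f n, g n)
  have hM : ∀ n, ‖u n‖ ≤ √A := fun n => by
    refine Real.le_sqrt_of_sq_le ?_
    rw [Zakharov.norm_sq_phaseSpace, hu]
    exact hA n
  -- The constant bounds all detectors at once, since their norms carry the factor (1 / 4) ^ k ≤ 1.
  obtain ⟨φ, Jstar, P, a, r, hφ, hr0, hr, hbd, hweak, hP, hfin, hinf, horth, htime⟩ :=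
    Zakharov.exists_profile_decomposition Zakharov.symmetry (Zakharov.detector χ)
      (Zakharov.tendsto_norm_detector χ) (8 * √(volume.real (Metric.ball (0 : Zakharov.R4) 1)))
      (fun i => (Zakharov.norm_detector_le χ i).trans
        (mul_le_of_le_one_right (by positivity) (pow_le_one₀ (by norm_num) (by norm_num))))
      (fun p => Zakharov.freeY χ (Zakharov.toPair p)) (Zakharov.freeY_le χ) u (√A) hM
  have hstep : ∀ J n, Zakharov.toPair (r J n) =
      Zakharov.groupElement (a J n).1 (a J n).2 (Zakharov.toPair (P J)) +
        Zakharov.toPair (r (J + 1) n) := fun J n => by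
    rw [hr, Zakharov.toPair_add, Zakharov.toPair_symmetry]
  have h0 : ∀ n, Zakharov.toPair (r 0 n) = (f (φ n), g (φ n)) := fun n => by rw [hr0, hu]
  refine ⟨φ, Jstar, fun j => Zakharov.toPair (P j), fun j n => (a j n).1, fun j n => (a j n).2,
    fun J n => (Zakharov.toPair (r J n)).1, fun J n => (Zakharov.toPair (r J n)).2, hφ,
    fun j hj => Zakharov.toPair_ne_zero (hP j hj), fun J n => ?_, fun J _ => ⟨?_, ?_, ?_⟩,
    hfin, hinf, fun j k hj hk hjk => Zakharov.tendsto_add_norm_of_cocompact (horth j k hj hk hjk),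
    fun j _ => htime j⟩
  · rw [← h0, Prod.mk.eta]
    induction J with
    | zero => simp
    | succ J ih => rw [ih, hstep, Finset.sum_range_succ, add_assoc]
  · refine (Zakharov.tendsto_sub_sum (A := fun J n => Zakharov.h1NormSq (Zakharov.toPair (r J n)).1)
      (B := fun J _ => Zakharov.h1NormSq (Zakharov.toPair (P J)).1) (fun J => ?_) J).congr
      fun n => by rw [h0]
    exact Zakharov.tendsto_h1NormSq_decoupling (hr J) (hweak J)
  · refine (Zakharov.tendsto_sub_sum (A := fun J n => ‖(Zakharov.toPair (r J n)).2‖ ^ 2)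
      (B := fun J _ => ‖(Zakharov.toPair (P J)).2‖ ^ 2) (fun J => ?_) J).congr
      fun n => by rw [h0]
    exact Zakharov.tendsto_norm_sq_snd_decoupling (hr J) (hweak J)
  · refine (Zakharov.tendsto_sub_sum
      (A := fun J n => Zakharov.energy (Zakharov.toPair (r J n)).1 (Zakharov.toPair (r J n)).2)
      (B := fun J n => Zakharov.energy
        (Zakharov.groupElement (a J n).1 (a J n).2 (Zakharov.toPair (P J))).1
        (Zakharov.groupElement (a J n).1 (a J n).2 (Zakharov.toPair (P J))).2)
      (fun J => ?_) J).congr fun n => by rw [h0]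
    obtain ⟨M, hM⟩ := hbd (J + 1)
    exact Zakharov.tendsto_energy_toPair_decoupling (hr J) (htime J) hM (hweak J)
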